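/- **Setting.** Let $\Lambda\subset\mathbb R^2$ be a lattice with point defects: for a non-singular $A\in\mathbb R^{2\times2}$ and some $R_{\rm DEF}>0$, $\Lambda\cap B_{R_{\rm DEF}}$ is finite and $\Lambda\setminus B_{R_{\rm DEF}}=A\mathbb Z^2\setminus B_{R_{\rm DEF}}$. For $\ell\in\Lambda$ let $\mathcal R_\ell=\{\ell'-\ell:\ell'\in\Lambda,\ 0<|\ell'-\ell|\le r_{\rm cut}\}$ and $Du(\ell)=(u(\ell+\rho)-u(\ell))_{\rho\in\mathcal R_\ell}$ for $u:\Lambda\to\mathbb R^2$; let $\mathcal R$ be the interaction range of $A\mathbb Z^2$. The site potentials $V_\ell:(\mathbb R^2)^{\mathcal R_\ell}\to\mathbb R$ are $C^2$, satisfy $V_\ell(0)=0$, and coincide with one homogeneous potential $V$ on $(\mathbb R^2)^{\mathcal R}$ for all $\ell$ far from the defect. Let $\mathcal T_\Lambda$ be a triangulation of $\mathbb R^2$ with vertex set $\Lambda$, with triangles of bounded diameter and of area bounded below; let $\zeta_\ell$ be its $\mathcal P_1$ hat functions and $I_{\rm a}u=\sum_\ell u(\ell)\zeta_\ell$ (for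 a function $u$ on $\mathbb R^2$, $I_{\rm a}u$ is formed from $u|_\Lambda$). Put $\|u\|_{\mathscr U^{1,2}}=\|\nabla I_{\rm a}u\|_{L^2(\mathbb R^2)}$ and $\mathscr U^{1,2}=\{u:\|u\|_{\mathscr U^{1,2}}<\infty\}$. The energy is $\mathcal E^{\rm a}(u)=\sum_{\ell\in\Lambda}V_\ell(Du(\ell))$, understood on $\mathscr U^{1,2}$ as $\sum_\ell V''_\ell(Du(\ell))+\langle\delta\mathcal E^{\rm a}(0),u\rangle$ with $V''_\ell(g)=V_\ell(g)-\langle\delta V_\ell(0),g\rangle$, which is the same for compactly supported $u$. Let $u^{\rm a}\in\mathscr U^{1,2}$ be a local minimizer of $\mathcal E^{\rm a}$ in $\mathscr U^{1,2}$ that is strongly stable: there is $\gamma>0$ with $\langle\delta^2\mathcal E^{\rm a}(u^{\rm a})v,v\rangle\ge\gamma\|v\|_{\mathscr U^{1,2}}^2$ for all $v\in\mathscr U^{1,2}$. **Blended methods.** Let $\Omega_h=\Omega^{\rm a}\cup\Omega^{\rm b}\cup\Omega^{\rm c}$ (atomistic, blending and continuum regions) be triangulated by a finite mesh $\mathcal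 T_h$ with ${\rm DoF}$ nodes, which consists of the triangles of $\mathcal T_\Lambda$ with vertices in $\Omega^{\rm a}\cup\Omega^{\rm b}$ and of further triangles in $\overline{\Omega^{\rm c}}$; let $\beta\in C^{2,1}(\mathbb R^2)$ with $\beta=0$ on $\Omega^{\rm a}$, $\beta=1$ on $\Omega^{\rm c}$, ${\rm supp}\,\nabla\beta\subset\Omega^{\rm b}$. Let $\mathscr U_h^{(1)}$ be the continuous functions $u_h:\mathbb R^2\to\mathbb R^2$ that are affine on each $T\in\mathcal T_h$ and vanish outside $\Omega_h$; $\mathscr U_h^{(2)}$ is the same with $\mathcal P_2$ instead of $\mathcal P_1$ on the triangles on which $\beta<1$ holds nowhere. Put $W(F)=|\det A|^{-1}V((F\rho)_{\rho\in\mathcal R})$, $W''(F)=W(F)-\langle\delta W(0),F\rangle$ and $$\mathcal E^{\rm bqce}_h(u_h)=\sum_{\ell\in\Lambda\cap\Omega_h}(1-\beta(\ell))V_\ell(Du_h(\ell))+\int_{\Omega_h}Q_h[\beta W(\nabla u_h)]\,dx ,$$ with $\mathcal E^{\rm bgfc}_h$ the same expression with $V''_\ell,W''$ in place of $V_\ell,W$.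 Here $Q_h$ is the midpoint rule on each triangle for $\mathscr U_h^{(1)}$, and any rule on the triangles that is exact for polynomials of degree $\le2$ for $\mathscr U_h^{(2)}$. The methods are BQCE ($\mathcal E_h^\beta=\mathcal E_h^{\rm bqce}$ on $\mathscr U_h^{(1)}$), P1-BGFC and P2-BGFC ($\mathcal E_h^\beta=\mathcal E_h^{\rm bgfc}$ on $\mathscr U_h^{(1)}$, $\mathscr U_h^{(2)}$); a solution $u_h$ is a local minimizer of $\mathcal E_h^\beta$ over the space. It is called consistent with constant $K$ if $\|u^{\rm a}-u_h\|_{\mathscr U^{1,2}}\le K\,{\rm DoF}^{\,r}$ with $r=-\tfrac12,-1,-\tfrac32$ for BQCE, P1-BGFC, P2-BGFC. **Estimators.** Let $\Omega\supset\Omega_h$ be a finite union of triangles of $\mathcal T_\Lambda$ with $B_{R_\Omega}\subset\Omega\subset B_{2R_\Omega}$, $R_\Omega>0$. Let $\mathcal F^{\rm a}_\ell=\partial_{u(\ell)}\mathcal E^{\rm a}(u)|_{u=I_{\rm a}u_h}$ be the residual forces and $\widehat{\mathcal F}^{\rm a}=\sum_\ell c_\ell\mathcal F^{\rm a}_\ell\zeta_\ell$,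 $c_\ell=(\int\zeta_\ell)^{-1}$. The domain $\Omega$ is assumed to be so large that $\mathcal F^{\rm a}_\ell=0$ for all $\ell\in\Lambda\setminus\Omega$. Let $\phi_{\rm a}$ be the $\mathcal P_1(\mathcal T_\Lambda)$ function on $\Omega$, vanishing on $\partial\Omega$, with $\int_\Omega\nabla\phi_{\rm a}\cdot\nabla v\,dx=\int_\Omega\widehat{\mathcal F}^{\rm a}\cdot v\,dx$ for all such $v$, and put $$\eta(u_h)=\|\nabla\phi_{\rm a}\|_{L^2(\Omega)},\qquad \rho_{\rm tr}(u_h)=R_\Omega\|\widehat{\mathcal F}^{\rm a}\|_{L^2(\Omega\setminus B_{R_\Omega/2})}+\|\nabla\phi_{\rm a}\|_{L^2(\Omega\setminus B_{R_\Omega/2})},\qquad \mu_{\rm E}(u_h)=\mathcal E^{\rm a}(I_{\rm a}u_h)-\mathcal E^\beta_h(u_h).$$ **Theorem.** There is a constant $C_{\rm E}>0$, independent of the approximation parameters (the method, the mesh, the regions, $\beta$, $Q_h$, $\Omega$, $u_h$), such that for every $K>0$ there is $N_0$ such that every solution $u_h$ of BQCE, P1-BGFC or P2-BGFC that is consistent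 with constant $K$, with ${\rm DoF}\ge N_0$, satisfies, for every $\Omega$ as above, $$|\mathcal E^{\rm a}(u^{\rm a})-\mathcal E^\beta_h(u_h)|\le C_{\rm E}\big(\eta(u_h)^2+\rho_{\rm tr}(u_h)^2\big)+|\mu_{\rm E}(u_h)| .$$ -/

import Mathlib

open Set MeasureTheory Filter Topology

noncomputable section

/-- The plane `ℝ²` with its Euclidean norm. -/
abbrev Plane : Type := EuclideanSpace ℝ (Fin 2)

/-! ### Gradients in `L²` -/

/-- Frobenius inner product of two linear maps of the plane. -/
def frob (F G : Plane →L[ℝ] Plane) : ℝ :=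
  ∑ i : Fin 2, inner ℝ (F (EuclideanSpace.single i 1)) (G (EuclideanSpace.single i 1))

/-- The Dirichlet form `∫_S ∇f : ∇g`. -/
def dirichlet (S : Set Plane) (f g : Plane → Plane) : ℝ :=
  ∫ x in S, frob (fderiv ℝ f x) (fderiv ℝ g x)

/-- `‖∇f‖_{L²(S)}`. -/
def gradNorm (S : Set Plane) (f : Plane → Plane) : ℝ := √(dirichlet S f f)

/-! ### The lattice -/

/-- The Bravais lattice `A ℤ²`. -/
def homLattice (A : Matrix (Fin 2) (Fin 2) ℝ) : Set Plane :=
  {x | ∃ z : Fin 2 → ℤ, x = WithLp.toLp 2 (A.mulVec fun i => (z i : ℝ))}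

/-- The interaction range `{ℓ' - ℓ | ℓ' ∈ S, 0 < |ℓ' - ℓ| ≤ r}` of a point `ℓ`. -/
def interactionRange (S : Set Plane) (r : ℝ) (ℓ : Plane) : Set Plane :=
  {ρ | 0 < ‖ρ‖ ∧ ‖ρ‖ ≤ r ∧ ℓ + ρ ∈ S}

/-- A single lattice with point defects inside the ball of radius `rDef`. -/
structure DefectLattice where
  A : Matrix (Fin 2) (Fin 2) ℝ
  det_ne_zero : A.det ≠ 0
  sites : Set Plane
  rDef : ℝ
  rDef_pos : 0 < rDef
  finite_core : (sites ∩ Metric.closedBall 0 rDef).Finite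
  far_eq : sites \ Metric.closedBall 0 rDef = homLattice A \ Metric.closedBall 0 rDef

theorem homLattice_inter_ball_finite (A : Matrix (Fin 2) (Fin 2) ℝ) (hA : A.det ≠ 0)
    (c : Plane) (r : ℝ) : (homLattice A ∩ Metric.closedBall c r).Finite := by
  let f : Plane → (Fin 2 → ℝ) := fun x => A⁻¹.mulVec (WithLp.ofLp x)
  have hf : Continuous f := by
    have h1 : Continuous fun x : Plane => WithLp.ofLp x := PiLp.continuous_ofLp 2 _
    exact Continuous.matrix_mulVec continuous_const h1
  have hK : IsCompact (f '' Metric.closedBall c r) := (isCompact_closedBall c r).image hf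
  obtain ⟨M, hM⟩ := hK.isBounded.exists_norm_le
  have hfin : (Set.Icc (fun _ : Fin 2 => -⌈M⌉) (fun _ => ⌈M⌉)).Finite := Set.finite_Icc _ _
  refine (hfin.image fun z : Fin 2 → ℤ =>
    (WithLp.toLp 2 (A.mulVec fun i => (z i : ℝ)) : Plane)).subset ?_
  rintro x ⟨⟨z, rfl⟩, hx⟩
  refine ⟨z, ?_, rfl⟩
  have h1 := hM _ ⟨_, hx, rfl⟩
  have h2 : f (WithLp.toLp 2 (A.mulVec fun i => (z i : ℝ))) = fun i => (z i : ℝ) := by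
    simp only [f, Matrix.mulVec_mulVec]
    rw [Matrix.nonsing_inv_mul _ (isUnit_iff_ne_zero.mpr hA), Matrix.one_mulVec]
  rw [h2] at h1
  have h3 : ∀ i, |(z i : ℝ)| ≤ M := fun i => (norm_le_pi_norm (fun i => (z i : ℝ)) i).trans h1
  refine ⟨fun i => ?_, fun i => ?_⟩
  · have h4 := (abs_le.mp (h3 i)).1
    have h5 : -(⌈M⌉ : ℝ) ≤ z i := by linarith [Int.le_ceil M]
    exact_mod_cast h5
  · have h4 := (abs_le.mp (h3 i)).2
    have h5 : (z i : ℝ) ≤ (⌈M⌉ : ℝ) := by linarith [Int.le_ceil M]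
    exact_mod_cast h5

theorem interactionRange_finite {S : Set Plane}
    (hS : ∀ (c : Plane) (r : ℝ), (S ∩ Metric.closedBall c r).Finite) (r : ℝ) (ℓ : Plane) :
    (interactionRange S r ℓ).Finite := by
  refine ((hS ℓ r).image fun x => x - ℓ).subset ?_
  rintro ρ ⟨-, h2, h3⟩
  exact ⟨ℓ + ρ, ⟨h3, by simpa using h2⟩, by simp⟩

theorem DefectLattice.inter_ball_finite (L : DefectLattice) (c : Plane) (r : ℝ) :
    (L.sites ∩ Metric.closedBall c r).Finite := by
  refine (L.finite_core.union (homLattice_inter_ball_finite L.A L.det_ne_zero c r)).subset ?_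
  rintro x ⟨h1, h2⟩
  by_cases h : x ∈ Metric.closedBall (0 : Plane) L.rDef
  · exact Or.inl ⟨h1, h⟩
  · have h3 : x ∈ L.sites \ Metric.closedBall 0 L.rDef := ⟨h1, h⟩
    rw [L.far_eq] at h3
    exact Or.inr ⟨h3.1, h2⟩

/-- The interaction range of a site of the defective lattice. -/
abbrev DefectLattice.range (L : DefectLattice) (r : ℝ) (ℓ : L.sites) : Set Plane :=
  interactionRange L.sites r ℓ

/-- The interaction range of the defect-free lattice. -/
abbrev DefectLattice.homRange (L : DefectLattice) (r : ℝ) : Set Plane :=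
  interactionRange (homLattice L.A) r 0

instance (L : DefectLattice) (r : ℝ) (ℓ : L.sites) : Fintype (L.range r ℓ) :=
  (interactionRange_finite L.inter_ball_finite r ℓ).fintype

instance (L : DefectLattice) (r : ℝ) : Fintype (L.homRange r) :=
  (interactionRange_finite (homLattice_inter_ball_finite L.A L.det_ne_zero) r 0).fintype

/-- The finite difference stencil `Du(ℓ) = (u(ℓ+ρ) - u(ℓ))_ρ`. -/
def DefectLattice.D (L : DefectLattice) (r : ℝ) (u : L.sites → Plane) (ℓ : L.sites) :
    L.range r ℓ → Plane :=
  fun ρ => u ⟨ℓ + ρ, ρ.2.2.2⟩ - u ℓ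

/-! ### The background mesh and the nodal interpolant -/

/-- The triangles of a simplicial complex in the plane. -/
def triangles (K : Geometry.SimplicialComplex ℝ Plane) : Set (Finset Plane) :=
  {t | t ∈ K.faces ∧ t.card = 3}

/-- The closed triangle with the given vertices. -/
def tri (t : Finset Plane) : Set Plane := convexHull ℝ (t : Set Plane)

/-- `w` is the family of barycentric coordinates of `x` in the complex `K`: `x` is a convex
combination, with positive coefficients, of the vertices of a face of `K`. -/
def IsBarycentric (K : Geometry.SimplicialComplex ℝ Plane) (x : Plane) (w : Plane →₀ ℝ) : Prop :=
  (∀ p, 0 ≤ w p) ∧ w.support ∈ K.faces ∧ ∑ p ∈ w.support, w p = 1 ∧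
    ∑ p ∈ w.support, w p • p = x

theorem IsBarycentric.unique {K : Geometry.SimplicialComplex ℝ Plane} {x : Plane}
    {w w' : Plane →₀ ℝ} (h : IsBarycentric K x w) (h' : IsBarycentric K x w') : w = w' := by
  classical
  have key : ∀ w : Plane →₀ ℝ, IsBarycentric K x w → ∀ r : Finset Plane, r ⊆ w.support →
      ∀ v : Plane → ℝ, ∑ p ∈ r, v p = 1 → ∑ p ∈ r, v p • p = x →
        ∀ p, w p = if p ∈ r then v p else 0 := by
    rintro w ⟨-, hs, h1, hx⟩ r hr v hv1 hvx p
    have hind := K.indep hs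
    by_cases hp : p ∈ w.support
    · have hcut : ∀ f : Plane → ℝ,
          ∑ q ∈ w.support, (if q ∈ r then f q else 0) = ∑ q ∈ r, f q := by
        intro f
        rw [← Finset.sum_filter, Finset.filter_mem_eq_inter, Finset.inter_eq_right.mpr hr]
      have hcut' : ∑ q ∈ w.support, ((if q ∈ r then v q else 0) • q) = ∑ q ∈ r, v q • q := by
        simp only [ite_smul, zero_smul]
        rw [← Finset.sum_filter, Finset.filter_mem_eq_inter, Finset.inter_eq_right.mpr hr]
      have := (affineIndependent_iff (k := ℝ)).mp hind Finset.univ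
        (fun q => w q - if (q : Plane) ∈ r then v q else 0)
        (by
          rw [Finset.univ_eq_attach,
            Finset.sum_attach w.support fun q => w q - if q ∈ r then v q else 0,
            Finset.sum_sub_distrib, hcut, h1, hv1, sub_self])
        (by
          rw [Finset.univ_eq_attach,
            Finset.sum_attach w.support fun q => (w q - if q ∈ r then v q else 0) • q]
          simp only [sub_smul]
          rw [Finset.sum_sub_distrib, hcut', hx, hvx, sub_self])
        ⟨p, hp⟩ (Finset.mem_univ _)
      exact sub_eq_zero.mp this
    · rw [if_neg fun h => hp (hr h)]
      simpa using hp
  have hmem : ∀ w : Plane →₀ ℝ, IsBarycentric K x w →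
      x ∈ convexHull ℝ (w.support : Set Plane) := by
    rintro w ⟨h0, -, h1, hx⟩
    exact Finset.mem_convexHull'.mpr ⟨w, fun y _ => h0 y, h1, hx⟩
  have hint := K.inter_subset_convexHull h.2.1 h'.2.1 ⟨hmem w h, hmem w' h'⟩
  rw [← Finset.coe_inter] at hint
  obtain ⟨v, -, hv1, hvx⟩ := Finset.mem_convexHull'.mp hint
  ext p
  rw [key w h _ Finset.inter_subset_left v hv1 hvx p,
    key w' h' _ Finset.inter_subset_right v hv1 hvx p]

open Classical in
/-- The `P₁` hat function `ζ_p` of the vertex `p`. -/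
def hat (K : Geometry.SimplicialComplex ℝ Plane) (p x : Plane) : ℝ :=
  if h : ∃ w, IsBarycentric K x w then h.choose p else 0

/-- A triangulation of the plane whose set of vertices is the lattice, with triangles of
bounded diameter and of area bounded below. -/
structure BackgroundMesh (L : DefectLattice) where
  K : Geometry.SimplicialComplex ℝ Plane
  vertices_eq : K.vertices = L.sites
  cover : ∀ x, ∃ t ∈ triangles K, x ∈ tri t
  diam_le : ∃ d : ℝ, ∀ t ∈ triangles K, Metric.diam (tri t) ≤ d
  area_ge : ∃ a : ℝ, 0 < a ∧ ∀ t ∈ triangles K, a ≤ volume.real (tri t)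

namespace BackgroundMesh

variable {L : DefectLattice} (T : BackgroundMesh L)

/-- The hat function of a site. -/
def zeta (ℓ : L.sites) (x : Plane) : ℝ := hat T.K ℓ x

/-- The nodal interpolant `I_a u`. -/
def interp (u : L.sites → Plane) (x : Plane) : Plane := ∑ᶠ ℓ : L.sites, T.zeta ℓ x • u ℓ

/-- The space of displacements of finite energy: `‖∇ I_a u‖_{L²(ℝ²)} < ∞`. -/
def IsU12 (u : L.sites → Plane) : Prop :=
  Integrable fun x => frob (fderiv ℝ (T.interp u) x) (fderiv ℝ (T.interp u) x)

/-- The norm `‖u‖_{U^{1,2}} = ‖∇ I_a u‖_{L²(ℝ²)}`. -/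
def normU12 (u : L.sites → Plane) : ℝ := gradNorm univ (T.interp u)

end BackgroundMesh

/-! ### The atomistic model -/

/-- Site potentials with a finite cut-off radius, which coincide with one homogeneous potential
`Vhom` far from the defect. -/
structure SitePotential (L : DefectLattice) where
  rcut : ℝ
  rcut_pos : 0 < rcut
  V : (ℓ : L.sites) → (L.range rcut ℓ → Plane) → ℝ
  Vhom : (L.homRange rcut → Plane) → ℝ
  contDiff : ∀ ℓ, ContDiff ℝ 2 (V ℓ)
  zero : ∀ ℓ, V ℓ 0 = 0
  far : ∃ R : ℝ, ∀ ℓ : L.sites, R < ‖(ℓ : Plane)‖ →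
    ∀ g : Plane → Plane, V ℓ (fun ρ => g ρ) = Vhom (fun ρ => g ρ)

namespace SitePotential

variable {L : DefectLattice} (P : SitePotential L)

/-- The finite difference stencil `Du(ℓ)` at the cut-off radius of the potential. -/
abbrev D (u : L.sites → Plane) (ℓ : L.sites) : L.range P.rcut ℓ → Plane := L.D P.rcut u ℓ

/-- The renormalised site energy `V''_ℓ(g) = V_ℓ(g) - ⟨δV_ℓ(0), g⟩`. -/
def V2 (ℓ : L.sites) (g : L.range P.rcut ℓ → Plane) : ℝ := P.V ℓ g - fderiv ℝ (P.V ℓ) 0 g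

/-- The sum `∑_ℓ V_ℓ(Du(ℓ))`, which has finitely many non-zero terms if `u` is constant outside
a ball. -/
def formalEnergy (u : L.sites → Plane) : ℝ := ∑ᶠ ℓ : L.sites, P.V ℓ (P.D u ℓ)

open Classical in
/-- The displacement that is `a` at the site `ℓ` and vanishes at the other sites. -/
def bump (ℓ : L.sites) (a : Plane) : L.sites → Plane := fun m => if m = ℓ then a else 0

/-- The derivative of the energy with respect to `u(ℓ)` at the reference state `u = 0`. It
vanishes for all sites far from the defect. -/
def refForce (ℓ : L.sites) : Plane := gradient (fun a => P.formalEnergy (bump ℓ a)) 0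

/-- The energy difference functional `E^a(u) = ∑_ℓ V_ℓ(Du(ℓ))`. For a general displacement of
finite energy this series is a formal one; its value is that of the continuous extension from
displacements with compact support, which is `∑_ℓ V''_ℓ(Du(ℓ)) + ⟨δE^a(0), u⟩`. -/
def energy (u : L.sites → Plane) : ℝ :=
  (∑' ℓ : L.sites, P.V2 ℓ (P.D u ℓ)) + ∑ᶠ ℓ : L.sites, inner ℝ (P.refForce ℓ) (u ℓ)

theorem finite_D_ne_zero {L : DefectLattice} (P : SitePotential L)
    (S : Finset L.sites) :
    ∃ N : Finset L.sites, ∀ u : L.sites → Plane, (∀ ℓ ∉ S, u ℓ = 0) → ∀ m ∉ N, P.D u m = 0 := by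
  classical
  have hfin : ∀ s : L.sites, {m : L.sites | (m : Plane) ∈ Metric.closedBall (s : Plane) P.rcut}.Finite := by
    intro s
    refine Set.Finite.of_finite_image ((L.inter_ball_finite s P.rcut).subset ?_)
      (Subtype.val_injective.injOn)
    rintro _ ⟨m, hm, rfl⟩
    exact ⟨m.2, hm⟩
  refine ⟨S ∪ S.biUnion fun s => (hfin s).toFinset, fun u hu m hm => ?_⟩
  simp only [Finset.mem_union, Finset.mem_biUnion, Set.Finite.mem_toFinset, not_or, not_exists,
    not_and] at hm
  funext ρ
  have h1 : u m = 0 := hu m hm.1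
  have h2 : u ⟨m + ρ, ρ.2.2.2⟩ = 0 := by
    refine hu _ fun h => hm.2 _ h ?_
    have := ρ.2.2.1
    simpa [dist_eq_norm] using this
  simp [DefectLattice.D, h1, h2]

/-- On displacements with finite support the energy is the sum of the site energies. -/
theorem energy_eq_formalEnergy {L : DefectLattice} (P : SitePotential L)
    (u : L.sites → Plane) (hu : {ℓ | u ℓ ≠ 0}.Finite) : P.energy u = P.formalEnergy u := by
  classical
  set S := hu.toFinset with hS
  have huS : ∀ ℓ ∉ S, u ℓ = 0 := by
    intro ℓ h
    by_contra h'
    exact h (by simpa [hS] using h')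
  obtain ⟨N, hN⟩ := P.finite_D_ne_zero S
  have hDadd : ∀ (m : L.sites) (a b : L.sites → Plane), P.D (a + b) m = P.D a m + P.D b m := by
    intro m a b; funext ρ; simp [DefectLattice.D]; abel
  have hDsmul : ∀ (m : L.sites) (c : ℝ) (a : L.sites → Plane), P.D (c • a) m = c • P.D a m := by
    intro m c a; funext ρ; simp [DefectLattice.D, smul_sub]
  let DL : (m : L.sites) → (L.sites → Plane) →ₗ[ℝ] (L.range P.rcut m → Plane) := fun m =>
    { toFun := fun a => P.D a m, map_add' := hDadd m, map_smul' := hDsmul m }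
  let B : L.sites → Plane →ₗ[ℝ] (L.sites → Plane) := fun ℓ =>
    { toFun := bump ℓ
      map_add' := by intro a b; funext m; by_cases h : m = ℓ <;> simp [bump, h]
      map_smul' := by intro a b; funext m; by_cases h : m = ℓ <;> simp [bump, h] }
  have hB : ∀ ℓ ∈ S, ∀ a m, m ∉ S → bump ℓ a m = 0 := by
    intro ℓ hℓ a m hm
    have : m ≠ ℓ := fun h => hm (h ▸ hℓ)
    simp [bump, this]
  have hzero : ∀ v : L.sites → Plane, (∀ ℓ ∉ S, v ℓ = 0) → ∀ m ∉ N, P.V m (P.D v m) = 0 := by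
    intro v hv m hm
    rw [hN v hv m hm]; exact P.zero m
  have hformal : ∀ v : L.sites → Plane, (∀ ℓ ∉ S, v ℓ = 0) →
      P.formalEnergy v = ∑ m ∈ N, P.V m (P.D v m) := by
    intro v hv
    refine finsum_eq_sum_of_support_subset _ fun m hm => ?_
    by_contra h
    exact hm (hzero v hv m h)
  have hforce : ∀ ℓ ∈ S, ∀ a, inner ℝ (P.refForce ℓ) a
      = ∑ m ∈ N, fderiv ℝ (P.V m) 0 (P.D (bump ℓ a) m) := by
    intro ℓ hℓ a
    have h1 : (fun a => P.formalEnergy (bump ℓ a)) =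
        fun a => ∑ m ∈ N, P.V m ((DL m ∘ₗ B ℓ).toContinuousLinearMap a) := by
      funext a
      exact hformal _ (hB ℓ hℓ a)
    have h2 : HasFDerivAt (fun a => ∑ m ∈ N, P.V m ((DL m ∘ₗ B ℓ).toContinuousLinearMap a))
        (∑ m ∈ N, (fderiv ℝ (P.V m) 0).comp (DL m ∘ₗ B ℓ).toContinuousLinearMap) 0 := by
      refine HasFDerivAt.fun_sum fun m _ => ?_
      refine HasFDerivAt.comp (g := P.V m) 0 ?_ (ContinuousLinearMap.hasFDerivAt _)
      rw [map_zero]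
      exact ((P.contDiff m).differentiable (by norm_num) 0).hasFDerivAt
    rw [SitePotential.refForce, gradient, InnerProductSpace.toDual_symm_apply, h1, h2.fderiv]
    simp
    rfl
  have hsum : u = ∑ ℓ ∈ S, B ℓ (u ℓ) := by
    funext m
    rw [Finset.sum_apply]
    by_cases hm : m ∈ S
    · rw [Finset.sum_eq_single_of_mem m hm]
      · simp [B, bump]
      · intro b _ hb
        simp [B, bump, hb.symm]
    · rw [huS m hm, Finset.sum_eq_zero]
      intro b hb
      exact hB b hb _ m hm
  have hlin : ∑ᶠ ℓ : L.sites, inner ℝ (P.refForce ℓ) (u ℓ)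
      = ∑ m ∈ N, fderiv ℝ (P.V m) 0 (P.D u m) := by
    rw [finsum_eq_sum_of_support_subset (s := S)]
    · rw [Finset.sum_congr rfl fun ℓ hℓ => hforce ℓ hℓ (u ℓ), Finset.sum_comm]
      refine Finset.sum_congr rfl fun m _ => ?_
      rw [← map_sum]
      congr 1
      have : P.D u m = DL m u := rfl
      rw [this]
      conv_rhs => rw [hsum]
      rw [map_sum]
      rfl
    · intro ℓ hℓ
      by_contra h
      exact hℓ (by simp [huS ℓ h])
  have htsum : ∑' ℓ : L.sites, P.V2 ℓ (P.D u ℓ)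
      = ∑ m ∈ N, (P.V m (P.D u m) - fderiv ℝ (P.V m) 0 (P.D u m)) := by
    refine tsum_eq_sum fun m hm => ?_
    rw [SitePotential.V2, hN u huS m hm, P.zero m, map_zero, sub_zero]
  rw [SitePotential.energy, htsum, hlin, hformal u huS, Finset.sum_sub_distrib]
  ring

/-- The residual force `F_ℓ(u) = ∂E^a(u)/∂u(ℓ)`. -/
def force (u : L.sites → Plane) (ℓ : L.sites) : Plane :=
  gradient (fun a => P.energy (u + bump ℓ a)) 0

/-- The second variation `⟨δ²E^a(u) v, v⟩`. -/
def secondVariation (u v : L.sites → Plane) : ℝ :=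
  iteratedDeriv 2 (fun s : ℝ => P.energy (u + s • v)) 0

/-- `u` is a local minimiser of `E^a` in the space of displacements of finite energy. -/
def IsLocalMinimiser (T : BackgroundMesh L) (u : L.sites → Plane) : Prop :=
  T.IsU12 u ∧ ∃ ε > 0, ∀ v, T.IsU12 v → T.normU12 (v - u) < ε → P.energy u ≤ P.energy v

/-- `u` is strongly stable. -/
def IsStronglyStable (T : BackgroundMesh L) (u : L.sites → Plane) : Prop :=
  ∃ γ > 0, ∀ v, T.IsU12 v → γ * T.normU12 v ^ 2 ≤ P.secondVariation u v

/-- The Cauchy–Born energy density `W(F) = V(F R) / |det A|`. -/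
def W (F : Plane →L[ℝ] Plane) : ℝ := |L.A.det|⁻¹ * P.Vhom (fun ρ => F ρ)

/-- The renormalised Cauchy–Born energy density `W''(F) = W(F) - ⟨δW(0), F⟩`. -/
def W2 (F : Plane →L[ℝ] Plane) : ℝ := P.W F - fderiv ℝ P.W 0 F

end SitePotential

/-! ### Blended atomistic-to-continuum methods -/

/-- The data of a blended discretisation: a finite triangulation of `Ω_h`, the atomistic, the
blending and the continuum region, and the blending function `β`. The triangulation consists of
the background triangles with vertices in the atomistic and blending regions, and of arbitrary
triangles that cover the continuum region. -/
structure Discretization {L : DefectLattice} (T : BackgroundMesh L) where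
  mesh : Geometry.SimplicialComplex ℝ Plane
  finite : mesh.faces.Finite
  pure : ∀ s ∈ mesh.faces, ∃ t ∈ triangles mesh, s ⊆ t
  regionA : Set Plane
  regionB : Set Plane
  regionC : Set Plane
  regions : regionA ∪ regionB ∪ regionC = ⋃ t ∈ triangles mesh, tri t
  refined : ∀ t ∈ triangles T.K, (t : Set Plane) ⊆ regionA ∪ regionB → t ∈ mesh.faces
  split : ∀ t ∈ triangles mesh,
    (t ∈ triangles T.K ∧ (t : Set Plane) ⊆ regionA ∪ regionB) ∨ tri t ⊆ closure regionC
  β : Plane → ℝ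
  β_contDiff : ContDiff ℝ 2 β
  β_lipschitz : ∃ C, LipschitzWith C (iteratedFDeriv ℝ 2 β)
  β_A : ∀ x ∈ regionA, β x = 0
  β_C : ∀ x ∈ regionC, β x = 1
  β_supp : tsupport (fderiv ℝ β) ⊆ regionB

/-- `u` is affine on the triangle `t`. -/
def IsP1On (u : Plane → Plane) (t : Finset Plane) : Prop :=
  ∃ f : Plane →ᵃ[ℝ] Plane, EqOn u f (tri t)

/-- `u` is a polynomial of degree at most two on the triangle `t`. -/
def IsP2On (u : Plane → Plane) (t : Finset Plane) : Prop :=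
  ∃ (B : Plane →L[ℝ] Plane →L[ℝ] Plane) (F : Plane →L[ℝ] Plane) (c : Plane),
    ∀ x ∈ tri t, u x = B x x + F x + c

/-- A quadrature rule on triangles that is exact for polynomials of degree at most two (these are
the linear combinations of products of two affine functions). -/
structure QuadratureRule where
  nodes : Finset Plane → Finset Plane
  weight : Finset Plane → Plane → ℝ
  nodes_mem : ∀ t : Finset Plane, AffineIndependent ℝ ((↑) : t → Plane) → t.card = 3 →
    ∀ x ∈ nodes t, x ∈ tri t
  exact_two : ∀ t : Finset Plane, AffineIndependent ℝ ((↑) : t → Plane) → t.card = 3 →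
    ∀ f g : Plane →ᵃ[ℝ] ℝ,
      ∑ x ∈ nodes t, weight t x * (f x * g x) = ∫ x in tri t, f x * g x

/-- The value `∫_T Q[g]` of a quadrature rule on a triangle. -/
def QuadratureRule.apply (Q : QuadratureRule) (t : Finset Plane) (g : Plane → ℝ) : ℝ :=
  ∑ x ∈ Q.nodes t, Q.weight t x * g x

/-- The midpoint rule on triangles. -/
def midpointRule (t : Finset Plane) (g : Plane → ℝ) : ℝ :=
  volume.real (tri t) * g (t.centroid ℝ id)

/-- The blended methods that have an energy functional. -/
inductive BlendedMethod where
  | bqce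
  | bgfcP1
  | bgfcP2 (Q : QuadratureRule)

namespace Discretization

variable {L : DefectLattice} {T : BackgroundMesh L} (d : Discretization T)

/-- The domain `Ω_h`. -/
def domain : Set Plane := ⋃ t ∈ triangles d.mesh, tri t

/-- The number of nodes of the mesh. -/
def dof : ℕ := d.mesh.vertices.ncard

/-- The coarse-grained displacements with `P₁` elements. -/
def space1 : Set (Plane → Plane) :=
  {u | Continuous u ∧ (∀ t ∈ triangles d.mesh, IsP1On u t) ∧ ∀ x ∉ d.domain, u x = 0}

/-- The coarse-grained displacements with `P₁` elements where `β` is not identically one, and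
`P₂` elements elsewhere. -/
def space2 : Set (Plane → Plane) :=
  {u | Continuous u ∧
    (∀ t ∈ triangles d.mesh, (∃ x ∈ tri t, d.β x < 1) → IsP1On u t) ∧
    (∀ t ∈ triangles d.mesh, (¬ ∃ x ∈ tri t, d.β x < 1) → IsP2On u t) ∧
    ∀ x ∉ d.domain, u x = 0}

/-- The space of coarse-grained displacements of a method. -/
def space : BlendedMethod → Set (Plane → Plane)
  | .bqce => d.space1
  | .bgfcP1 => d.space1
  | .bgfcP2 _ => d.space2

/-- The restriction of a displacement field to the lattice sites. -/
def restrict (u : Plane → Plane) : L.sites → Plane := fun ℓ => u ℓ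

/-- `∑_{ℓ ∈ Λ ∩ Ω_h} (1 - β(ℓ)) v_ℓ(Du(ℓ)) + ∫_{Ω_h} Q[β w(∇u)]` for a family of site potentials
`v`, an energy density `w` and a quadrature operator `q`. The gradient in the second term is that
of the polynomial with which `u` coincides on the triangle. -/
def blend (P : SitePotential L) (v : (ℓ : L.sites) → (L.range P.rcut ℓ → Plane) → ℝ)
    (w : (Plane →L[ℝ] Plane) → ℝ) (q : Finset Plane → (Plane → ℝ) → ℝ) (u : Plane → Plane) : ℝ :=
  (∑ᶠ (ℓ : L.sites) (_ : (ℓ : Plane) ∈ d.domain), (1 - d.β ℓ) * v ℓ (P.D (restrict u) ℓ)) +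
    ∑ᶠ (t : Finset Plane) (_ : t ∈ triangles d.mesh),
      q t fun x => d.β x * w (fderivWithin ℝ u (tri t) x)

/-- The energy functional `E^β_h` of a method. -/
def blendedEnergy (P : SitePotential L) : BlendedMethod → (Plane → Plane) → ℝ
  | .bqce => d.blend P P.V P.W midpointRule
  | .bgfcP1 => d.blend P P.V2 P.W2 midpointRule
  | .bgfcP2 Q => d.blend P P.V2 P.W2 Q.apply

/-- `u` solves the blended method: it is a local minimiser of `E^β_h` over the space of
coarse-grained displacements. -/
def IsSolution (P : SitePotential L) (m : BlendedMethod) (u : Plane → Plane) : Prop :=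
  u ∈ d.space m ∧ ∃ ε > 0, ∀ v ∈ d.space m, gradNorm univ (v - u) < ε →
    d.blendedEnergy P m u ≤ d.blendedEnergy P m v

/-- The consistency term `μ_E(u) = E^a(I_a u) - E^β_h(u)`. -/
def muE (P : SitePotential L) (m : BlendedMethod) (u : Plane → Plane) : ℝ :=
  P.energy (restrict u) - d.blendedEnergy P m u

end Discretization

/-- The exponent `r` in the rate `DoF^r` of convergence of a method, in two dimensions. -/
def BlendedMethod.rate : BlendedMethod → ℝ
  | .bqce => -1 / 2
  | .bgfcP1 => -1
  | .bgfcP2 _ => -3 / 2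

/-! ### The error estimator -/

/-- The computational domain of the error estimator: a union of background triangles with
`B_R ⊆ Ω ⊆ B_{2R}`. -/
structure CompDomain {L : DefectLattice} (T : BackgroundMesh L) where
  elements : Finset (Finset Plane)
  elements_mem : ∀ t ∈ elements, t ∈ triangles T.K
  R : ℝ
  R_pos : 0 < R
  ball_subset : Metric.closedBall 0 R ⊆ ⋃ t ∈ elements, tri t
  subset_ball : (⋃ t ∈ elements, tri t) ⊆ Metric.closedBall 0 (2 * R)

namespace CompDomain

variable {L : DefectLattice} {T : BackgroundMesh L} (Ω : CompDomain T)

/-- The closed domain. -/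
def carrier : Set Plane := ⋃ t ∈ Ω.elements, tri t

/-- The outer part `Ω \ B_{R/2}`. -/
def outer : Set Plane := Ω.carrier \ Metric.closedBall 0 (Ω.R / 2)

/-- The nodal values of the piecewise affine functions on `Ω` that vanish on its boundary (and
are extended by zero). -/
def feSpace : Set (L.sites → Plane) :=
  {φ | ∀ x ∉ interior Ω.carrier, T.interp φ x = 0}

/-- The rescaled nodal interpolant `∑_ℓ c_ℓ F_ℓ(u) ζ_ℓ`, `c_ℓ = 1 / ∫ ζ_ℓ`, of the residual
forces. -/
def forceInterp (T : BackgroundMesh L) (P : SitePotential L) (u : L.sites → Plane) :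
    Plane → Plane :=
  T.interp fun ℓ => (∫ x, T.zeta ℓ x)⁻¹ • P.force u ℓ

/-- `φ` solves the discrete Poisson problem with the residual forces as its right-hand side. -/
def IsPoissonSolution (P : SitePotential L) (u φ : L.sites → Plane) : Prop :=
  φ ∈ Ω.feSpace ∧ ∀ v ∈ Ω.feSpace, dirichlet Ω.carrier (T.interp φ) (T.interp v) =
    ∫ x in Ω.carrier, inner ℝ (forceInterp T P u x) (T.interp v x)

open Classical in
/-- The function `φ_a`, the unique solution of the discrete Poisson problem. -/
def phi (P : SitePotential L) (u : L.sites → Plane) : Plane → Plane :=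
  if h : ∃ φ, Ω.IsPoissonSolution P u φ then T.interp h.choose else 0

/-- The error estimator `η = ‖∇φ_a‖_{L²(Ω)}`. -/
def eta (P : SitePotential L) (u : L.sites → Plane) : ℝ := gradNorm Ω.carrier (Ω.phi P u)

/-- The truncation indicator
`ρ_tr = R ‖F̂‖_{L²(Ω \ B_{R/2})} + ‖∇φ_a‖_{L²(Ω \ B_{R/2})}`. -/
def rhoTr (P : SitePotential L) (u : L.sites → Plane) : ℝ :=
  Ω.R * √(∫ x in Ω.outer, ‖forceInterp T P u x‖ ^ 2) + gradNorm Ω.outer (Ω.phi P u)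

end CompDomain

end

/-! ### The lattice, the background mesh and its hat functions -/

noncomputable section

/-! ### Local finiteness of the lattice -/

/-! Let `w` be the restriction of `uh` to the sites and `e = w - ua`. The error splits as `E(ua) -
E_h(uh) = -(E(w) - E(ua)) + μ_E`, so only `E(w) - E(ua)` has to be estimated. Since `δE(ua) = 0` and
the Taylor remainder of the energy is quadratic, this difference is `O(‖e‖²)`, and the theorem
reduces to `‖e‖ ≤ C (η + ρ_tr)`. Strong stability and the continuity of the second variation give `c
‖e‖² ≤ ⟨δE(w), e⟩` for small `e` (`IsLocalMinimiser.exists_coercive`), and consistency makes `e`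
small once DoF is large. What remains is the dual bound `⟨δE(w), v⟩ ≤ C (η + ρ_tr) ‖v‖`
(`CompDomain.residual_le`).

As `w` has finite support, `⟨δE(w), v⟩ = ∑ F_ℓ · v_ℓ`. The forces add up to zero, because `⟨δE(u),
c⟩` for a constant `c` does not depend on `u` and vanishes at `ua`. So a constant may be subtracted
from `v`, and a Poincaré inequality allows `v - c` to be cut off to a finite element function `u`
with `‖∇u‖ ≤ C ‖∇v‖` (`exists_truncation`). The part cut away lives at sites of modulus at least
`3R/4`; there the forces are paired with something of `ℓ²` norm at most `C R ‖∇v‖`, which produces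
the first term of `ρ_tr`. For `u` itself the sum is `∫ F̂ · u = ∫ ∇φ : ∇u ≤ η ‖∇u‖`, up to the error
of mass lumping.

The lumping error is at most `C ‖f‖ ‖∇u‖`, where `‖f‖` is the `ℓ²` norm of the nodal values `f` of
`F̂`. This norm is again controlled by `η` and `ρ_tr` (`sum_load_sq_le`): test with `f` itself, cut
off at radius `R`, and use the inverse inequality `‖∇g‖ ≤ C ‖g‖`, which holds because the background
mesh is not refined.

The constants of the mesh come from the diameter and area bounds of the triangles and from the
uniform local finiteness of the lattice; those of the potentials are uniform because all sites far
from the defect carry the same potential. Independence of `Ω` also needs a lower bound for its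
radius. -/

theorem homLattice_sub_mem {A : Matrix (Fin 2) (Fin 2) ℝ} {x y : Plane}
    (hx : x ∈ homLattice A) (hy : y ∈ homLattice A) : x - y ∈ homLattice A := by
  obtain ⟨z, rfl⟩ := hx
  obtain ⟨z', rfl⟩ := hy
  refine ⟨z - z', ?_⟩
  rw [← WithLp.toLp_sub, ← Matrix.mulVec_sub]
  congr 2
  funext i
  simp

/-- The defect core contributes finitely many sites. For the Bravais part, subtracting one lattice
point of the ball moves all the others into the ball of radius `2r` about the origin, so the count
does not depend on the centre. Every overlap bound below rests on this. -/
theorem DefectLattice.exists_encard_le (L : DefectLattice) (r : ℝ) :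
    ∃ N : ℕ, ∀ x : Plane, (L.sites ∩ Metric.closedBall x r).encard ≤ N := by
  have h1 := L.finite_core
  have h2 := homLattice_inter_ball_finite L.A L.det_ne_zero 0 (2 * r)
  refine ⟨h1.toFinset.card + h2.toFinset.card, fun x => ?_⟩
  have h3 : (homLattice L.A ∩ Metric.closedBall x r).encard ≤ h2.toFinset.card := by
    rcases (homLattice L.A ∩ Metric.closedBall x r).eq_empty_or_nonempty with h | ⟨p, hp⟩
    · simp [h]
    · rw [← h2.encard_eq_coe_toFinset_card]
      rw [← (sub_left_injective (b := p)).encard_image]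
      refine Set.encard_le_encard ?_
      rintro _ ⟨q, hq, rfl⟩
      refine ⟨homLattice_sub_mem hq.1 hp.1, ?_⟩
      have a1 := hq.2
      have a2 := hp.2
      rw [Metric.mem_closedBall] at a1 a2 ⊢
      rw [dist_zero_right, ← dist_eq_norm]
      linarith [dist_triangle_right q p x]
  have h4 : L.sites ∩ Metric.closedBall x r ⊆
      (L.sites ∩ Metric.closedBall 0 L.rDef) ∪ (homLattice L.A ∩ Metric.closedBall x r) := by
    rintro y ⟨hy, hyx⟩
    by_cases h : y ∈ Metric.closedBall (0 : Plane) L.rDef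
    · exact Or.inl ⟨hy, h⟩
    · have h5 : y ∈ L.sites \ Metric.closedBall 0 L.rDef := ⟨hy, h⟩
      rw [L.far_eq] at h5
      exact Or.inr ⟨h5.1, hyx⟩
  refine (Set.encard_le_encard h4).trans ((Set.encard_union_le _ _).trans ?_)
  rw [h1.encard_eq_coe_toFinset_card]
  push_cast
  gcongr

/-- A bound for the number of sites in a ball of radius `r`. -/
def DefectLattice.siteBound (L : DefectLattice) (r : ℝ) : ℕ := (L.exists_encard_le r).choose

theorem DefectLattice.card_le_siteBound (L : DefectLattice) (r : ℝ) (x : Plane)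
    (S : Finset Plane) (hS : ∀ p ∈ S, p ∈ L.sites ∧ dist p x ≤ r) : S.card ≤ L.siteBound r := by
  have h := (L.exists_encard_le r).choose_spec x
  have h2 : ((S : Set Plane)).encard ≤ (L.sites ∩ Metric.closedBall x r).encard :=
    Set.encard_le_encard fun p hp => ⟨(hS p hp).1, (hS p hp).2⟩
  rw [Set.encard_coe_eq_coe_finsetCard] at h2
  exact_mod_cast h2.trans h

/-- The sites in a ball. -/
def DefectLattice.sitesNear (L : DefectLattice) (x : Plane) (r : ℝ) : Finset Plane :=
  (L.inter_ball_finite x r).toFinset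

theorem DefectLattice.mem_sitesNear {L : DefectLattice} {x p : Plane} {r : ℝ} :
    p ∈ L.sitesNear x r ↔ p ∈ L.sites ∧ dist p x ≤ r := by
  simp [DefectLattice.sitesNear]

theorem DefectLattice.card_sitesNear_le (L : DefectLattice) (x : Plane) (r : ℝ) :
    (L.sitesNear x r).card ≤ L.siteBound r :=
  L.card_le_siteBound r x _ fun _ hp => L.mem_sitesNear.1 hp

/-! ### The triangles of the background mesh -/

namespace BackgroundMesh

variable {L : DefectLattice} (T : BackgroundMesh L)

/-- A bound for the diameter of the triangles. -/
def diam : ℝ := max 1 T.diam_le.choose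

/-- A lower bound for the area of the triangles. -/
def area : ℝ := T.area_ge.choose

theorem one_le_diam : 1 ≤ T.diam := le_max_left _ _

theorem diam_pos : 0 < T.diam := one_pos.trans_le T.one_le_diam

theorem area_pos : 0 < T.area := T.area_ge.choose_spec.1

variable {T}

theorem area_le {t : Finset Plane} (ht : t ∈ triangles T.K) : T.area ≤ volume.real (tri t) :=
  T.area_ge.choose_spec.2 t ht

theorem isCompact_tri (t : Finset Plane) : IsCompact (tri t) :=
  t.finite_toSet.isCompact_convexHull (𝕜 := ℝ)

theorem measurableSet_tri (t : Finset Plane) : MeasurableSet (tri t) :=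
  (isCompact_tri t).isClosed.measurableSet

theorem dist_le {t : Finset Plane} (ht : t ∈ triangles T.K) {x y : Plane} (hx : x ∈ tri t)
    (hy : y ∈ tri t) : dist x y ≤ T.diam :=
  (Metric.dist_le_diam_of_mem (isCompact_tri t).isBounded hx hy).trans
    ((T.diam_le.choose_spec t ht).trans (le_max_right _ _))

theorem vertex_mem_tri {t : Finset Plane} {p : Plane} (hp : p ∈ t) : p ∈ tri t :=
  subset_convexHull ℝ _ hp

theorem vertex_mem_sites {t : Finset Plane} (ht : t ∈ T.K.faces) {p : Plane} (hp : p ∈ t) :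
    p ∈ L.sites := by
  rw [← T.vertices_eq]
  exact T.K.down_closed ht (by simpa using hp) (Finset.singleton_nonempty p)

theorem face_of_mem_sites {p : Plane} (hp : p ∈ L.sites) : {p} ∈ T.K.faces := by
  rw [← T.vertices_eq] at hp
  exact hp

/-- A triangle is a set of sites, and the diameter bound keeps these sites near the ball. The power
set gives a crude but centre-independent count. -/
theorem finite_near (T : BackgroundMesh L) (x : Plane) (r : ℝ) :
    {t | t ∈ triangles T.K ∧ (tri t ∩ Metric.closedBall x r).Nonempty}.Finite := by
  refine ((L.sitesNear x (r + T.diam)).powerset.finite_toSet).subset ?_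
  rintro t ⟨ht, y, hy, hyx⟩
  simp only [Finset.coe_powerset, mem_preimage, mem_powerset_iff]
  intro p hp
  refine L.mem_sitesNear.2 ⟨vertex_mem_sites ht.1 hp, ?_⟩
  have h1 := dist_le ht (vertex_mem_tri hp) hy
  have h2 : dist y x ≤ r := hyx
  linarith [dist_triangle p y x]

variable (T) in
/-- The triangles that meet a ball. -/
def near (x : Plane) (r : ℝ) : Finset (Finset Plane) := (T.finite_near x r).toFinset

theorem mem_near {x : Plane} {r : ℝ} {t : Finset Plane} :
    t ∈ T.near x r ↔ t ∈ triangles T.K ∧ (tri t ∩ Metric.closedBall x r).Nonempty := by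
  simp [near]

theorem mem_near_of_mem {x y : Plane} {r : ℝ} {t : Finset Plane} (ht : t ∈ triangles T.K)
    (hy : y ∈ tri t) (h : dist y x ≤ r) : t ∈ T.near x r :=
  mem_near.2 ⟨ht, y, hy, h⟩

variable (T) in
/-- A bound for the number of triangles that meet a ball of radius `r`. -/
def nearBound (r : ℝ) : ℕ := 2 ^ L.siteBound (r + T.diam)

theorem card_le_nearBound (S : Finset (Finset Plane)) (x : Plane) (r : ℝ)
    (hS : S ⊆ T.near x r) : S.card ≤ T.nearBound r := by
  have : S ⊆ (L.sitesNear x (r + T.diam)).powerset := by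
    intro t h
    obtain ⟨ht, y, hy, hyx⟩ := mem_near.1 (hS h)
    rw [Finset.mem_powerset]
    intro p hp
    refine L.mem_sitesNear.2 ⟨vertex_mem_sites ht.1 hp, ?_⟩
    have h1 := dist_le ht (vertex_mem_tri hp) hy
    have h2 : dist y x ≤ r := hyx
    linarith [dist_triangle p y x]
  refine (Finset.card_le_card this).trans ?_
  rw [Finset.card_powerset]
  exact Nat.pow_le_pow_right two_pos (L.card_sitesNear_le _ _)

theorem countable_triangles (T : BackgroundMesh L) : (triangles T.K).Countable := by
  have : triangles T.K ⊆ ⋃ n : ℕ, (T.near 0 n : Set (Finset Plane)) := by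
    intro t ht
    obtain ⟨p, hp⟩ := T.K.nonempty_of_mem_faces ht.1
    obtain ⟨n, hn⟩ := exists_nat_ge ‖p‖
    exact mem_iUnion.2 ⟨n, mem_near_of_mem ht (vertex_mem_tri hp) (by simpa using hn)⟩
  exact (countable_iUnion fun n : ℕ => (T.near 0 n).countable_toSet).mono this

/-! ### Hat functions on a triangle -/

theorem hat_of_isBarycentric {x : Plane} {w : Plane →₀ ℝ} (h : IsBarycentric T.K x w)
    (p : Plane) : hat T.K p x = w p := by
  have h' : ∃ w, IsBarycentric T.K x w := ⟨w, h⟩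
  rw [hat, dif_pos h']
  exact DFunLike.congr_fun (h'.choose_spec.unique h) p

open Classical in
/-- On a face the hat functions are the barycentric coordinates. -/
theorem hat_combination {t : Finset Plane} (ht : t ∈ T.K.faces) {μ : Plane → ℝ}
    (h0 : ∀ p ∈ t, 0 ≤ μ p) (h1 : ∑ p ∈ t, μ p = 1) (q : Plane) :
    hat T.K q (∑ p ∈ t, μ p • p) = if q ∈ t then μ q else 0 := by
  -- Vanishing coordinates leave the support, so `w` may live on a proper face of `t`; this face is
  -- in the complex by `down_closed`, and is nonempty because the weights add up to one.
  set w : Plane →₀ ℝ := Finsupp.onFinset t (fun p => if p ∈ t then μ p else 0)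
    (fun p hp => by by_contra h; simp [h] at hp) with hw
  have hsub : w.support ⊆ t := Finsupp.support_onFinset_subset
  have hwp : ∀ p, w p = if p ∈ t then μ p else 0 := fun p => rfl
  have hs1 : ∑ p ∈ w.support, w p = 1 := by
    rw [← h1, Finset.sum_subset hsub]
    · exact Finset.sum_congr rfl fun p hp => by simp [hwp, hp]
    · intro p _ hp
      simpa using hp
  have hb : IsBarycentric T.K (∑ p ∈ t, μ p • p) w := by
    refine ⟨fun p => ?_, ?_, hs1, ?_⟩
    · rw [hwp]; split_ifs with h
      · exact h0 p h
      · exact le_rfl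
    · refine T.K.down_closed ht hsub ?_
      rw [Finset.nonempty_iff_ne_empty]
      intro h
      simp [h] at hs1
    · rw [Finset.sum_subset hsub]
      · exact Finset.sum_congr rfl fun p hp => by simp [hwp, hp]
      · intro p _ hp
        have : w p = 0 := by simpa using hp
        simp [this]
  rw [hat_of_isBarycentric hb, hwp]

theorem mem_tri_iff {t : Finset Plane} {x : Plane} :
    x ∈ tri t ↔ ∃ μ : Plane → ℝ, (∀ p ∈ t, 0 ≤ μ p) ∧ ∑ p ∈ t, μ p = 1 ∧
      ∑ p ∈ t, μ p • p = x := Finset.mem_convexHull'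

/-- Barycentric coordinates as affine functions. -/
theorem exists_affine_coord {t : Finset Plane} (ht : t ∈ triangles T.K) :
    ∃ lam : Plane → Plane →ᵃ[ℝ] ℝ, (∀ x, ∑ p ∈ t, lam p x = 1) ∧
      (∀ x, ∑ p ∈ t, lam p x • p = x) ∧ (∀ x ∈ tri t, ∀ p ∈ t, 0 ≤ lam p x) := by
  classical
  have hind := T.K.indep ht.1
  have hcard : Fintype.card t = Module.finrank ℝ Plane + 1 := by
    simp [ht.2]
  have htop : affineSpan ℝ (range ((↑) : t → Plane)) = ⊤ :=
    hind.affineSpan_eq_top_iff_card_eq_finrank_add_one.2 hcard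
  let b : AffineBasis t ℝ Plane := ⟨(↑), hind, htop⟩
  have hb : ∀ p : t, b p = (p : Plane) := fun _ => rfl
  refine ⟨fun p => if h : p ∈ t then b.coord ⟨p, h⟩ else 0, fun x => ?_, fun x => ?_, ?_⟩
  · rw [← b.sum_coord_apply_eq_one x, ← Finset.sum_coe_sort t]
    refine Finset.sum_congr rfl fun p _ => ?_
    simp
  · conv_rhs => rw [← b.linear_combination_coord_eq_self x]
    rw [← Finset.sum_coe_sort t]
    refine Finset.sum_congr rfl fun p _ => ?_
    simp [hb]
  · intro x hx p hp
    have h2 : tri t = convexHull ℝ (range b) := by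
      rw [tri]; congr 1; ext y; simp [hb]
    rw [h2, b.convexHull_eq_nonneg_coord] at hx
    simpa [hp] using hx ⟨p, hp⟩

open Classical in
theorem exists_hat_eq_affine {t : Finset Plane} (ht : t ∈ triangles T.K) (q : Plane) :
    ∃ f : Plane →ᵃ[ℝ] ℝ, EqOn (hat T.K q) f (tri t) := by
  obtain ⟨lam, h1, h2, h3⟩ := exists_affine_coord ht
  refine ⟨if q ∈ t then lam q else 0, fun x hx => ?_⟩
  have h4 := hat_combination ht.1 (μ := fun p => lam p x) (h3 x hx) (h1 x) q
  rw [h2] at h4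
  rw [h4]
  split_ifs <;> rfl

theorem hat_eq_zero {t : Finset Plane} (ht : t ∈ T.K.faces) {q x : Plane} (hq : q ∉ t)
    (hx : x ∈ tri t) : hat T.K q x = 0 := by
  classical
  obtain ⟨μ, h0, h1, rfl⟩ := mem_tri_iff.1 hx
  rw [hat_combination ht h0 h1, if_neg hq]

theorem hat_nonneg (q x : Plane) : 0 ≤ hat T.K q x := by
  classical
  obtain ⟨t, ht, hx⟩ := T.cover x
  obtain ⟨μ, h0, h1, rfl⟩ := mem_tri_iff.1 hx
  rw [hat_combination ht.1 h0 h1]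
  split_ifs with h
  · exact h0 q h
  · exact le_rfl

theorem hat_self {q : Plane} (hq : q ∈ L.sites) : hat T.K q q = 1 := by
  classical
  have := hat_combination (T := T) (face_of_mem_sites hq) (μ := fun _ => 1) (by simp) (by simp) q
  simpa using this

theorem sum_hat {t : Finset Plane} (ht : t ∈ T.K.faces) {x : Plane} (hx : x ∈ tri t) :
    ∑ p ∈ t, hat T.K p x = 1 := by
  classical
  obtain ⟨μ, h0, h1, rfl⟩ := mem_tri_iff.1 hx
  rw [← h1]
  exact Finset.sum_congr rfl fun p hp => by rw [hat_combination ht h0 h1, if_pos hp]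

theorem hat_le_one (q x : Plane) : hat T.K q x ≤ 1 := by
  obtain ⟨t, ht, hx⟩ := T.cover x
  by_cases h : q ∈ t
  · rw [← sum_hat ht.1 hx]
    exact Finset.single_le_sum (f := fun p => hat T.K p x) (fun p _ => hat_nonneg p x) h
  · rw [hat_eq_zero ht.1 h hx]; exact zero_le_one

/-- A site lies only in the triangles of which it is a vertex. -/
theorem mem_of_mem_tri {t : Finset Plane} (ht : t ∈ T.K.faces) {p : Plane} (hp : p ∈ L.sites)
    (h : p ∈ tri t) : p ∈ t := by
  by_contra h'
  have := hat_eq_zero ht h' h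
  rw [hat_self hp] at this
  exact one_ne_zero this

/-- Triangles that share a point at which all barycentric coordinates with respect to the first
one are positive coincide. -/
theorem eq_of_pos_combination {t t' : Finset Plane} (ht : t ∈ triangles T.K)
    (ht' : t' ∈ triangles T.K) {μ : Plane → ℝ} (h0 : ∀ p ∈ t, 0 < μ p) (h1 : ∑ p ∈ t, μ p = 1)
    (h : ∑ p ∈ t, μ p • p ∈ tri t') : t = t' := by
  classical
  refine Finset.eq_of_subset_of_card_le (fun q hq => ?_) (by rw [ht.2, ht'.2])
  by_contra hq'
  have h2 := hat_eq_zero ht'.1 hq' h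
  rw [hat_combination ht.1 (fun p hp => (h0 p hp).le) h1, if_pos hq] at h2
  exact (h0 q hq).ne' h2

/-! ### The nodal interpolant -/

theorem interp_eq_sum {t : Finset Plane} (ht : t ∈ T.K.faces) {x : Plane} (hx : x ∈ tri t)
    (u : L.sites → Plane) :
    T.interp u x = ∑ p ∈ t.attach, hat T.K p x • u ⟨p, vertex_mem_sites ht p.2⟩ := by
  classical
  let e : {p // p ∈ t} ↪ L.sites :=
    ⟨fun p => ⟨p, vertex_mem_sites ht p.2⟩, fun p q h => Subtype.ext (congrArg (fun z : L.sites => (z : Plane)) h)⟩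
  rw [interp, finsum_eq_sum_of_support_subset (s := t.attach.map e), Finset.sum_map]
  · rfl
  · intro ℓ hℓ
    have h : (ℓ : Plane) ∈ t := by
      by_contra h
      refine hℓ ?_
      simp only [zeta]
      rw [hat_eq_zero ht h hx, zero_smul]
    simp only [Finset.coe_map, mem_image, Finset.mem_coe, Finset.mem_attach, true_and]
    exact ⟨⟨ℓ, h⟩, rfl⟩

theorem interp_site (u : L.sites → Plane) (ℓ : L.sites) : T.interp u ℓ = u ℓ := by
  rw [interp_eq_sum (face_of_mem_sites ℓ.2) (vertex_mem_tri (by simp))]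
  rw [Finset.sum_eq_single ⟨ℓ, by simp⟩]
  · rw [hat_self ℓ.2, one_smul]
  · rintro ⟨p, hp⟩ _ h
    refine absurd (Subtype.ext ?_) h
    simpa using hp
  · intro h; exact absurd (Finset.mem_attach _ _) h

theorem interp_add (u v : L.sites → Plane) : T.interp (u + v) = T.interp u + T.interp v := by
  funext x
  obtain ⟨t, ht, hx⟩ := T.cover x
  simp only [Pi.add_apply, interp_eq_sum ht.1 hx, smul_add, Finset.sum_add_distrib]

theorem interp_smul (c : ℝ) (u : L.sites → Plane) : T.interp (c • u) = c • T.interp u := by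
  funext x
  obtain ⟨t, ht, hx⟩ := T.cover x
  simp only [Pi.smul_apply, interp_eq_sum ht.1 hx, Finset.smul_sum]
  exact Finset.sum_congr rfl fun p _ => smul_comm _ _ _

theorem interp_sub (u v : L.sites → Plane) : T.interp (u - v) = T.interp u - T.interp v := by
  have := interp_add (T := T) (u - v) v
  rw [sub_add_cancel] at this
  rw [this, add_sub_cancel_right]

theorem interp_const (c : Plane) : T.interp (fun _ => c) = fun _ => c := by
  funext x
  obtain ⟨t, ht, hx⟩ := T.cover x
  rw [interp_eq_sum ht.1 hx, ← Finset.sum_smul,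
    Finset.sum_attach t fun p => hat T.K p x, sum_hat ht.1 hx, one_smul]

/-- The functions that are affine on every triangle of the mesh. -/
def IsPL {E : Type*} [AddCommGroup E] [Module ℝ E] (T : BackgroundMesh L) (g : Plane → E) : Prop :=
  ∀ t ∈ triangles T.K, ∃ f : Plane →ᵃ[ℝ] E, EqOn g f (tri t)

theorem isPL_hat (T : BackgroundMesh L) (q : Plane) : T.IsPL (hat T.K q) :=
  fun _ ht => exists_hat_eq_affine ht q

theorem IsPL.eq_sum {E : Type*} [AddCommGroup E] [Module ℝ E] {g : Plane → E} (hg : T.IsPL g)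
    {t : Finset Plane} (ht : t ∈ triangles T.K) {μ : Plane → ℝ} (h0 : ∀ p ∈ t, 0 ≤ μ p)
    (h1 : ∑ p ∈ t, μ p = 1) : g (∑ p ∈ t, μ p • p) = ∑ p ∈ t, μ p • g p := by
  obtain ⟨f, hf⟩ := hg t ht
  have h2 : ∑ p ∈ t, μ p • p ∈ tri t := mem_tri_iff.2 ⟨μ, h0, h1, rfl⟩
  rw [hf h2]
  have h3 := Finset.map_affineCombination t (fun p => p) μ h1 f
  rw [Finset.affineCombination_eq_linear_combination _ _ _ h1] at h3
  rw [h3, Finset.affineCombination_eq_linear_combination _ _ _ h1]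
  exact Finset.sum_congr rfl fun p hp => by rw [Function.comp, hf (vertex_mem_tri hp)]

theorem isPL_interp (T : BackgroundMesh L) (u : L.sites → Plane) : T.IsPL (T.interp u) := by
  intro t ht
  choose f hf using fun q => exists_hat_eq_affine ht q
  refine ⟨∑ p ∈ t.attach, ((LinearMap.toSpanSingleton ℝ Plane
    (u ⟨p, vertex_mem_sites ht.1 p.2⟩)).toAffineMap.comp (f p)), fun x hx => ?_⟩
  rw [interp_eq_sum ht.1 hx]
  have : ∀ (S : Finset t) (g : t → Plane →ᵃ[ℝ] Plane), (∑ p ∈ S, g p) x = ∑ p ∈ S, g p x := by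
    classical
    intro S g
    induction S using Finset.induction_on with
    | empty => simp
    | insert a s h ih => simp [Finset.sum_insert h, ih]
  rw [this]
  exact Finset.sum_congr rfl fun p _ => by simp [hf p hx]

end BackgroundMesh

end

/-! ### Piecewise affine functions: the gradient norm against nodal differences -/

noncomputable section

/-! ### Affine functions on triangles -/

namespace BackgroundMesh

variable {L : DefectLattice} {T : BackgroundMesh L}

/-- The determinant of two vectors of the plane. -/
def det2 (a b : Plane) : ℝ := a 0 * b 1 - a 1 * b 0

theorem abs_det2_le (a b : Plane) : |det2 a b| ≤ 2 * ‖a‖ * ‖b‖ := by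
  have h : ∀ (c : Plane) i, |c i| ≤ ‖c‖ := fun c i => by
    simpa using PiLp.norm_apply_le c i
  calc |det2 a b| ≤ |a 0 * b 1| + |a 1 * b 0| := abs_sub _ _
    _ ≤ ‖a‖ * ‖b‖ + ‖a‖ * ‖b‖ := by
        rw [abs_mul, abs_mul]
        gcongr <;> exact h _ _
    _ = 2 * ‖a‖ * ‖b‖ := by ring

/-- The area of a disc of radius two. -/
def discArea : ℝ := volume.real (Metric.closedBall (0 : Plane) 2)

theorem discArea_pos : 0 < discArea := by
  rw [discArea, measureReal_def]
  exact ENNReal.toReal_pos (Metric.measure_closedBall_pos _ _ two_pos).ne'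
    measure_closedBall_lt_top.ne

/-- Up to translation, the triangle lies in the image of the disc of radius two under the linear map
whose columns are the edge vectors. The lower area bound thus becomes a lower bound for the
determinant of the edges; the exact factor one half is not needed. -/
theorem area_tri_le (p₀ p₁ p₂ : Plane) (h₁ : p₀ ≠ p₁) (h₂ : p₀ ≠ p₂) (h₃ : p₁ ≠ p₂) :
    volume.real (tri {p₀, p₁, p₂}) ≤ discArea * |det2 (p₁ - p₀) (p₂ - p₀)| := by
  set u := p₁ - p₀
  set v := p₂ - p₀
  let b := (EuclideanSpace.basisFun (Fin 2) ℝ).toBasis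
  let f : Plane →ₗ[ℝ] Plane := Matrix.toLin b b !![u 0, v 0; u 1, v 1]
  have hf : ∀ x, f x = x 0 • u + x 1 • v := by
    intro x
    ext i
    simp only [f, b, Matrix.toLin_apply]
    fin_cases i <;> simp [Matrix.mulVec, dotProduct, Fin.sum_univ_two, mul_comm]
  have hdet : LinearMap.det f = det2 u v := by
    simp only [f]
    rw [LinearMap.det_toLin, Matrix.det_fin_two_of, det2]
    ring
  have hsub : tri {p₀, p₁, p₂} ⊆ (fun y => -p₀ + y) ⁻¹' (f '' Metric.closedBall 0 2) := by
    intro x hx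
    obtain ⟨μ, h0, h1, rfl⟩ := mem_tri_iff.1 hx
    rw [Finset.sum_insert (by simp [h₁, h₂]), Finset.sum_insert (by simp [h₃]),
      Finset.sum_singleton] at h1 ⊢
    simp only [Finset.mem_insert, Finset.mem_singleton, forall_eq_or_imp, forall_eq] at h0
    refine ⟨!₂[μ p₁, μ p₂], ?_, ?_⟩
    · rw [mem_closedBall_zero_iff, EuclideanSpace.norm_eq]
      refine Real.sqrt_le_iff.2 ⟨by norm_num, ?_⟩
      simp only [Fin.sum_univ_two, Real.norm_eq_abs, sq_abs]
      simp
      nlinarith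
    · rw [hf]
      have : μ p₀ = 1 - μ p₁ - μ p₂ := by linarith
      simp only [u, v, this]
      simp
      module
  have h4 : volume (tri {p₀, p₁, p₂}) ≤
      ENNReal.ofReal |det2 u v| * volume (Metric.closedBall (0 : Plane) 2) := by
    refine (measure_mono hsub).trans ?_
    rw [measure_preimage_add, Measure.addHaar_image_linearMap, hdet]
  rw [discArea, measureReal_def, measureReal_def, mul_comm]
  refine (ENNReal.toReal_mono ?_ h4).trans_eq ?_
  · exact ENNReal.mul_ne_top ENNReal.ofReal_ne_top measure_closedBall_lt_top.ne
  · rw [ENNReal.toReal_mul, ENNReal.toReal_ofReal (abs_nonneg _)]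

variable {E : Type*} [NormedAddCommGroup E]

/-- The sum of the squares of the differences of the nodal values on a triangle. -/
def osc (t : Finset Plane) (g : Plane → E) : ℝ := ∑ p ∈ t, ∑ q ∈ t, ‖g p - g q‖ ^ 2

theorem osc_nonneg (t : Finset Plane) (g : Plane → E) : 0 ≤ osc t g :=
  Finset.sum_nonneg fun _ _ => Finset.sum_nonneg fun _ _ => by positivity

theorem norm_sub_le_sqrt_osc {t : Finset Plane} (g : Plane → E) {p q : Plane} (hp : p ∈ t)
    (hq : q ∈ t) : ‖g p - g q‖ ≤ √(osc t g) := by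
  refine Real.le_sqrt_of_sq_le ?_
  refine le_trans ?_ (Finset.single_le_sum (f := fun p => ∑ q ∈ t, ‖g p - g q‖ ^ 2)
    (fun _ _ => Finset.sum_nonneg fun _ _ => by positivity) hp)
  exact Finset.single_le_sum (f := fun q => ‖g p - g q‖ ^ 2) (fun _ _ => by positivity) hq

variable [NormedSpace ℝ E]

variable (T) in
/-- A bound for the Lipschitz constants of the barycentric coordinates. -/
def lip : ℝ := 4 * T.diam * discArea / T.area

theorem lip_pos : 0 < T.lip := by
  have := T.diam_pos
  have := T.area_pos
  have := discArea_pos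
  unfold lip
  positivity

theorem sum_triple {F : Type*} [AddCommGroup F] {p₀ p₁ p₂ : Plane} (h₁ : p₀ ≠ p₁) (h₂ : p₀ ≠ p₂)
    (h₃ : p₁ ≠ p₂) (G : Plane → F) :
    ∑ p ∈ ({p₀, p₁, p₂} : Finset Plane), G p = G p₀ + (G p₁ + G p₂) := by
  rw [Finset.sum_insert (by simp [h₁, h₂]), Finset.sum_insert (by simp [h₃]),
    Finset.sum_singleton]

/-- Cramer's rule expresses the differences of barycentric coordinates as quotients of determinants.
The numerator is bounded by the diameter, the denominator from below by the area, so the Lipschitz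
constant is the same for all triangles. -/
theorem IsPL.norm_sub_le {g : Plane → E} (hg : T.IsPL g) {t : Finset Plane}
    (ht : t ∈ triangles T.K) {x y : Plane} (hx : x ∈ tri t) (hy : y ∈ tri t) :
    ‖g x - g y‖ ≤ T.lip * √(osc t g) * ‖x - y‖ := by
  obtain ⟨p₀, p₁, p₂, h₁, h₂, h₃, rfl⟩ := Finset.card_eq_three.1 ht.2
  have harea := (area_le ht).trans (area_tri_le p₀ p₁ p₂ h₁ h₂ h₃)
  obtain ⟨μ, h0, h1, rfl⟩ := mem_tri_iff.1 hx
  obtain ⟨ν, k0, k1, rfl⟩ := mem_tri_iff.1 hy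
  rw [hg.eq_sum ht h0 h1, hg.eq_sum ht k0 k1]
  have m1 := norm_sub_le_sqrt_osc (t := {p₀, p₁, p₂}) g (p := p₁) (q := p₀) (by simp) (by simp)
  have m2 := norm_sub_le_sqrt_osc (t := {p₀, p₁, p₂}) g (p := p₂) (q := p₀) (by simp) (by simp)
  set S := √(osc {p₀, p₁, p₂} g)
  have d1 : ‖p₁ - p₀‖ ≤ T.diam := by
    rw [← dist_eq_norm]
    exact dist_le ht (vertex_mem_tri (by simp)) (vertex_mem_tri (by simp))
  have d2 : ‖p₂ - p₀‖ ≤ T.diam := by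
    rw [← dist_eq_norm]
    exact dist_le ht (vertex_mem_tri (by simp)) (vertex_mem_tri (by simp))
  simp only [sum_triple h₁ h₂ h₃] at h1 k1 hx hy ⊢
  set z := μ p₀ • p₀ + (μ p₁ • p₁ + μ p₂ • p₂) - (ν p₀ • p₀ + (ν p₁ • p₁ + ν p₂ • p₂)) with hz
  have e0 : μ p₀ = 1 - μ p₁ - μ p₂ := by linarith
  have f0 : ν p₀ = 1 - ν p₁ - ν p₂ := by linarith
  have hz' : z = (μ p₁ - ν p₁) • (p₁ - p₀) + (μ p₂ - ν p₂) • (p₂ - p₀) := by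
    rw [hz, e0, f0]; module
  have hg' : μ p₀ • g p₀ + (μ p₁ • g p₁ + μ p₂ • g p₂) -
      (ν p₀ • g p₀ + (ν p₁ • g p₁ + ν p₂ • g p₂)) =
      (μ p₁ - ν p₁) • (g p₁ - g p₀) + (μ p₂ - ν p₂) • (g p₂ - g p₀) := by
    rw [e0, f0]; module
  -- Cramer's rule for the coordinates of `z` in the basis of the two edges at `p₀`.
  have c1 : (μ p₁ - ν p₁) * det2 (p₁ - p₀) (p₂ - p₀) = det2 z (p₂ - p₀) := by
    rw [hz']; simp [det2]; ring
  have c2 : (μ p₂ - ν p₂) * det2 (p₁ - p₀) (p₂ - p₀) = det2 (p₁ - p₀) z := by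
    rw [hz']; simp [det2]; ring
  have hA := T.area_pos
  have hD := discArea_pos
  have key : ∀ s w : ℝ, s * det2 (p₁ - p₀) (p₂ - p₀) = w → |w| ≤ 2 * ‖z‖ * T.diam →
      |s| ≤ 2 * ‖z‖ * T.diam * discArea / T.area := by
    intro s w h h'
    rw [le_div_iff₀ hA]
    calc |s| * T.area ≤ |s| * (discArea * |det2 (p₁ - p₀) (p₂ - p₀)|) := by gcongr
      _ = |w| * discArea := by rw [← h, abs_mul]; ring
      _ ≤ _ := by gcongr
  have s1 := key _ _ c1 ((abs_det2_le _ _).trans (by gcongr))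
  have s2 := key _ _ c2 ((abs_det2_le _ _).trans (by
    rw [mul_right_comm]; gcongr))
  rw [hg']
  have hS : 0 ≤ S := Real.sqrt_nonneg _
  have hB := (abs_nonneg _).trans s1
  calc _ ≤ |μ p₁ - ν p₁| * ‖g p₁ - g p₀‖ + |μ p₂ - ν p₂| * ‖g p₂ - g p₀‖ := by
        refine (norm_add_le _ _).trans ?_
        rw [norm_smul, norm_smul, Real.norm_eq_abs, Real.norm_eq_abs]
    _ ≤ 2 * ‖z‖ * T.diam * discArea / T.area * S + 2 * ‖z‖ * T.diam * discArea / T.area * S := by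
        gcongr
    _ = _ := by unfold lip; ring

/-- A function that is Lipschitz continuous on each of finitely many closed sets that cover a
segment is Lipschitz continuous along the segment. -/
theorem norm_sub_le_of_cover {E : Type*} [NormedAddCommGroup E] {ι : Type*} (F : Finset ι) (C : ι → Set Plane)
    (hC : ∀ i ∈ F, IsClosed (C i)) {g : Plane → E} {x y : Plane} {M : ℝ}
    (hcov : segment ℝ x y ⊆ ⋃ i ∈ F, C i)
    (hg : ∀ i ∈ F, ∀ a ∈ C i, ∀ b ∈ C i, ‖g a - g b‖ ≤ M * ‖a - b‖) :
    ‖g x - g y‖ ≤ M * ‖x - y‖ := by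
  let γ : ℝ → Plane := fun s => x + s • (y - x)
  have hγc : Continuous γ := by fun_prop
  have hγ : ∀ s ∈ Icc (0 : ℝ) 1, ∃ i ∈ F, γ s ∈ C i := by
    intro s hs
    have : γ s ∈ segment ℝ x y := by
      rw [segment_eq_image']
      exact ⟨s, hs, rfl⟩
    simpa using hcov this
  have hd : ∀ s s', s ≤ s' → ‖γ s - γ s'‖ = (s' - s) * ‖x - y‖ := by
    intro s s' h
    have : γ s - γ s' = (s' - s) • (x - y) := by simp only [γ]; module
    rw [this, norm_smul, Real.norm_of_nonneg (by linarith)]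
  have hcont : ContinuousOn (fun s => g (γ s)) (Icc 0 1) := by
    have hloc : LocallyFinite fun i : F => C i := locallyFinite_of_finite _
    have hu : ContinuousOn g (⋃ i : F, C i) := by
      refine hloc.continuousOn_iUnion (fun i => hC i i.2) fun i => ?_
      have : LipschitzOnWith (Real.toNNReal M) g (C i) := by
        refine LipschitzOnWith.of_dist_le_mul fun a ha b hb => ?_
        rw [dist_eq_norm, dist_eq_norm]
        refine (hg i i.2 a ha b hb).trans ?_
        gcongr
        exact Real.le_coe_toNNReal M
      exact this.continuousOn
    refine hu.comp hγc.continuousOn fun s hs => ?_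
    obtain ⟨i, hi, h⟩ := hγ s hs
    exact mem_iUnion.2 ⟨⟨i, hi⟩, h⟩
  set S : Set ℝ := {s | ‖g x - g (γ s)‖ ≤ M * (s * ‖x - y‖)} with hS
  have hclosed : IsClosed (S ∩ Icc 0 1) := by
    have : S ∩ Icc 0 1 = {s ∈ Icc (0 : ℝ) 1 | ‖g x - g (γ s)‖ ≤ M * (s * ‖x - y‖)} := by
      ext s; simp [hS, and_comm]
    rw [this]
    exact isClosed_Icc.isClosed_le (continuousOn_const.sub hcont).norm (by fun_prop)
  -- Continuous induction on the parameter: the set of good parameters is closed, and it extends to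
  -- the right of each of its points.
  have hsub : Icc (0 : ℝ) 1 ⊆ S := by
    refine hclosed.Icc_subset_of_forall_exists_gt (by simp [hS, γ]) ?_
    rintro s ⟨hsS, hs⟩ b hb
    have hfreq : ∃ᶠ s' in 𝓝[>] s, s' ∈ Ioo s (min b 1) := by
      refine Eventually.frequently ?_
      exact Ioo_mem_nhdsGT (lt_min hb hs.2)
    -- Pigeonhole: a single set of the cover is visited at parameters arbitrarily close to `s` from
    -- the right. Being closed it also contains `γ s`, so its Lipschitz bound carries the estimate
    -- from `s` to `s'`.
    have : ∃ i ∈ F, ∃ᶠ s' in 𝓝[>] s, s' ∈ Ioo s (min b 1) ∧ γ s' ∈ C i := by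
      by_contra hcon
      push Not at hcon
      have h2 : ∀ᶠ s' in 𝓝[>] s, ∀ i ∈ F, ¬ (s' ∈ Ioo s (min b 1) ∧ γ s' ∈ C i) :=
        (Filter.eventually_all_finset F).2 fun i hi => (hcon i hi).mono fun _ h h' => h h'.1 h'.2
      obtain ⟨s', h3, h4⟩ := (hfreq.and_eventually h2).exists
      obtain ⟨i, hi, h⟩ := hγ s' ⟨by linarith [hs.1, h3.1], (h3.2.trans_le (min_le_right _ _)).le⟩
      exact h4 i hi ⟨h3, h⟩
    obtain ⟨i, hi, hfr⟩ := this
    have hsi : γ s ∈ C i := by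
      have : s ∈ closure (γ ⁻¹' C i) :=
        mem_closure_iff_frequently.2 ((hfr.mono fun _ h => h.2).filter_mono nhdsWithin_le_nhds)
      rwa [((hC i hi).preimage hγc).closure_eq] at this
    obtain ⟨s', h3, h4⟩ := hfr.exists
    refine ⟨s', ?_, h3.1, (h3.2.trans_le (min_le_left _ _)).le⟩
    have h5 := hg i hi _ hsi _ h4
    rw [hd _ _ h3.1.le] at h5
    have h6 : ‖g x - g (γ s)‖ ≤ M * (s * ‖x - y‖) := hsS
    change ‖g x - g (γ s')‖ ≤ M * (s' * ‖x - y‖)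
    calc ‖g x - g (γ s')‖ ≤ ‖g x - g (γ s)‖ + ‖g (γ s) - g (γ s')‖ := norm_sub_le_norm_sub_add_norm_sub _ _ _
      _ ≤ M * (s * ‖x - y‖) + M * ((s' - s) * ‖x - y‖) := add_le_add h6 h5
      _ = _ := by ring
  have := hsub (right_mem_Icc.2 zero_le_one)
  simpa [hS, γ] using this

/-- The segment from `x` to `y` crosses only triangles that meet the ball of radius `r` about `x`,
and each of their oscillations is at most the sum of all. This locality makes finite differences
square summable. -/
theorem IsPL.norm_sub_le_of_dist_le {g : Plane → E} (hg : T.IsPL g) {x y : Plane} {r : ℝ}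
    (h : dist x y ≤ r) :
    ‖g x - g y‖ ^ 2 ≤ T.lip ^ 2 * r ^ 2 * ∑ t ∈ T.near x r, osc t g := by
  set S := ∑ t ∈ T.near x r, osc t g with hS
  have hS0 : 0 ≤ S := Finset.sum_nonneg fun t _ => osc_nonneg t g
  have h1 : ‖g x - g y‖ ≤ T.lip * √S * ‖x - y‖ := by
    refine norm_sub_le_of_cover (T.near x r) tri (fun t _ => (isCompact_tri t).isClosed) ?_ ?_
    · intro z hz
      obtain ⟨t, ht, hzt⟩ := T.cover z
      have : z ∈ Metric.closedBall x r :=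
        (convex_closedBall x r).segment_subset (Metric.mem_closedBall_self (dist_nonneg.trans h))
          (by rwa [Metric.mem_closedBall, dist_comm]) hz
      exact mem_biUnion (mem_near_of_mem ht hzt this) hzt
    · intro t ht a ha b hb
      refine (hg.norm_sub_le (mem_near.1 ht).1 ha hb).trans ?_
      have := T.lip_pos
      gcongr
      exact Finset.single_le_sum (f := fun t => osc t g) (fun t _ => osc_nonneg t g) ht
  have h2 : ‖x - y‖ ≤ r := by rwa [← dist_eq_norm]
  calc ‖g x - g y‖ ^ 2 ≤ (T.lip * √S * ‖x - y‖) ^ 2 := by gcongr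
    _ = T.lip ^ 2 * ‖x - y‖ ^ 2 * S := by rw [mul_pow, mul_pow, Real.sq_sqrt hS0]; ring
    _ ≤ _ := by gcongr

theorem IsPL.continuous {g : Plane → E} (hg : T.IsPL g) : Continuous g := by
  rw [continuous_iff_continuousAt]
  intro x
  set S := ∑ t ∈ T.near x 1, osc t g with hS
  refine continuousAt_of_locally_lipschitz one_pos (T.lip * √S) fun y hy => ?_
  have hS0 : 0 ≤ S := Finset.sum_nonneg fun t _ => osc_nonneg t g
  have h1 : ‖g x - g y‖ ≤ T.lip * √S * ‖x - y‖ := by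
    refine norm_sub_le_of_cover (T.near x 1) tri (fun t _ => (isCompact_tri t).isClosed) ?_ ?_
    · intro z hz
      obtain ⟨t, ht, hzt⟩ := T.cover z
      have : z ∈ Metric.closedBall x 1 :=
        (convex_closedBall x 1).segment_subset (Metric.mem_closedBall_self zero_le_one)
          hy.le hz
      exact mem_biUnion (mem_near_of_mem ht hzt this) hzt
    · intro t ht a ha b hb
      refine (hg.norm_sub_le (mem_near.1 ht).1 ha hb).trans ?_
      have := T.lip_pos
      gcongr
      exact Finset.single_le_sum (f := fun t => osc t g) (fun t _ => osc_nonneg t g) ht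
  rw [dist_comm, dist_eq_norm, dist_comm, dist_eq_norm]
  exact h1

/-! ### Gradients of piecewise affine functions -/

theorem IsPL.exists_hasFDerivAt {g : Plane → E} (hg : T.IsPL g) {t : Finset Plane}
    (ht : t ∈ triangles T.K) :
    ∃ G : Plane →L[ℝ] E, (∀ x ∈ interior (tri t), HasFDerivAt g G x) ∧
      ∀ p ∈ tri t, ∀ q ∈ tri t, g p - g q = G (p - q) := by
  obtain ⟨f, hf⟩ := hg t ht
  refine ⟨LinearMap.toContinuousLinearMap f.linear, fun x hx => ?_, fun p hp q hq => ?_⟩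
  · have h1 : HasFDerivAt f (LinearMap.toContinuousLinearMap f.linear) x := by
      rw [f.decomp]
      exact (LinearMap.toContinuousLinearMap f.linear).hasFDerivAt.add_const _
    exact h1.congr_of_eventuallyEq (hf.eventuallyEq_of_mem (mem_interior_iff_mem_nhds.1 hx))
  · rw [hf hp, hf hq]
    simpa using (f.linearMap_vsub p q).symm

/-- The boundary of a convex set is a null set, and there are only countably many triangles. -/
theorem ae_mem_interior (T : BackgroundMesh L) :
    ∀ᵐ x : Plane, ∀ t ∈ triangles T.K, x ∈ tri t → x ∈ interior (tri t) := by
  rw [ae_ball_iff T.countable_triangles]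
  intro t _
  have h : volume (frontier (tri t)) = 0 := (convex_convexHull ℝ _).addHaar_frontier volume
  rw [measure_eq_zero_iff_ae_notMem] at h
  filter_upwards [h] with x hx hxt
  by_contra h'
  exact hx ⟨subset_closure hxt, h'⟩

theorem ae_differentiableAt {g : Plane → E} (hg : T.IsPL g) :
    ∀ᵐ x : Plane, DifferentiableAt ℝ g x := by
  filter_upwards [T.ae_mem_interior] with x hx
  obtain ⟨t, ht, hxt⟩ := T.cover x
  obtain ⟨G, hG, -⟩ := hg.exists_hasFDerivAt ht
  exact (hG x (hx t ht hxt)).differentiableAt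

/-- With `IsPL.norm_fderiv_le` this makes oscillation and gradient equivalent on a single triangle.
The factor nine counts the ordered pairs of vertices. -/
theorem IsPL.osc_le {g : Plane → E} (hg : T.IsPL g) {t : Finset Plane}
    (ht : t ∈ triangles T.K) {x : Plane} (hx : x ∈ interior (tri t)) :
    osc t g ≤ 9 * T.diam ^ 2 * ‖fderiv ℝ g x‖ ^ 2 := by
  obtain ⟨G, hG, hd⟩ := hg.exists_hasFDerivAt ht
  rw [(hG x hx).fderiv]
  have : ∀ p ∈ t, ∀ q ∈ t, ‖g p - g q‖ ^ 2 ≤ T.diam ^ 2 * ‖G‖ ^ 2 := by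
    intro p hp q hq
    rw [hd p (vertex_mem_tri hp) q (vertex_mem_tri hq), ← mul_pow]
    gcongr
    refine (G.le_opNorm _).trans ?_
    rw [mul_comm]
    gcongr
    rw [← dist_eq_norm]
    exact dist_le ht (vertex_mem_tri hp) (vertex_mem_tri hq)
  refine (Finset.sum_le_sum fun p hp => Finset.sum_le_sum fun q hq => this p hp q hq).trans ?_
  simp only [Finset.sum_const, ht.2, nsmul_eq_mul]
  push_cast
  linarith

theorem IsPL.norm_fderiv_le {g : Plane → E} (hg : T.IsPL g) {t : Finset Plane}
    (ht : t ∈ triangles T.K) {x : Plane} (hx : x ∈ interior (tri t)) :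
    ‖fderiv ℝ g x‖ ≤ T.lip * √(osc t g) := by
  have h0 : 0 ≤ T.lip * √(osc t g) := mul_nonneg T.lip_pos.le (Real.sqrt_nonneg _)
  have : LipschitzOnWith ⟨T.lip * √(osc t g), h0⟩ g (tri t) := by
    refine LipschitzOnWith.of_dist_le_mul fun a ha b hb => ?_
    rw [dist_eq_norm, dist_eq_norm]
    exact hg.norm_sub_le ht ha hb
  exact norm_fderiv_le_of_lipschitzOn ℝ (mem_interior_iff_mem_nhds.1 hx) this

/-! ### The Frobenius inner product -/

theorem frob_self (F : Plane →L[ℝ] Plane) :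
    frob F F = ∑ i : Fin 2, ‖F (EuclideanSpace.single i 1)‖ ^ 2 := by
  simp [frob]

theorem frob_self_nonneg (F : Plane →L[ℝ] Plane) : 0 ≤ frob F F := by
  rw [frob_self]; positivity

theorem norm_sq_le_frob (F : Plane →L[ℝ] Plane) : ‖F‖ ^ 2 ≤ frob F F := by
  have h : ‖F‖ ≤ √(frob F F) := by
    refine F.opNorm_le_bound (Real.sqrt_nonneg _) fun x => ?_
    refine (sq_le_sq₀ (norm_nonneg _) (by positivity)).1 ?_
    have hx : x = x 0 • EuclideanSpace.single 0 1 + x 1 • EuclideanSpace.single 1 1 := by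
      ext i; fin_cases i <;> simp
    have h1 : ‖F x‖ ≤ |x 0| * ‖F (EuclideanSpace.single 0 1)‖ +
        |x 1| * ‖F (EuclideanSpace.single 1 1)‖ := by
      conv_lhs => rw [hx, map_add, map_smul, map_smul]
      refine (norm_add_le _ _).trans ?_
      rw [norm_smul, norm_smul, Real.norm_eq_abs, Real.norm_eq_abs]
    rw [mul_pow, Real.sq_sqrt (frob_self_nonneg F), frob_self, EuclideanSpace.norm_sq_eq x,
      Fin.sum_univ_two, Fin.sum_univ_two, Real.norm_eq_abs, Real.norm_eq_abs]
    set a := |x 0|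
    set b := |x 1|
    set c := ‖F (EuclideanSpace.single 0 1)‖
    set d := ‖F (EuclideanSpace.single 1 1)‖
    calc ‖F x‖ ^ 2 ≤ (a * c + b * d) ^ 2 := by gcongr
      _ ≤ _ := by nlinarith [sq_nonneg (a * d - b * c)]
  calc ‖F‖ ^ 2 ≤ √(frob F F) ^ 2 := by gcongr
    _ = _ := Real.sq_sqrt (frob_self_nonneg F)

theorem frob_le_norm_sq (F : Plane →L[ℝ] Plane) : frob F F ≤ 2 * ‖F‖ ^ 2 := by
  rw [frob_self, Fin.sum_univ_two]
  have : ∀ i, ‖F (EuclideanSpace.single i 1)‖ ^ 2 ≤ ‖F‖ ^ 2 := fun i => by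
    have := F.le_opNorm (EuclideanSpace.single i 1)
    rw [PiLp.norm_single, norm_one, mul_one] at this
    gcongr
  linarith [this 0, this 1]

theorem measurable_frob_fderiv (f g : Plane → Plane) :
    Measurable fun x => frob (fderiv ℝ f x) (fderiv ℝ g x) := by
  unfold frob
  refine Finset.measurable_sum _ fun i _ => Measurable.inner ?_ ?_
  · exact measurable_fderiv_apply_const ℝ f _
  · exact measurable_fderiv_apply_const ℝ g _

/-! ### The energy space -/

theorem normU12_sq (T : BackgroundMesh L) (u : L.sites → Plane) : T.normU12 u ^ 2 =
    ∫ x, frob (fderiv ℝ (T.interp u) x) (fderiv ℝ (T.interp u) x) := by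
  rw [normU12, gradNorm, dirichlet, setIntegral_univ,
    Real.sq_sqrt (integral_nonneg fun _ => frob_self_nonneg _)]

theorem normU12_nonneg (T : BackgroundMesh L) (u : L.sites → Plane) : 0 ≤ T.normU12 u :=
  Real.sqrt_nonneg _

theorem IsU12.smul {u : L.sites → Plane} (hu : T.IsU12 u) (c : ℝ) : T.IsU12 (c • u) := by
  have : ∀ x, frob (fderiv ℝ (T.interp (c • u)) x) (fderiv ℝ (T.interp (c • u)) x) =
      c ^ 2 * frob (fderiv ℝ (T.interp u) x) (fderiv ℝ (T.interp u) x) := by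
    intro x
    rw [interp_smul, fderiv_const_smul_field, frob_self, frob_self, Finset.mul_sum]
    refine Finset.sum_congr rfl fun i _ => ?_
    simp [norm_smul, mul_pow]
  simp only [IsU12, this]
  exact Integrable.const_mul hu _

theorem normU12_smul (u : L.sites → Plane) (c : ℝ) : T.normU12 (c • u) = |c| * T.normU12 u := by
  have : ∀ x, frob (fderiv ℝ (T.interp (c • u)) x) (fderiv ℝ (T.interp (c • u)) x) =
      c ^ 2 * frob (fderiv ℝ (T.interp u) x) (fderiv ℝ (T.interp u) x) := by
    intro x
    rw [interp_smul, fderiv_const_smul_field, frob_self, frob_self, Finset.mul_sum]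
    refine Finset.sum_congr rfl fun i _ => ?_
    simp [norm_smul, mul_pow]
  rw [← abs_of_nonneg (T.normU12_nonneg (c • u)), ← abs_of_nonneg (T.normU12_nonneg u),
    ← abs_mul, ← sq_eq_sq_iff_abs_eq_abs, mul_pow, normU12_sq, normU12_sq]
  simp only [this]
  rw [integral_const_mul]

theorem IsU12.add {u v : L.sites → Plane} (hu : T.IsU12 u) (hv : T.IsU12 v) :
    T.IsU12 (u + v) := by
  refine Integrable.mono' ((Integrable.add hu hv).const_mul 2)
    (measurable_frob_fderiv _ _).aestronglyMeasurable ?_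
  filter_upwards [ae_differentiableAt (T.isPL_interp u), ae_differentiableAt (T.isPL_interp v)]
    with x h1 h2
  rw [interp_add, fderiv_add h1 h2, Real.norm_of_nonneg (frob_self_nonneg _)]
  simp only [Pi.add_apply, frob_self, Fin.sum_univ_two, _root_.add_apply]
  have : ∀ a b : Plane, ‖a + b‖ ^ 2 ≤ 2 * (‖a‖ ^ 2 + ‖b‖ ^ 2) := fun a b => by
    nlinarith [parallelogram_law_with_norm ℝ a b, norm_nonneg (a - b)]
  have h3 := this (fderiv ℝ (T.interp u) x (EuclideanSpace.single 0 1))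
    (fderiv ℝ (T.interp v) x (EuclideanSpace.single 0 1))
  have h4 := this (fderiv ℝ (T.interp u) x (EuclideanSpace.single 1 1))
    (fderiv ℝ (T.interp v) x (EuclideanSpace.single 1 1))
  linarith

theorem IsU12.sub {u v : L.sites → Plane} (hu : T.IsU12 u) (hv : T.IsU12 v) :
    T.IsU12 (u - v) := by
  have := hu.add (hv.smul (-1))
  rwa [neg_one_smul, ← sub_eq_add_neg] at this

/-- Constants are admissible test functions, which is what forces the residual forces to balance. -/
theorem isU12_const (T : BackgroundMesh L) (c : Plane) : T.IsU12 fun _ => c := by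
  simp [IsU12, interp_const, frob]

variable (T) in
/-- The constant in the estimate of nodal differences by the energy norm. -/
def oscConst : ℝ := T.nearBound 0 * (9 * T.diam ^ 2) / T.area

theorem oscConst_nonneg : 0 ≤ T.oscConst := by
  have := T.area_pos
  unfold oscConst
  positivity

/-- The area bound turns each oscillation into an integral over its triangle, where it is bounded by
the squared gradient; a point lies in at most `nearBound 0` triangles. -/
theorem sum_osc_le {u : L.sites → Plane} (hu : T.IsU12 u) (F : Finset (Finset Plane))
    (hF : ∀ t ∈ F, t ∈ triangles T.K) :
    ∑ t ∈ F, osc t (T.interp u) ≤ T.oscConst * T.normU12 u ^ 2 := by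
  classical
  have hA := T.area_pos
  have hfin : ∀ t : Finset Plane, volume (tri t) ≠ ⊤ := fun t => (isCompact_tri t).measure_ne_top
  have h1 : (∑ t ∈ F, osc t (T.interp u)) * T.area ≤
      ∫ x, ∑ t ∈ F, (tri t).indicator (fun _ => osc t (T.interp u)) x := by
    rw [integral_finsetSum, Finset.sum_mul]
    · refine Finset.sum_le_sum fun t ht => ?_
      rw [integral_indicator (measurableSet_tri t), setIntegral_const, smul_eq_mul, mul_comm]
      exact mul_le_mul_of_nonneg_right (area_le (hF t ht)) (osc_nonneg _ _)
    · intro t _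
      exact (integrableOn_const (hfin t)).integrable_indicator (measurableSet_tri t)
  have h2 : ∫ x, ∑ t ∈ F, (tri t).indicator (fun _ => osc t (T.interp u)) x ≤
      ∫ x, T.nearBound 0 * (9 * T.diam ^ 2) *
        frob (fderiv ℝ (T.interp u) x) (fderiv ℝ (T.interp u) x) := by
    refine integral_mono_of_nonneg (ae_of_all _ fun x => Finset.sum_nonneg fun t _ =>
      indicator_nonneg (fun _ _ => osc_nonneg _ _) _) (Integrable.const_mul hu _) ?_
    filter_upwards [T.ae_mem_interior] with x hx
    set Q := frob (fderiv ℝ (T.interp u) x) (fderiv ℝ (T.interp u) x)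
    have hQ : 0 ≤ Q := frob_self_nonneg _
    have h3 : ∀ t ∈ F, (tri t).indicator (fun _ => osc t (T.interp u)) x ≤
        if x ∈ tri t then 9 * T.diam ^ 2 * Q else 0 := by
      intro t ht
      by_cases hxt : x ∈ tri t
      · rw [indicator_of_mem hxt, if_pos hxt]
        refine ((T.isPL_interp u).osc_le (hF t ht) (hx t (hF t ht) hxt)).trans ?_
        gcongr
        exact norm_sq_le_frob _
      · rw [indicator_of_notMem hxt, if_neg hxt]
    refine (Finset.sum_le_sum h3).trans ?_
    rw [← Finset.sum_filter, Finset.sum_const, nsmul_eq_mul, mul_assoc (T.nearBound 0 : ℝ)]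
    refine mul_le_mul_of_nonneg_right ?_ (by positivity)
    refine Nat.cast_le.2 (card_le_nearBound _ x 0 fun t ht => ?_)
    rw [Finset.mem_filter] at ht
    exact mem_near_of_mem (hF t ht.1) ht.2 (by simp)
  rw [integral_const_mul, ← normU12_sq] at h2
  rw [oscConst, div_mul_eq_mul_div, le_div_iff₀ hA]
  exact h1.trans h2

variable (T) in
/-- The constant in the estimate of the energy norm by nodal differences. -/
def normConst : ℝ := 2 * T.lip ^ 2 * volume.real (Metric.closedBall (0 : Plane) T.diam)

theorem normConst_nonneg : 0 ≤ T.normConst := by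
  unfold normConst
  positivity

theorem area_tri_le_ball {t : Finset Plane} (ht : t ∈ triangles T.K) :
    volume.real (tri t) ≤ volume.real (Metric.closedBall (0 : Plane) T.diam) := by
  obtain ⟨p, hp⟩ := T.K.nonempty_of_mem_faces ht.1
  have h : tri t ⊆ Metric.closedBall p T.diam := fun x hx => dist_le ht hx (vertex_mem_tri hp)
  have h2 : volume (Metric.closedBall p T.diam) = volume (Metric.closedBall (0 : Plane) T.diam) :=
    Measure.addHaar_closedBall_center _ _ _
  rw [measureReal_def, measureReal_def, ← h2]
  exact ENNReal.toReal_mono measure_closedBall_lt_top.ne (measure_mono h)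

/-- The converse of `sum_osc_le`: almost everywhere the squared gradient is bounded by the
oscillation of the surrounding triangle, whose area is at most that of a disc. -/
theorem isU12_and_normU12_sq_le {u : L.sites → Plane} (F : Finset (Finset Plane))
    (hF : ∀ t ∈ F, t ∈ triangles T.K)
    (hu : ∀ t ∈ triangles T.K, t ∉ F → osc t (T.interp u) = 0) :
    T.IsU12 u ∧ T.normU12 u ^ 2 ≤ T.normConst * ∑ t ∈ F, osc t (T.interp u) := by
  classical
  have hfin : ∀ t : Finset Plane, volume (tri t) ≠ ⊤ := fun t => (isCompact_tri t).measure_ne_top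
  have hi : ∀ t ∈ F, Integrable ((tri t).indicator fun _ => 2 * T.lip ^ 2 * osc t (T.interp u)) :=
    fun t _ => (integrableOn_const (hfin t)).integrable_indicator (measurableSet_tri t)
  have hint := integrable_finsetSum F hi
  have hb : ∀ᵐ x : Plane, frob (fderiv ℝ (T.interp u) x) (fderiv ℝ (T.interp u) x) ≤
      ∑ t ∈ F, (tri t).indicator (fun _ => 2 * T.lip ^ 2 * osc t (T.interp u)) x := by
    filter_upwards [T.ae_mem_interior] with x hx
    obtain ⟨t, ht, hxt⟩ := T.cover x
    have h1 : frob (fderiv ℝ (T.interp u) x) (fderiv ℝ (T.interp u) x) ≤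
        2 * T.lip ^ 2 * osc t (T.interp u) := by
      refine (frob_le_norm_sq _).trans ?_
      have h2 := (T.isPL_interp u).norm_fderiv_le ht (hx t ht hxt)
      calc _ ≤ 2 * (T.lip * √(osc t (T.interp u))) ^ 2 := by gcongr
        _ = _ := by rw [mul_pow, Real.sq_sqrt (osc_nonneg _ _)]; ring
    have hnn : ∀ s ∈ F, 0 ≤ (tri s).indicator (fun _ => 2 * T.lip ^ 2 * osc s (T.interp u)) x :=
      fun s _ => indicator_nonneg (fun _ _ => mul_nonneg (by positivity) (osc_nonneg _ _)) _
    by_cases htF : t ∈ F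
    · refine h1.trans (le_trans ?_ (Finset.single_le_sum hnn htF))
      rw [indicator_of_mem hxt]
    · rw [hu t ht htF, mul_zero] at h1
      exact h1.trans (Finset.sum_nonneg hnn)
  have hU : T.IsU12 u := by
    refine Integrable.mono' hint (measurable_frob_fderiv _ _).aestronglyMeasurable ?_
    filter_upwards [hb] with x hx
    rw [Real.norm_of_nonneg (frob_self_nonneg _)]
    exact hx
  refine ⟨hU, ?_⟩
  rw [normU12_sq]
  refine (integral_mono_ae hU hint hb).trans ?_
  rw [integral_finsetSum _ hi, Finset.mul_sum]
  refine Finset.sum_le_sum fun t ht => ?_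
  rw [integral_indicator (measurableSet_tri t), setIntegral_const, smul_eq_mul, normConst]
  have := area_tri_le_ball (hF t ht)
  have := osc_nonneg t (T.interp u)
  have := T.lip_pos
  calc volume.real (tri t) * (2 * T.lip ^ 2 * osc t (T.interp u)) ≤
      volume.real (Metric.closedBall (0 : Plane) T.diam) * (2 * T.lip ^ 2 * osc t (T.interp u)) := by
        gcongr
    _ = _ := by ring

/-- Double counting: a triangle is charged only by points within `r + diam` of any chosen vertex of
it, hence at most `N` times. The points will be lattice sites or integer grid points. -/
theorem sum_near_osc_le {u : L.sites → Plane} (hu : T.IsU12 u) {ι : Type*} (I : Finset ι)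
    (x : ι → Plane) {r : ℝ} {N : ℕ}
    (hN : ∀ p : Plane, ∀ J ⊆ I, (∀ i ∈ J, dist (x i) p ≤ r + T.diam) → J.card ≤ N) :
    ∑ i ∈ I, ∑ t ∈ T.near (x i) r, osc t (T.interp u) ≤
      N * (T.oscConst * T.normU12 u ^ 2) := by
  classical
  set F := I.biUnion fun i => T.near (x i) r
  have hF : ∀ t ∈ F, t ∈ triangles T.K := by
    intro t ht
    obtain ⟨i, -, h⟩ := Finset.mem_biUnion.1 ht
    exact (mem_near.1 h).1
  have h1 : ∀ i ∈ I, ∑ t ∈ T.near (x i) r, osc t (T.interp u) =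
      ∑ t ∈ F, if t ∈ T.near (x i) r then osc t (T.interp u) else 0 := by
    intro i hi
    rw [← Finset.sum_filter]
    refine Finset.sum_congr ?_ fun _ _ => rfl
    ext t
    simp only [Finset.mem_filter, F, Finset.mem_biUnion]
    exact ⟨fun h => ⟨⟨i, hi, h⟩, h⟩, fun h => h.2⟩
  rw [Finset.sum_congr rfl h1, Finset.sum_comm]
  refine le_trans ?_ (mul_le_mul_of_nonneg_left (sum_osc_le hu F hF) (Nat.cast_nonneg N))
  rw [Finset.mul_sum]
  refine Finset.sum_le_sum fun t ht => ?_
  rw [← Finset.sum_filter, Finset.sum_const, nsmul_eq_mul]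
  refine mul_le_mul_of_nonneg_right ?_ (osc_nonneg _ _)
  obtain ⟨p, hp⟩ := T.K.nonempty_of_mem_faces (hF t ht).1
  refine Nat.cast_le.2 (hN p _ (Finset.filter_subset _ _) fun i hi => ?_)
  obtain ⟨htt, z, hz, hzx⟩ := mem_near.1 (Finset.mem_filter.1 hi).2
  have a1 := dist_le htt hz (vertex_mem_tri hp)
  have a2 : dist z (x i) ≤ r := hzx
  have := dist_triangle_left (x i) p z
  linarith

/-- Differences of values of the interpolant at pairs of points with bounded overlap are controlled
by the energy norm. -/
theorem sum_norm_sub_sq_le {u : L.sites → Plane} (hu : T.IsU12 u) {ι : Type*} (I : Finset ι)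
    (x y : ι → Plane) {r : ℝ} (hxy : ∀ i ∈ I, dist (x i) (y i) ≤ r) {N : ℕ}
    (hN : ∀ p : Plane, ∀ J ⊆ I, (∀ i ∈ J, dist (x i) p ≤ r + T.diam) → J.card ≤ N) :
    ∑ i ∈ I, ‖T.interp u (x i) - T.interp u (y i)‖ ^ 2 ≤
      T.lip ^ 2 * r ^ 2 * (N * (T.oscConst * T.normU12 u ^ 2)) := by
  refine (Finset.sum_le_sum fun i hi =>
    (T.isPL_interp u).norm_sub_le_of_dist_le (hxy i hi)).trans ?_
  rw [← Finset.mul_sum]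
  gcongr
  exact sum_near_osc_le hu I x hN

end BackgroundMesh

end

noncomputable section

/-! ### A Poincaré inequality -/

section Discrete

variable {E : Type*} [NormedAddCommGroup E]

theorem norm_sub_sq_le_two (a b c : E) : ‖a - c‖ ^ 2 ≤ 2 * (‖a - b‖ ^ 2 + ‖b - c‖ ^ 2) := by
  have h := norm_sub_le_norm_sub_add_norm_sub a b c
  have := norm_nonneg (a - c)
  nlinarith [sq_nonneg (‖a - b‖ - ‖b - c‖)]

theorem norm_sub_sq_le_sum_range (V : ℕ → E) {m a b : ℕ} (ha : a < m) (hb : b < m) :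
    ‖V a - V b‖ ^ 2 ≤ m * ∑ i ∈ Finset.range m, ‖V (i + 1) - V i‖ ^ 2 := by
  wlog hab : a ≤ b generalizing a b
  · rw [norm_sub_rev]
    exact this hb ha (le_of_not_ge hab)
  have h1 : ‖V a - V b‖ ≤ ∑ i ∈ Finset.range m, ‖V (i + 1) - V i‖ := by
    rw [norm_sub_rev, ← Finset.sum_Ico_sub V hab]
    refine (norm_sum_le _ _).trans ?_
    refine Finset.sum_le_sum_of_subset_of_nonneg ?_ fun _ _ _ => norm_nonneg _
    intro i hi
    rw [Finset.mem_Ico] at hi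
    rw [Finset.mem_range]
    omega
  calc ‖V a - V b‖ ^ 2 ≤ (∑ i ∈ Finset.range m, ‖V (i + 1) - V i‖) ^ 2 := by gcongr
    _ ≤ _ := by
      have := sq_sum_le_card_mul_sum_sq (s := Finset.range m) (f := fun i => ‖V (i + 1) - V i‖)
      rwa [Finset.card_range] at this

/-- The discrete Poincaré inequality on a square grid. -/
theorem discrete_poincare (V : ℕ → ℕ → E) {m : ℕ} (hm : 0 < m) :
    ∃ c : E, ∑ a ∈ Finset.range m, ∑ b ∈ Finset.range m, ‖V a b - c‖ ^ 2 ≤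
      2 * m ^ 2 * (∑ a ∈ Finset.range m, ∑ b ∈ Finset.range m, ‖V (a + 1) b - V a b‖ ^ 2 +
        ∑ a ∈ Finset.range m, ∑ b ∈ Finset.range m, ‖V a (b + 1) - V a b‖ ^ 2) := by
  set Y : ℕ → ℝ := fun a => ∑ b ∈ Finset.range m, ‖V a (b + 1) - V a b‖ ^ 2 with hY
  set X : ℕ → ℝ := fun b => ∑ a ∈ Finset.range m, ‖V (a + 1) b - V a b‖ ^ 2 with hX
  -- The reference column is the one of least vertical energy, so that `m * Y a'` is at most the
  -- total vertical energy. Every node is joined to `(a', 0)` by going along its row to this column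
  -- and then down the column.
  obtain ⟨a', ha', hmin⟩ := Finset.exists_min_image (Finset.range m) Y ⟨0, by simpa using hm⟩
  have h1 : m * Y a' ≤ ∑ a ∈ Finset.range m, Y a := by
    have := Finset.card_nsmul_le_sum (Finset.range m) Y (Y a') hmin
    rwa [Finset.card_range, nsmul_eq_mul] at this
  have ha'm := Finset.mem_range.1 ha'
  refine ⟨V a' 0, ?_⟩
  have h2 : ∀ a ∈ Finset.range m, ∀ b ∈ Finset.range m,
      ‖V a b - V a' 0‖ ^ 2 ≤ 2 * (m * X b + m * Y a') := by
    intro a ha b hb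
    rw [Finset.mem_range] at ha hb
    refine (norm_sub_sq_le_two _ (V a' b) _).trans ?_
    have k1 := norm_sub_sq_le_sum_range (fun i => V i b) ha ha'm
    have k2 := norm_sub_sq_le_sum_range (V a') hb hm
    simp only [hX, hY]
    linarith
  refine (Finset.sum_le_sum fun a ha => Finset.sum_le_sum fun b hb => h2 a ha b hb).trans ?_
  have hcomm : ∑ a ∈ Finset.range m, ∑ b ∈ Finset.range m, ‖V (a + 1) b - V a b‖ ^ 2 =
      ∑ b ∈ Finset.range m, X b := Finset.sum_comm
  rw [hcomm]
  simp only [← Finset.mul_sum, Finset.sum_add_distrib, Finset.sum_const, Finset.card_range,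
    nsmul_eq_mul]
  have hm0 : (0 : ℝ) ≤ m := Nat.cast_nonneg m
  nlinarith [mul_le_mul_of_nonneg_left h1 (mul_nonneg hm0 hm0)]

end Discrete

theorem DefectLattice.card_sites_le (L : DefectLattice) {r : ℝ} {x : Plane} (S : Finset L.sites)
    (hS : ∀ ℓ ∈ S, dist (ℓ : Plane) x ≤ r) : S.card ≤ L.siteBound r := by
  rw [← Finset.card_map (Function.Embedding.subtype _)]
  refine L.card_le_siteBound r x _ fun p hp => ?_
  obtain ⟨ℓ, hℓ, rfl⟩ := Finset.mem_map.1 hp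
  exact ⟨ℓ.2, hS ℓ hℓ⟩

/-- The lattice `ℤ²`. -/
def squareLattice : DefectLattice where
  A := 1
  det_ne_zero := by simp
  sites := homLattice 1
  rDef := 1
  rDef_pos := one_pos
  finite_core := homLattice_inter_ball_finite 1 (by simp) 0 1
  far_eq := rfl

/-- The points of a square grid. -/
def gridPoint (n : ℕ) (k : ℕ × ℕ) : Plane := !₂[(k.1 : ℝ) - n, (k.2 : ℝ) - n]

theorem gridPoint_injective (n : ℕ) : Function.Injective (gridPoint n) := by
  intro k k' h
  have h0 : gridPoint n k 0 = gridPoint n k' 0 := by rw [h]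
  have h1 : gridPoint n k 1 = gridPoint n k' 1 := by rw [h]
  simp only [gridPoint] at h0 h1
  ext
  · simpa using h0
  · simpa using h1

/-- Grid points are sites of `squareLattice`, so the site count for lattices applies to them. -/
theorem card_gridPoint_le (n : ℕ) {r : ℝ} {x : Plane} (J : Finset (ℕ × ℕ))
    (hJ : ∀ k ∈ J, dist (gridPoint n k) x ≤ r) : J.card ≤ squareLattice.siteBound r := by
  classical
  rw [← Finset.card_image_of_injective J (gridPoint_injective n)]
  refine squareLattice.card_le_siteBound r x _ fun p hp => ?_
  obtain ⟨k, hk, rfl⟩ := Finset.mem_image.1 hp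
  refine ⟨⟨![(k.1 : ℤ) - n, (k.2 : ℤ) - n], ?_⟩, hJ k hk⟩
  ext i
  fin_cases i <;> simp [gridPoint]

theorem dist_le_two {x y : Plane} (h0 : |x 0 - y 0| ≤ 1) (h1 : |x 1 - y 1| ≤ 1) :
    dist x y ≤ 2 := by
  rw [EuclideanSpace.dist_eq, Fin.sum_univ_two, Real.dist_eq, Real.dist_eq]
  refine Real.sqrt_le_iff.2 ⟨by norm_num, ?_⟩
  have := abs_nonneg (x 0 - y 0)
  have := abs_nonneg (x 1 - y 1)
  nlinarith

namespace BackgroundMesh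

variable {L : DefectLattice} {T : BackgroundMesh L}

/-- The nodal values in a ball deviate from a suitable constant by at most a multiple of the
radius times the energy norm. -/
theorem poincare (T : BackgroundMesh L) : ∃ C : ℝ, 0 ≤ C ∧ ∀ u : L.sites → Plane, T.IsU12 u →
    ∀ R : ℝ, 0 ≤ R → ∃ c : Plane, ∀ S : Finset L.sites, (∀ ℓ ∈ S, ‖(ℓ : Plane)‖ ≤ R) →
      ∑ ℓ ∈ S, ‖u ℓ - c‖ ^ 2 ≤ C * (R + 1) ^ 2 * T.normU12 u ^ 2 := by
  classical
  set N₁ := squareLattice.siteBound (2 + T.diam)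
  set N₂ := L.siteBound (2 + T.diam)
  set N₃ := L.siteBound 2
  set B := T.lip ^ 2 * 2 ^ 2 * T.oscConst with hB
  have hB0 : 0 ≤ B := mul_nonneg (by positivity) T.oscConst_nonneg
  refine ⟨2 * (N₂ * B + N₃ * (2 * 9 * (2 * (N₁ * B)))), by positivity, fun u hu R hR => ?_⟩
  set n := ⌈R⌉₊
  have hn : R ≤ n := Nat.le_ceil R
  have hn' : (n : ℝ) ≤ R + 1 := (Nat.ceil_lt_add_one hR).le
  -- The indices `0, …, 2n` give all integer coordinates from `-n` to `n`, which cover the ball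
  -- since `R ≤ n`.
  set m := 2 * n + 1
  set Q := T.normU12 u ^ 2 with hQ
  have hQ0 : 0 ≤ Q := sq_nonneg _
  let V : ℕ → ℕ → Plane := fun a b => T.interp u (gridPoint n (a, b))
  obtain ⟨c, hc⟩ := discrete_poincare V (m := m) (by omega)
  refine ⟨c, fun S hS => ?_⟩
  let G := Finset.range m ×ˢ Finset.range m
  have hgrid : ∀ σ : ℕ × ℕ → ℕ × ℕ, (∀ k, dist (gridPoint n (σ k)) (gridPoint n k) ≤ 2) →
      ∑ k ∈ G, ‖T.interp u (gridPoint n (σ k)) - T.interp u (gridPoint n k)‖ ^ 2 ≤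
        N₁ * B * Q := by
    intro σ hσ
    have := sum_norm_sub_sq_le hu G (gridPoint n) (fun k => gridPoint n (σ k)) (r := 2) (N := N₁)
      (fun k _ => by rw [dist_comm]; exact hσ k)
      (fun p J _ hJ => card_gridPoint_le n J hJ)
    simp only [norm_sub_rev (T.interp u (gridPoint n (σ _)))]
    calc _ ≤ _ := this
      _ = _ := by rw [hB]; ring
  have hX := hgrid (fun k => (k.1 + 1, k.2)) fun k => dist_le_two (by simp [gridPoint])
    (by simp [gridPoint])
  have hY := hgrid (fun k => (k.1, k.2 + 1)) fun k => dist_le_two (by simp [gridPoint])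
    (by simp [gridPoint])
  have hc2 : ∑ k ∈ G, ‖T.interp u (gridPoint n k) - c‖ ^ 2 ≤
      2 * m ^ 2 * (2 * (N₁ * B) * Q) := by
    rw [Finset.sum_product]
    refine hc.trans ?_
    rw [Finset.sum_product] at hX hY
    refine mul_le_mul_of_nonneg_left ?_ (by positivity)
    linarith
  -- Each site is compared with the integer point at the lower left corner of its unit cell. This
  -- costs only local differences, and a bounded number of sites shares one grid point, so the grid
  -- inequality carries over.
  let idx : L.sites → ℕ × ℕ := fun ℓ => (⌊(ℓ : Plane) 0 + n⌋₊, ⌊(ℓ : Plane) 1 + n⌋₊)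
  have hcoord : ∀ ℓ ∈ S, ∀ i, |(ℓ : Plane) i| ≤ n := fun ℓ hℓ i =>
    ((by simpa using PiLp.norm_apply_le (ℓ : Plane) i : |(ℓ : Plane) i| ≤ ‖(ℓ : Plane)‖).trans
      (hS ℓ hℓ)).trans hn
  have hfl : ∀ x : ℝ, |x| ≤ n → ⌊x + n⌋₊ < m ∧ |x - ((⌊x + n⌋₊ : ℝ) - n)| ≤ 1 := by
    intro x hx
    obtain ⟨h1, h2⟩ := abs_le.1 hx
    have h3 := Nat.floor_le (show 0 ≤ x + n by linarith)
    have h4 := Nat.lt_floor_add_one (x + n)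
    refine ⟨?_, abs_le.2 ⟨by linarith, by linarith⟩⟩
    rw [Nat.floor_lt (by linarith)]
    push_cast [m]
    linarith
  have hidx : ∀ ℓ ∈ S, idx ℓ ∈ G := fun ℓ hℓ => Finset.mk_mem_product
    (Finset.mem_range.2 (hfl _ (hcoord ℓ hℓ 0)).1) (Finset.mem_range.2 (hfl _ (hcoord ℓ hℓ 1)).1)
  have hdist : ∀ ℓ ∈ S, dist (ℓ : Plane) (gridPoint n (idx ℓ)) ≤ 2 := fun ℓ hℓ =>
    dist_le_two (by simpa [gridPoint, idx] using (hfl _ (hcoord ℓ hℓ 0)).2)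
      (by simpa [gridPoint, idx] using (hfl _ (hcoord ℓ hℓ 1)).2)
  have h1 := sum_norm_sub_sq_le hu S (fun ℓ => (ℓ : Plane)) (fun ℓ => gridPoint n (idx ℓ))
    (r := 2) (N := N₂) hdist fun p J _ hJ => L.card_sites_le J hJ
  have h2 : ∑ ℓ ∈ S, ‖T.interp u (gridPoint n (idx ℓ)) - c‖ ^ 2 ≤
      N₃ * ∑ k ∈ G, ‖T.interp u (gridPoint n k) - c‖ ^ 2 := by
    rw [← Finset.sum_fiberwise_of_maps_to hidx, Finset.mul_sum]
    refine Finset.sum_le_sum fun k _ => ?_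
    have : ∀ ℓ ∈ S.filter (fun ℓ => idx ℓ = k), ‖T.interp u (gridPoint n (idx ℓ)) - c‖ ^ 2 =
        ‖T.interp u (gridPoint n k) - c‖ ^ 2 := by
      intro ℓ hℓ
      rw [(Finset.mem_filter.1 hℓ).2]
    rw [Finset.sum_congr rfl this, Finset.sum_const, nsmul_eq_mul]
    refine mul_le_mul_of_nonneg_right (Nat.cast_le.2 ?_) (sq_nonneg _)
    refine L.card_sites_le (x := gridPoint n k) _ fun ℓ hℓ => ?_
    obtain ⟨h, rfl⟩ := Finset.mem_filter.1 hℓ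
    exact hdist ℓ h
  have hm : (m : ℝ) ^ 2 ≤ 9 * (R + 1) ^ 2 := by
    have : (m : ℝ) ≤ 3 * (R + 1) := by
      push_cast [m]
      linarith
    calc (m : ℝ) ^ 2 ≤ (3 * (R + 1)) ^ 2 := by gcongr
      _ = _ := by ring
  have hR1 : 1 ≤ (R + 1) ^ 2 := by nlinarith
  calc ∑ ℓ ∈ S, ‖u ℓ - c‖ ^ 2
      ≤ ∑ ℓ ∈ S, 2 * (‖T.interp u ℓ - T.interp u (gridPoint n (idx ℓ))‖ ^ 2 +
          ‖T.interp u (gridPoint n (idx ℓ)) - c‖ ^ 2) := by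
        refine Finset.sum_le_sum fun ℓ _ => ?_
        rw [interp_site]
        exact norm_sub_sq_le_two _ _ _
    _ ≤ 2 * (N₂ * B * Q * (R + 1) ^ 2 + N₃ * (2 * (9 * (R + 1) ^ 2) * (2 * (N₁ * B) * Q))) := by
        rw [← Finset.mul_sum, Finset.sum_add_distrib]
        gcongr
        · refine h1.trans ?_
          calc _ = N₂ * B * Q * 1 := by rw [hB]; ring
            _ ≤ _ := by gcongr
        · refine h2.trans ?_
          gcongr
          refine hc2.trans ?_
          gcongr
    _ = _ := by ring

end BackgroundMesh

end

/-! ### Nodal sums against integrals of the interpolant -/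

noncomputable section

namespace BackgroundMesh

variable {L : DefectLattice} {T : BackgroundMesh L}
variable {E : Type*} [NormedAddCommGroup E] [NormedSpace ℝ E]

/-! ### Nodal values and integrals -/

theorem volume_real_homothety (p : Plane) (r : ℝ) (s : Set Plane) :
    volume.real (AffineMap.homothety p r '' s) = r ^ 2 * volume.real s := by
  rw [measureReal_def, Measure.addHaar_image_homothety, ENNReal.toReal_mul, measureReal_def,
    ENNReal.toReal_ofReal (abs_nonneg _), finrank_euclideanSpace_fin, abs_of_nonneg (sq_nonneg r)]

/-- The value of a piecewise affine function at a vertex is controlled by its integral over a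
scaled copy of the triangle. -/
theorem IsPL.norm_sq_le_integral {g : Plane → E} (hg : T.IsPL g) {t : Finset Plane}
    (ht : t ∈ triangles T.K) {p : Plane} (hp : p ∈ t) {s : ℝ} (hs0 : 0 < s) (hs1 : s ≤ 1) :
    s ^ 2 * T.area / 80 * ‖g p‖ ^ 2 ≤
      ∫ x in AffineMap.homothety p s '' tri t, ‖g x‖ ^ 2 := by
  obtain ⟨f, hf⟩ := hg t ht
  have hpt := vertex_mem_tri hp
  have hconv : Convex ℝ (tri t) := convex_convexHull ℝ _
  set D := AffineMap.homothety p s '' tri t with hD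
  have hDc : IsCompact D := (isCompact_tri t).image (AffineMap.homothety p s).continuous_of_finiteDimensional
  have hDt : ∀ r : ℝ, 0 ≤ r → r ≤ 1 → AffineMap.homothety p r '' tri t ⊆ tri t := by
    rintro r h0 h1 _ ⟨x, hx, rfl⟩
    rw [AffineMap.homothety_apply, vsub_eq_sub, vadd_eq_add, add_comm]
    have := hconv.add_smul_sub_mem hpt hx (t := r) ⟨h0, h1⟩
    exact this
  set A := {x ∈ D | ‖g p‖ / 4 ≤ ‖g x‖} with hA
  have hAD : A ⊆ D := fun x hx => hx.1
  have hAm : MeasurableSet A :=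
    (hDc.isClosed.inter (isClosed_le continuous_const hg.continuous.norm)).measurableSet
  have hAfin : volume A ≠ ⊤ := (hDc.measure_lt_top.trans_le' (measure_mono hAD)).ne
  -- If `y` is the midpoint of `p` and `z`, then `g p = 2 g y - g z`, so `‖g‖ ≥ ‖g p‖ / 4` at `y` or
  -- at `z`. Hence the copy scaled by `s / 2` is covered by `A` and the half-size copy of `A`.
  have hcov : AffineMap.homothety p (s / 2) '' tri t ⊆ A ∪ AffineMap.homothety p (1 / 2 : ℝ) '' A := by
    rintro _ ⟨x, hx, rfl⟩
    set y := AffineMap.homothety p (s / 2) x with hy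
    set z := AffineMap.homothety p s x with hz
    have hyz : AffineMap.homothety p (1 / 2 : ℝ) z = y := by
      rw [hy, hz, AffineMap.homothety_apply, AffineMap.homothety_apply, AffineMap.homothety_apply]
      simp only [vsub_eq_sub, vadd_eq_add]
      module
    have hzD : z ∈ D := ⟨x, hx, rfl⟩
    have hyD : y ∈ D := by
      refine ⟨AffineMap.homothety p (1 / 2 : ℝ) x, hDt _ (by norm_num) (by norm_num) ⟨x, hx, rfl⟩, ?_⟩
      rw [hy, AffineMap.homothety_apply, AffineMap.homothety_apply, AffineMap.homothety_apply]
      simp only [vsub_eq_sub, vadd_eq_add]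
      module
    have hDD := hDt s hs0.le hs1
    have hval : g p = (2 : ℝ) • g y - g z := by
      rw [hf hpt, hf (hDD hyD), hf (hDD hzD)]
      have h1 : f y = AffineMap.lineMap (f p) (f z) (1 / 2 : ℝ) := by
        rw [← AffineMap.apply_lineMap, ← hyz]
        rfl
      rw [h1, AffineMap.lineMap_apply_module]
      module
    by_cases h : ‖g p‖ / 4 ≤ ‖g y‖
    · exact Or.inl ⟨hyD, h⟩
    · refine Or.inr ⟨z, ⟨hzD, ?_⟩, hyz⟩
      have h1 : ‖g p‖ ≤ 2 * ‖g y‖ + ‖g z‖ := by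
        rw [hval]
        refine (_root_.norm_sub_le _ _).trans ?_
        rw [norm_smul, Real.norm_of_nonneg zero_le_two]
      have := norm_nonneg (g p)
      linarith
  -- Comparing areas, `s² |t| / 4 ≤ (1 + 1/4) |A|`. The fifth found here times the square of a
  -- quarter is the `1 / 80` of the statement.
  have hvol : s ^ 2 * T.area / 5 ≤ volume.real A := by
    have h1 : volume.real (AffineMap.homothety p (s / 2) '' tri t) ≤
        volume.real A + volume.real (AffineMap.homothety p (1 / 2 : ℝ) '' A) := by
      refine (measureReal_mono hcov ?_).trans (measureReal_union_le _ _)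
      refine measure_union_ne_top hAfin ?_
      rw [Measure.addHaar_image_homothety]
      exact ENNReal.mul_ne_top ENNReal.ofReal_ne_top hAfin
    rw [volume_real_homothety, volume_real_homothety] at h1
    have h2 := mul_le_mul_of_nonneg_left (area_le ht) (sq_nonneg s)
    nlinarith
  have hint : IntegrableOn (fun x => ‖g x‖ ^ 2) D :=
    (hg.continuous.norm.pow 2).continuousOn.integrableOn_compact hDc
  calc s ^ 2 * T.area / 80 * ‖g p‖ ^ 2 = s ^ 2 * T.area / 5 * (‖g p‖ / 4) ^ 2 := by ring
    _ ≤ volume.real A * (‖g p‖ / 4) ^ 2 := by gcongr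
    _ = ∫ x in A, (‖g p‖ / 4) ^ 2 := by rw [setIntegral_const, smul_eq_mul]
    _ ≤ ∫ x in A, ‖g x‖ ^ 2 := by
        refine setIntegral_mono_on (integrableOn_const hAfin) (hint.mono_set hAD) hAm ?_
        intro x hx
        have := hx.2
        gcongr
    _ ≤ ∫ x in D, ‖g x‖ ^ 2 :=
        setIntegral_mono_set hint (ae_of_all _ fun _ => by positivity) (LE.le.eventuallyLE hAD)

theorem exists_triangle (ℓ : L.sites) : ∃ t ∈ triangles T.K, (ℓ : Plane) ∈ t := by
  obtain ⟨t, ht, h⟩ := T.cover ℓ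
  exact ⟨t, ht, mem_of_mem_tri ht.1 ℓ.2 h⟩

theorem homothety_subset_ball {t : Finset Plane} (ht : t ∈ triangles T.K) {p : Plane}
    (hp : p ∈ t) {s : ℝ} (hs : 0 ≤ s) :
    AffineMap.homothety p s '' tri t ⊆ Metric.closedBall p (s * T.diam) := by
  rintro _ ⟨x, hx, rfl⟩
  rw [AffineMap.homothety_apply, vsub_eq_sub, vadd_eq_add, Metric.mem_closedBall, dist_eq_norm,
    add_sub_cancel_right, norm_smul, Real.norm_of_nonneg hs, ← dist_eq_norm]
  gcongr
  exact dist_le ht hx (vertex_mem_tri hp)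

/-- Nodal values at sites that have a scaled copy of a triangle in a set are controlled by the
integral over the set. -/
theorem IsPL.sum_norm_sq_le_integral {g : Plane → E} (hg : T.IsPL g) (S : Finset L.sites)
    {D : Set Plane} (hD : MeasurableSet D) (hint : IntegrableOn (fun x => ‖g x‖ ^ 2) D) {s : ℝ}
    (hs0 : 0 < s) (hs1 : s ≤ 1)
    (hS : ∀ ℓ ∈ S, ∃ t ∈ triangles T.K, (ℓ : Plane) ∈ t ∧
      AffineMap.homothety (ℓ : Plane) s '' tri t ⊆ D) :
    s ^ 2 * T.area / 80 * ∑ ℓ ∈ S, ‖g ℓ‖ ^ 2 ≤ L.siteBound T.diam * ∫ x in D, ‖g x‖ ^ 2 := by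
  classical
  set B : L.sites → Set Plane := fun ℓ => D ∩ Metric.closedBall (ℓ : Plane) T.diam with hB
  have hBm : ∀ ℓ, MeasurableSet (B ℓ) := fun ℓ => hD.inter Metric.isClosed_closedBall.measurableSet
  have h1 : ∀ ℓ ∈ S, s ^ 2 * T.area / 80 * ‖g ℓ‖ ^ 2 ≤
      ∫ x in D, (Metric.closedBall (ℓ : Plane) T.diam).indicator (fun x => ‖g x‖ ^ 2) x := by
    intro ℓ hℓ
    obtain ⟨t, ht, hlt, hsub⟩ := hS ℓ hℓ
    refine (hg.norm_sq_le_integral ht hlt hs0 hs1).trans ?_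
    rw [setIntegral_indicator Metric.isClosed_closedBall.measurableSet]
    refine setIntegral_mono_set (hint.mono_set inter_subset_left)
      (ae_of_all _ fun _ => by positivity) (LE.le.eventuallyLE ?_)
    refine subset_inter hsub ((homothety_subset_ball ht hlt hs0.le).trans
      (Metric.closedBall_subset_closedBall ?_))
    have := T.diam_pos
    nlinarith
  rw [Finset.mul_sum]
  refine (Finset.sum_le_sum h1).trans ?_
  have hi : ∀ ℓ ∈ S, IntegrableOn
      ((Metric.closedBall (ℓ : Plane) T.diam).indicator (fun x => ‖g x‖ ^ 2)) D :=
    fun ℓ _ => Integrable.indicator hint Metric.isClosed_closedBall.measurableSet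
  rw [← integral_finsetSum _ hi, ← integral_const_mul]
  refine integral_mono (integrable_finsetSum _ hi) (Integrable.const_mul hint _) fun x => ?_
  simp only [indicator_apply]
  rw [← Finset.sum_filter, Finset.sum_const, nsmul_eq_mul]
  refine mul_le_mul_of_nonneg_right (Nat.cast_le.2 ?_) (by positivity)
  refine L.card_sites_le (x := x) _ fun ℓ hℓ => ?_
  have := (Finset.mem_filter.1 hℓ).2
  rwa [Metric.mem_closedBall, dist_comm] at this

/-! ### Hat functions of sites -/

theorem continuous_zeta (T : BackgroundMesh L) (ℓ : L.sites) : Continuous (T.zeta ℓ) :=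
  (T.isPL_hat ℓ).continuous

theorem zeta_nonneg (ℓ : L.sites) (x : Plane) : 0 ≤ T.zeta ℓ x := hat_nonneg _ _

theorem zeta_le_one (ℓ : L.sites) (x : Plane) : T.zeta ℓ x ≤ 1 := hat_le_one _ _

theorem exists_triangle_of_zeta_ne_zero {ℓ : L.sites} {x : Plane} (h : T.zeta ℓ x ≠ 0) :
    ∃ t ∈ triangles T.K, (ℓ : Plane) ∈ t ∧ x ∈ tri t := by
  obtain ⟨t, ht, hx⟩ := T.cover x
  refine ⟨t, ht, ?_, hx⟩
  by_contra h'
  exact h (hat_eq_zero ht.1 h' hx)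

theorem zeta_eq_zero_of_dist {ℓ : L.sites} {x : Plane} (h : T.diam < dist x ℓ) :
    T.zeta ℓ x = 0 := by
  by_contra h'
  obtain ⟨t, ht, hlt, hx⟩ := exists_triangle_of_zeta_ne_zero h'
  exact absurd (dist_le ht hx (vertex_mem_tri hlt)) (not_le.2 h)

theorem hasCompactSupport_zeta (T : BackgroundMesh L) (ℓ : L.sites) :
    HasCompactSupport (T.zeta ℓ) := by
  refine HasCompactSupport.intro (isCompact_closedBall (ℓ : Plane) T.diam) fun x hx => ?_
  exact zeta_eq_zero_of_dist (by simpa using hx)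

theorem integrable_zeta (T : BackgroundMesh L) (ℓ : L.sites) : Integrable (T.zeta ℓ) :=
  (T.continuous_zeta ℓ).integrable_of_hasCompactSupport (T.hasCompactSupport_zeta ℓ)

/-- Since `0 ≤ ζ ≤ 1`, the integral dominates that of `ζ²`, which is bounded below through the nodal
value one. The positivity lets the forces be recovered from their rescaled versions. -/
theorem le_integral_zeta (T : BackgroundMesh L) (ℓ : L.sites) :
    T.area / 80 ≤ ∫ x, T.zeta ℓ x := by
  obtain ⟨t, ht, hlt⟩ := exists_triangle (T := T) ℓ
  have h := (T.isPL_hat ℓ).norm_sq_le_integral ht hlt one_pos le_rfl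
  rw [hat_self ℓ.2] at h
  simp only [one_pow, one_mul, norm_one, mul_one] at h
  refine h.trans ?_
  have hi := T.integrable_zeta ℓ
  refine le_trans ?_ (setIntegral_le_integral hi (ae_of_all _ (zeta_nonneg ℓ))
    (s := AffineMap.homothety (ℓ : Plane) (1 : ℝ) '' tri t))
  have hm : MeasurableSet (AffineMap.homothety (ℓ : Plane) (1 : ℝ) '' tri t) :=
    ((isCompact_tri t).image
      (AffineMap.homothety (ℓ : Plane) (1 : ℝ)).continuous_of_finiteDimensional).isClosed.measurableSet
  refine integral_mono_of_nonneg (ae_of_all _ fun _ => by positivity) hi.integrableOn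
    (ae_of_all _ fun x => ?_)
  have h0 := zeta_nonneg (T := T) ℓ x
  have h1 := zeta_le_one (T := T) ℓ x
  simp only [Real.norm_eq_abs, sq_abs]
  change T.zeta ℓ x ^ 2 ≤ T.zeta ℓ x
  nlinarith

variable (T) in
/-- The area of a disc whose radius is the bound for the diameter of the triangles. -/
def ballArea : ℝ := volume.real (Metric.closedBall (0 : Plane) T.diam)

theorem ballArea_nonneg : 0 ≤ T.ballArea := measureReal_nonneg

theorem integral_zeta_le (T : BackgroundMesh L) (ℓ : L.sites) :
    ∫ x, T.zeta ℓ x ≤ T.ballArea := by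
  have h2 : volume (Metric.closedBall (ℓ : Plane) T.diam) = volume (Metric.closedBall (0 : Plane) T.diam) :=
    Measure.addHaar_closedBall_center _ _ _
  have h3 : ∫ x, (Metric.closedBall (ℓ : Plane) T.diam).indicator (fun _ => (1 : ℝ)) x = T.ballArea := by
    rw [integral_indicator Metric.isClosed_closedBall.measurableSet, setIntegral_const, smul_eq_mul,
      mul_one, measureReal_def, h2]
    rfl
  rw [← h3]
  refine integral_mono (T.integrable_zeta ℓ) ?_ fun x => ?_
  · exact (integrableOn_const measure_closedBall_lt_top.ne).integrable_indicator
      Metric.isClosed_closedBall.measurableSet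
  · by_cases h : x ∈ Metric.closedBall (ℓ : Plane) T.diam
    · rw [indicator_of_mem h]; exact zeta_le_one _ _
    · rw [indicator_of_notMem h, zeta_eq_zero_of_dist (by simpa using h)]

/-! ### Displacements with finite support -/

theorem interp_eq_sum_of_support {u : L.sites → Plane} {S : Finset L.sites}
    (hu : ∀ ℓ ∉ S, u ℓ = 0) (x : Plane) : T.interp u x = ∑ ℓ ∈ S, T.zeta ℓ x • u ℓ := by
  refine finsum_eq_sum_of_support_subset _ fun ℓ hℓ => ?_
  by_contra h
  exact hℓ (by simp [hu ℓ h])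

theorem sum_zeta_le_one (S : Finset L.sites) (x : Plane) : ∑ ℓ ∈ S, T.zeta ℓ x ≤ 1 := by
  classical
  obtain ⟨t, ht, hx⟩ := T.cover x
  rw [← sum_hat ht.1 hx]
  have : ∑ ℓ ∈ S, T.zeta ℓ x = ∑ p ∈ S.map (Function.Embedding.subtype _), hat T.K p x := by
    rw [Finset.sum_map]; rfl
  rw [this]
  rw [← Finset.sum_filter_of_ne (p := fun p => p ∈ t) fun p _ h => by
    by_contra h'
    exact h (hat_eq_zero ht.1 h' hx)]
  exact Finset.sum_le_sum_of_subset_of_nonneg (fun p hp => (Finset.mem_filter.1 hp).2)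
    fun p _ _ => hat_nonneg _ _

/-- Jensen's inequality, as the hat functions are nonnegative weights with sum at most one. -/
theorem norm_interp_sq_le {u : L.sites → Plane} {S : Finset L.sites}
    (hu : ∀ ℓ ∉ S, u ℓ = 0) (x : Plane) :
    ‖T.interp u x‖ ^ 2 ≤ ∑ ℓ ∈ S, T.zeta ℓ x * ‖u ℓ‖ ^ 2 := by
  rw [interp_eq_sum_of_support hu]
  have h1 : ‖∑ ℓ ∈ S, T.zeta ℓ x • u ℓ‖ ≤ ∑ ℓ ∈ S, T.zeta ℓ x * ‖u ℓ‖ := by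
    refine (norm_sum_le _ _).trans_eq (Finset.sum_congr rfl fun ℓ _ => ?_)
    rw [norm_smul, Real.norm_of_nonneg (zeta_nonneg _ _)]
  have h2 : (∑ ℓ ∈ S, T.zeta ℓ x * ‖u ℓ‖) ^ 2 ≤
      (∑ ℓ ∈ S, T.zeta ℓ x) * ∑ ℓ ∈ S, T.zeta ℓ x * ‖u ℓ‖ ^ 2 :=
    Finset.sum_sq_le_sum_mul_sum_of_sq_le_mul S (fun ℓ _ => zeta_nonneg _ _)
      (fun ℓ _ => mul_nonneg (zeta_nonneg _ _) (by positivity)) fun ℓ _ => by apply le_of_eq; ring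
  have h3 : 0 ≤ ∑ ℓ ∈ S, T.zeta ℓ x * ‖u ℓ‖ ^ 2 :=
    Finset.sum_nonneg fun ℓ _ => mul_nonneg (zeta_nonneg _ _) (by positivity)
  calc _ ≤ (∑ ℓ ∈ S, T.zeta ℓ x * ‖u ℓ‖) ^ 2 := by gcongr
    _ ≤ _ := h2
    _ ≤ 1 * ∑ ℓ ∈ S, T.zeta ℓ x * ‖u ℓ‖ ^ 2 := by gcongr; exact sum_zeta_le_one S x
    _ = _ := one_mul _

theorem hasCompactSupport_interp {u : L.sites → Plane} {S : Finset L.sites}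
    (hu : ∀ ℓ ∉ S, u ℓ = 0) : HasCompactSupport (T.interp u) := by
  refine HasCompactSupport.intro (K := ⋃ ℓ ∈ S, Metric.closedBall (ℓ : Plane) T.diam)
    (S.isCompact_biUnion fun ℓ _ => isCompact_closedBall _ _) fun x hx => ?_
  rw [interp_eq_sum_of_support hu]
  refine Finset.sum_eq_zero fun ℓ hℓ => ?_
  simp only [mem_iUnion, not_exists] at hx
  rw [zeta_eq_zero_of_dist (by simpa using hx ℓ hℓ), zero_smul]

theorem continuous_interp (T : BackgroundMesh L) (u : L.sites → Plane) : Continuous (T.interp u) :=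
  (T.isPL_interp u).continuous

theorem integrable_norm_interp_sq {u : L.sites → Plane} {S : Finset L.sites}
    (hu : ∀ ℓ ∉ S, u ℓ = 0) : Integrable fun x => ‖T.interp u x‖ ^ 2 := by
  have h1 : Continuous fun x => ‖T.interp u x‖ ^ 2 := (T.continuous_interp u).norm.pow 2
  have h2 : HasCompactSupport fun x => ‖T.interp u x‖ ^ 2 :=
    (hasCompactSupport_interp hu).comp_left (g := fun a : Plane => ‖a‖ ^ 2) (by simp)
  exact h1.integrable_of_hasCompactSupport h2

/-- With `sum_norm_sq_le_integral_interp` this says that the mass matrix is uniformly comparable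
with the identity. -/
theorem integral_norm_interp_sq_le {u : L.sites → Plane} {S : Finset L.sites}
    (hu : ∀ ℓ ∉ S, u ℓ = 0) :
    ∫ x, ‖T.interp u x‖ ^ 2 ≤ T.ballArea * ∑ ℓ ∈ S, ‖u ℓ‖ ^ 2 := by
  have hi : ∀ ℓ ∈ S, Integrable fun x => T.zeta ℓ x * ‖u ℓ‖ ^ 2 :=
    fun ℓ _ => (T.integrable_zeta ℓ).mul_const _
  refine (integral_mono (integrable_norm_interp_sq hu) (integrable_finsetSum _ hi)
    (norm_interp_sq_le hu)).trans ?_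
  rw [integral_finsetSum _ hi, Finset.mul_sum]
  refine Finset.sum_le_sum fun ℓ _ => ?_
  rw [integral_mul_const]
  gcongr
  exact T.integral_zeta_le ℓ

theorem sum_norm_sq_le_integral_interp {u : L.sites → Plane} {S : Finset L.sites}
    (hu : ∀ ℓ ∉ S, u ℓ = 0) :
    T.area / 80 * ∑ ℓ ∈ S, ‖u ℓ‖ ^ 2 ≤ L.siteBound T.diam * ∫ x, ‖T.interp u x‖ ^ 2 := by
  have := (T.isPL_interp u).sum_norm_sq_le_integral S MeasurableSet.univ
    (integrable_norm_interp_sq hu).integrableOn one_pos le_rfl fun ℓ _ => by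
      obtain ⟨t, ht, hlt⟩ := exists_triangle (T := T) ℓ
      exact ⟨t, ht, hlt, subset_univ _⟩
  simpa [interp_site] using this

/-- The triangles that contain one of finitely many sites. -/
def star (T : BackgroundMesh L) (S : Finset L.sites) : Finset (Finset Plane) :=
  open Classical in S.biUnion fun ℓ => T.near ℓ 0

theorem mem_star {S : Finset L.sites} {t : Finset Plane} :
    t ∈ T.star S ↔ t ∈ triangles T.K ∧ ∃ ℓ ∈ S, (ℓ : Plane) ∈ t := by
  classical
  simp only [star, Finset.mem_biUnion, mem_near, Metric.closedBall_zero]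
  constructor
  · rintro ⟨ℓ, hℓ, ht, x, hx, rfl⟩
    exact ⟨ht, ℓ, hℓ, mem_of_mem_tri ht.1 ℓ.2 hx⟩
  · rintro ⟨ht, ℓ, hℓ, h⟩
    exact ⟨ℓ, hℓ, ht, ℓ, vertex_mem_tri h, rfl⟩

theorem osc_eq_zero_of_notMem_star {u : L.sites → Plane} {S : Finset L.sites}
    (hu : ∀ ℓ ∉ S, u ℓ = 0) {t : Finset Plane} (ht : t ∈ triangles T.K) (h : t ∉ T.star S) :
    osc t (T.interp u) = 0 := by
  have h0 : ∀ p ∈ t, T.interp u p = 0 := by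
    intro p hp
    have := interp_site (T := T) u ⟨p, vertex_mem_sites ht.1 hp⟩
    rw [this]
    exact hu _ fun hS => h (mem_star.2 ⟨ht, _, hS, hp⟩)
  refine Finset.sum_eq_zero fun p hp => Finset.sum_eq_zero fun q hq => ?_
  rw [h0 p hp, h0 q hq]
  simp

theorem isU12_of_support {u : L.sites → Plane} {S : Finset L.sites} (hu : ∀ ℓ ∉ S, u ℓ = 0) :
    T.IsU12 u :=
  (isU12_and_normU12_sq_le (T.star S) (fun _ ht => (mem_star.1 ht).1)
    fun _ ht h => osc_eq_zero_of_notMem_star hu ht h).1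

theorem normU12_sq_le_of_support {u : L.sites → Plane} {S : Finset L.sites}
    (hu : ∀ ℓ ∉ S, u ℓ = 0) :
    T.normU12 u ^ 2 ≤ T.normConst * ∑ t ∈ T.star S, osc t (T.interp u) :=
  (isU12_and_normU12_sq_le (T.star S) (fun _ ht => (mem_star.1 ht).1)
    fun _ ht h => osc_eq_zero_of_notMem_star hu ht h).2

/-- Summation of nodal quantities over triangles. -/
theorem sum_triangles_le (F : Finset (Finset Plane)) (hF : ∀ t ∈ F, t ∈ triangles T.K)
    (S : Finset L.sites) {a : Plane → ℝ} (ha : ∀ p, 0 ≤ a p)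
    (hS : ∀ p : L.sites, p ∉ S → a p = 0) :
    ∑ t ∈ F, ∑ p ∈ t, a p ≤ T.nearBound 0 * ∑ ℓ ∈ S, a ℓ := by
  classical
  have h1 : ∀ t ∈ F, ∑ p ∈ t, a p = ∑ ℓ ∈ S, if (ℓ : Plane) ∈ t then a ℓ else 0 := by
    intro t ht
    have : ∑ ℓ ∈ S, (if (ℓ : Plane) ∈ t then a ℓ else 0) =
        ∑ p ∈ S.map (Function.Embedding.subtype _), if p ∈ t then a p else 0 := by
      rw [Finset.sum_map]; rfl
    rw [this, ← Finset.sum_filter, Finset.filter_mem_eq_inter]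
    refine (Finset.sum_subset Finset.inter_subset_right fun p hp h => ?_).symm
    have hps := vertex_mem_sites (hF t ht).1 hp
    refine hS ⟨p, hps⟩ fun hpS => h (Finset.mem_inter.2 ⟨?_, hp⟩)
    exact Finset.mem_map.2 ⟨⟨p, hps⟩, hpS, rfl⟩
  rw [Finset.sum_congr rfl h1, Finset.sum_comm, Finset.mul_sum]
  refine Finset.sum_le_sum fun ℓ _ => ?_
  rw [← Finset.sum_filter, Finset.sum_const, nsmul_eq_mul]
  refine mul_le_mul_of_nonneg_right (Nat.cast_le.2 ?_) (ha _)
  refine card_le_nearBound _ (ℓ : Plane) 0 fun t ht => ?_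
  obtain ⟨h, h'⟩ := Finset.mem_filter.1 ht
  exact mem_near_of_mem (hF t h) (vertex_mem_tri h') (by simp)

/-- The inverse inequality on a mesh of fixed size: nodal differences are bounded by nodal values,
and each site belongs to boundedly many triangles. It allows testing the residual with the forces
themselves. -/
theorem normU12_sq_le_sum {u : L.sites → Plane} {S : Finset L.sites} (hu : ∀ ℓ ∉ S, u ℓ = 0) :
    T.normU12 u ^ 2 ≤ T.normConst * (12 * T.nearBound 0) * ∑ ℓ ∈ S, ‖u ℓ‖ ^ 2 := by
  refine (normU12_sq_le_of_support hu).trans ?_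
  rw [mul_assoc]
  refine mul_le_mul_of_nonneg_left ?_ T.normConst_nonneg
  have hF : ∀ t ∈ T.star S, t ∈ triangles T.K := fun _ ht => (mem_star.1 ht).1
  have h1 : ∀ t ∈ T.star S, osc t (T.interp u) ≤ 12 * ∑ p ∈ t, ‖T.interp u p‖ ^ 2 := by
    intro t ht
    have h2 : ∀ p ∈ t, ∀ q ∈ t, ‖T.interp u p - T.interp u q‖ ^ 2 ≤
        2 * (‖T.interp u p‖ ^ 2 + ‖T.interp u q‖ ^ 2) := fun p _ q _ => by
      simpa using norm_sub_sq_le_two (T.interp u p) 0 (T.interp u q)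
    refine (Finset.sum_le_sum fun p hp => Finset.sum_le_sum fun q hq => h2 p hp q hq).trans ?_
    simp only [← Finset.mul_sum, Finset.sum_add_distrib, Finset.sum_const, (hF t ht).2, nsmul_eq_mul]
    push_cast
    linarith
  refine (Finset.sum_le_sum h1).trans ?_
  rw [← Finset.mul_sum, mul_assoc]
  refine mul_le_mul_of_nonneg_left ?_ (by norm_num)
  have := sum_triangles_le (T.star S) hF S (a := fun p => ‖T.interp u p‖ ^ 2)
    (fun _ => by positivity) fun ℓ hℓ => by simp only [interp_site, hu ℓ hℓ]; simp
  simpa only [interp_site] using this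

end BackgroundMesh

end

noncomputable section

namespace BackgroundMesh

variable {L : DefectLattice} {T : BackgroundMesh L}

/-! ### The Dirichlet form -/

theorem abs_frob_le (F G : Plane →L[ℝ] Plane) : |frob F G| ≤ frob F F + frob G G := by
  rw [frob_self, frob_self, frob, Fin.sum_univ_two, Fin.sum_univ_two, Fin.sum_univ_two]
  have h : ∀ a b : Plane, |inner ℝ a b| ≤ ‖a‖ ^ 2 + ‖b‖ ^ 2 := fun a b => by
    refine (abs_real_inner_le_norm a b).trans ?_
    nlinarith [sq_nonneg (‖a‖ - ‖b‖), sq_nonneg ‖a‖, sq_nonneg ‖b‖]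
  refine (abs_add_le _ _).trans ?_
  have h0 := h (F (EuclideanSpace.single 0 1)) (G (EuclideanSpace.single 0 1))
  have h1 := h (F (EuclideanSpace.single 1 1)) (G (EuclideanSpace.single 1 1))
  linarith

theorem integrable_frob {u v : L.sites → Plane} (hu : T.IsU12 u) (hv : T.IsU12 v) :
    Integrable fun x => frob (fderiv ℝ (T.interp u) x) (fderiv ℝ (T.interp v) x) := by
  refine Integrable.mono' (Integrable.add hu hv) (measurable_frob_fderiv _ _).aestronglyMeasurable
    (ae_of_all _ fun x => ?_)
  exact abs_frob_le _ _

theorem dirichlet_add_right {u v w : L.sites → Plane} (hu : T.IsU12 u) (hv : T.IsU12 v)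
    (hw : T.IsU12 w) (S : Set Plane) : dirichlet S (T.interp u) (T.interp (v + w)) =
      dirichlet S (T.interp u) (T.interp v) + dirichlet S (T.interp u) (T.interp w) := by
  rw [dirichlet, dirichlet, dirichlet, ← integral_add (integrable_frob hu hv).integrableOn
    (integrable_frob hu hw).integrableOn]
  refine integral_congr_ae (ae_restrict_of_ae ?_)
  filter_upwards [ae_differentiableAt (T.isPL_interp v), ae_differentiableAt (T.isPL_interp w)]
    with x h1 h2
  rw [interp_add, fderiv_add h1 h2]
  simp only [frob, _root_.add_apply, inner_add_right, Finset.sum_add_distrib]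

theorem dirichlet_smul_right (u v : L.sites → Plane) (c : ℝ) (S : Set Plane) :
    dirichlet S (T.interp u) (T.interp (c • v)) = c * dirichlet S (T.interp u) (T.interp v) := by
  rw [dirichlet, dirichlet, ← integral_const_mul]
  refine integral_congr_ae (ae_of_all _ fun x => ?_)
  simp only [interp_smul, fderiv_const_smul_field, frob, Finset.mul_sum]
  refine Finset.sum_congr rfl fun i _ => ?_
  simp [inner_smul_right]

theorem dirichlet_comm (S : Set Plane) (f g : Plane → Plane) : dirichlet S f g = dirichlet S g f := by
  simp only [dirichlet, frob, real_inner_comm]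

theorem dirichlet_self_nonneg (S : Set Plane) (f : Plane → Plane) : 0 ≤ dirichlet S f f :=
  integral_nonneg fun _ => frob_self_nonneg _

/-- Cauchy–Schwarz for a semidefinite form: the quadratic polynomial `s ↦ ‖∇(u + s v)‖²` is
nonnegative, so its discriminant is not positive. -/
theorem abs_dirichlet_le {u v : L.sites → Plane} (hu : T.IsU12 u) (hv : T.IsU12 v) (S : Set Plane) :
    |dirichlet S (T.interp u) (T.interp v)| ≤
      gradNorm S (T.interp u) * gradNorm S (T.interp v) := by
  rw [gradNorm, gradNorm, ← Real.sqrt_mul (dirichlet_self_nonneg _ _)]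
  refine Real.abs_le_sqrt ?_
  have h : ∀ s : ℝ, 0 ≤ dirichlet S (T.interp v) (T.interp v) * (s * s) +
      2 * dirichlet S (T.interp u) (T.interp v) * s + dirichlet S (T.interp u) (T.interp u) := by
    intro s
    have h1 := dirichlet_self_nonneg S (T.interp (u + s • v))
    rw [dirichlet_add_right (hu.add (hv.smul s)) hu (hv.smul s), dirichlet_smul_right,
      dirichlet_comm S _ (T.interp u), dirichlet_comm S _ (T.interp v),
      dirichlet_add_right hu hu (hv.smul s), dirichlet_add_right hv hu (hv.smul s),
      dirichlet_smul_right, dirichlet_smul_right, dirichlet_comm S (T.interp v) (T.interp u)] at h1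
    linarith
  have := discrim_le_zero h
  rw [discrim] at this
  linarith

end BackgroundMesh

/-! ### The computational domain and the discrete Poisson problem -/

namespace CompDomain

open BackgroundMesh

variable {L : DefectLattice} {T : BackgroundMesh L} (Ω : CompDomain T)

theorem isCompact_carrier : IsCompact Ω.carrier :=
  Ω.elements.isCompact_biUnion fun t _ => isCompact_tri t

theorem measurableSet_carrier : MeasurableSet Ω.carrier :=
  Ω.isCompact_carrier.isClosed.measurableSet

theorem measurableSet_outer : MeasurableSet Ω.outer :=
  Ω.measurableSet_carrier.diff Metric.isClosed_closedBall.measurableSet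

theorem norm_le_of_mem {x : Plane} (hx : x ∈ Ω.carrier) : ‖x‖ ≤ 2 * Ω.R := by
  simpa using Ω.subset_ball hx

/-- The sites in the domain. -/
def sites : Finset L.sites :=
  ((L.inter_ball_finite 0 (2 * Ω.R)).preimage Subtype.val_injective.injOn
    |>.subset (fun ℓ (hℓ : ℓ ∈ {ℓ : L.sites | (ℓ : Plane) ∈ Ω.carrier}) =>
      ⟨ℓ.2, Ω.subset_ball hℓ⟩)).toFinset

theorem mem_sites {ℓ : L.sites} : ℓ ∈ Ω.sites ↔ (ℓ : Plane) ∈ Ω.carrier := by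
  simp [sites]

/-- A lower bound for the radii of computational domains. -/
def minRadius (T : BackgroundMesh L) : ℝ := √(T.area / discArea)

theorem minRadius_pos (T : BackgroundMesh L) : 0 < minRadius T :=
  Real.sqrt_pos.2 (div_pos T.area_pos discArea_pos)

/-- The triangle of `Ω` that contains the origin has area at least `area` and lies in the disc of
radius `2R`. The lower bound lets additive constants be absorbed into multiples of `R`. -/
theorem minRadius_le : minRadius T ≤ Ω.R := by
  have h0 : (0 : Plane) ∈ ⋃ t ∈ Ω.elements, tri t := Ω.ball_subset (by simp [Ω.R_pos.le])
  simp only [mem_iUnion] at h0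
  obtain ⟨t, ht, -⟩ := h0
  have h1 : tri t ⊆ Metric.closedBall 0 (Ω.R * 2) := by
    rw [mul_comm]
    exact (subset_biUnion_of_mem (u := tri) ht).trans Ω.subset_ball
  have h2 := (area_le (Ω.elements_mem t ht)).trans
    (measureReal_mono h1 measure_closedBall_lt_top.ne)
  rw [measureReal_def, Measure.addHaar_closedBall_mul volume _ Ω.R_pos.le zero_le_two, ENNReal.toReal_mul,
    ENNReal.toReal_ofReal (by have := Ω.R_pos; positivity), finrank_euclideanSpace_fin,
    ← measureReal_def] at h2
  refine Real.sqrt_le_iff.2 ⟨Ω.R_pos.le, ?_⟩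
  rw [div_le_iff₀ discArea_pos]
  exact h2

/-- A triangle of the background mesh that has a vertex in the open ball of radius `R` belongs to
the computational domain. -/
theorem mem_elements {t : Finset Plane} (ht : t ∈ triangles T.K) {ℓ : Plane} (hlt : ℓ ∈ t)
    (hℓ : ‖ℓ‖ < Ω.R) : t ∈ Ω.elements := by
  classical
  set b : Plane := ∑ p ∈ t, (1 / 3 : ℝ) • p with hb
  -- Moving slightly from `ℓ` towards the centroid stays in the ball, hence in some triangle of `Ω`,
  -- but makes all barycentric coordinates positive. That triangle must then be `t`.
  have hev : ∀ᶠ s : ℝ in 𝓝[>] 0, s < 1 ∧ ‖ℓ + s • (b - ℓ)‖ < Ω.R := by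
    refine Filter.Eventually.filter_mono nhdsWithin_le_nhds ((eventually_lt_nhds one_pos).and ?_)
    have hc : Continuous fun s : ℝ => ‖ℓ + s • (b - ℓ)‖ := by fun_prop
    exact hc.continuousAt.eventually_lt continuousAt_const (by simpa using hℓ)
  obtain ⟨s, ⟨hs1, hs⟩, hs0⟩ := (hev.and self_mem_nhdsWithin).exists
  have hs0' : 0 < s := hs0
  have hx : ℓ + s • (b - ℓ) ∈ ⋃ t ∈ Ω.elements, tri t := Ω.ball_subset (by simpa using hs.le)
  simp only [mem_iUnion] at hx
  obtain ⟨t', ht', hxt'⟩ := hx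
  have hcard := ht.2
  set μ : Plane → ℝ := fun p => s / 3 + if p = ℓ then 1 - s else 0 with hμ
  have hsum : ∑ p ∈ t, μ p • p = ℓ + s • (b - ℓ) := by
    simp only [hμ, add_smul, Finset.sum_add_distrib, ite_smul, zero_smul, Finset.sum_ite_eq', hlt,
      if_true, hb]
    rw [smul_sub, Finset.smul_sum]
    simp only [smul_smul]
    have : ∀ p : Plane, (s * (1 / 3)) • p = (s / 3) • p := fun p => by ring_nf
    simp only [this]
    module
  have heq := eq_of_pos_combination ht (Ω.elements_mem t' ht') (μ := μ)
    (fun p _ => by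
      simp only [hμ]
      split_ifs
      · linarith
      · linarith)
    (by
      simp only [hμ, Finset.sum_add_distrib, Finset.sum_const, hcard, Finset.sum_ite_eq', hlt,
        if_true, nsmul_eq_mul]
      push_cast
      ring)
    (by rw [hsum]; exact hxt')
  rwa [heq]

/-- All triangles at a site of the open ball belong to `Ω`, and the set where its hat function is
nonzero is open, so it lies in the interior. -/
theorem mem_feSpace {v : L.sites → Plane} (hv : ∀ ℓ : L.sites, Ω.R ≤ ‖(ℓ : Plane)‖ → v ℓ = 0) :
    v ∈ Ω.feSpace := by
  intro x hx
  by_contra h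
  have : ∃ ℓ : L.sites, T.zeta ℓ x • v ℓ ≠ 0 := by
    by_contra! h'
    exact h (by rw [interp, finsum_congr h', finsum_zero])
  obtain ⟨ℓ, hℓ⟩ := this
  have hz : T.zeta ℓ x ≠ 0 := fun h => hℓ (by rw [h, zero_smul])
  have hvl : v ℓ ≠ 0 := fun h => hℓ (by rw [h, smul_zero])
  have hR : ‖(ℓ : Plane)‖ < Ω.R := by
    by_contra h'
    exact hvl (hv ℓ (not_lt.1 h'))
  refine hx (mem_interior.2 ⟨{y | T.zeta ℓ y ≠ 0}, fun y hy => ?_, ?_, hz⟩)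
  · obtain ⟨t, ht, hlt, hyt⟩ := exists_triangle_of_zeta_ne_zero hy
    exact mem_biUnion (Ω.mem_elements ht hlt hR) hyt
  · exact isOpen_ne_fun (T.continuous_zeta ℓ) continuous_const

variable {Ω}

theorem eq_zero_of_mem_feSpace {v : L.sites → Plane} (hv : v ∈ Ω.feSpace) :
    ∀ ℓ ∉ Ω.sites, v ℓ = 0 := by
  intro ℓ hℓ
  have := hv ℓ fun h => hℓ (Ω.mem_sites.2 (interior_subset h))
  rwa [interp_site] at this

theorem isU12_of_mem_feSpace {v : L.sites → Plane} (hv : v ∈ Ω.feSpace) : T.IsU12 v :=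
  isU12_of_support (eq_zero_of_mem_feSpace hv)

theorem gradNorm_carrier_eq {v : L.sites → Plane} (hv : v ∈ Ω.feSpace) :
    gradNorm Ω.carrier (T.interp v) = T.normU12 v := by
  rw [normU12, gradNorm, gradNorm, dirichlet, dirichlet, setIntegral_univ]
  congr 1
  refine setIntegral_eq_integral_of_forall_compl_eq_zero fun x hx => ?_
  have h : T.interp v =ᶠ[𝓝 x] fun _ => 0 := by
    filter_upwards [Ω.isCompact_carrier.isClosed.isOpen_compl.mem_nhds hx] with y hy
    exact hv y fun h => hy (interior_subset h)
  rw [h.fderiv_eq]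
  simp [frob]

/-- Without oscillation the interpolant is constant, and it vanishes at a point beyond radius `2R`.
This is the definiteness of the Dirichlet form. -/
theorem eq_zero_of_normU12_eq_zero {v : L.sites → Plane} (hv : v ∈ Ω.feSpace)
    (h : T.normU12 v = 0) : v = 0 := by
  have hosc : ∀ t ∈ triangles T.K, osc t (T.interp v) = 0 := by
    intro t ht
    have := sum_osc_le (isU12_of_mem_feSpace hv) {t} (by simpa using ht)
    rw [h, Finset.sum_singleton] at this
    exact le_antisymm (by simpa using this) (osc_nonneg _ _)
  have hconst : ∀ x y : Plane, T.interp v x = T.interp v y := by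
    intro x y
    have := (T.isPL_interp v).norm_sub_le_of_dist_le (le_refl (dist x y))
    rw [Finset.sum_eq_zero fun t ht => hosc t (mem_near.1 ht).1, mul_zero] at this
    have h2 : ‖T.interp v x - T.interp v y‖ = 0 := by
      have := norm_nonneg (T.interp v x - T.interp v y)
      nlinarith
    exact sub_eq_zero.1 (norm_eq_zero.1 h2)
  obtain ⟨y, hy⟩ : ∃ y : Plane, y ∉ interior Ω.carrier := by
    refine ⟨EuclideanSpace.single 0 (2 * Ω.R + 1), fun h => ?_⟩
    have := Ω.norm_le_of_mem (interior_subset h)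
    rw [PiLp.norm_single, Real.norm_eq_abs] at this
    linarith [le_abs_self (2 * Ω.R + 1)]
  funext ℓ
  rw [← interp_site (T := T) v ℓ, hconst ℓ y, hv y hy]
  rfl

variable (Ω)

/-- The finite element space as a subspace. -/
def feSubmodule : Submodule ℝ (L.sites → Plane) where
  carrier := Ω.feSpace
  add_mem' := by
    intro u v hu hv x hx
    rw [interp_add, Pi.add_apply, hu x hx, hv x hx, add_zero]
  zero_mem' := by
    intro x _
    simp [interp]
  smul_mem' := by
    intro c u hu x hx
    rw [interp_smul, Pi.smul_apply, hu x hx, smul_zero]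

instance : FiniteDimensional ℝ Ω.feSubmodule := by
  let ρ : Ω.feSubmodule →ₗ[ℝ] (Ω.sites → Plane) :=
    { toFun := fun v ℓ => v.1 ℓ
      map_add' := fun _ _ => rfl
      map_smul' := fun _ _ => rfl }
  refine FiniteDimensional.of_injective ρ ((injective_iff_map_eq_zero ρ).2 fun v hv => ?_)
  refine Subtype.ext (funext fun ℓ => ?_)
  by_cases h : ℓ ∈ Ω.sites
  · exact congrFun hv ⟨ℓ, h⟩
  · exact eq_zero_of_mem_feSpace v.2 ℓ h

theorem integrableOn_inner_interp {g : Plane → Plane} (hg : Continuous g) (v : L.sites → Plane) :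
    IntegrableOn (fun x => inner ℝ (g x) (T.interp v x)) Ω.carrier :=
  (hg.inner (T.continuous_interp v)).continuousOn.integrableOn_compact Ω.isCompact_carrier

/-- The Dirichlet form on the finite element space. -/
def dirichletForm : Ω.feSubmodule →ₗ[ℝ] Module.Dual ℝ Ω.feSubmodule where
  toFun φ :=
    { toFun := fun v => dirichlet Ω.carrier (T.interp φ.1) (T.interp v.1)
      map_add' := fun a b => dirichlet_add_right (isU12_of_mem_feSpace φ.2)
        (isU12_of_mem_feSpace a.2) (isU12_of_mem_feSpace b.2) _
      map_smul' := fun c a => dirichlet_smul_right φ.1 a.1 c _ }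
  map_add' a b := by
    refine LinearMap.ext fun v => ?_
    change dirichlet Ω.carrier (T.interp (a.1 + b.1)) (T.interp v.1) =
      dirichlet Ω.carrier (T.interp a.1) (T.interp v.1) +
        dirichlet Ω.carrier (T.interp b.1) (T.interp v.1)
    rw [dirichlet_comm, dirichlet_add_right (isU12_of_mem_feSpace v.2)
      (isU12_of_mem_feSpace a.2) (isU12_of_mem_feSpace b.2), dirichlet_comm,
      dirichlet_comm _ (T.interp v.1)]
  map_smul' c a := by
    refine LinearMap.ext fun v => ?_
    change dirichlet Ω.carrier (T.interp (c • a.1)) (T.interp v.1) =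
      c * dirichlet Ω.carrier (T.interp a.1) (T.interp v.1)
    rw [dirichlet_comm, dirichlet_smul_right, dirichlet_comm]

/-- The `L²` product with a continuous function as a linear form on the finite element space. -/
def loadForm {F : Plane → Plane} (hF : Continuous F) : Module.Dual ℝ Ω.feSubmodule where
  toFun v := ∫ x in Ω.carrier, inner ℝ (F x) (T.interp v.1 x)
  map_add' v w := by
    rw [← integral_add (Ω.integrableOn_inner_interp hF v.1) (Ω.integrableOn_inner_interp hF w.1)]
    simp only [Submodule.coe_add, interp_add, Pi.add_apply, inner_add_right]
  map_smul' c v := by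
    rw [RingHom.id_apply, smul_eq_mul, ← integral_const_mul]
    simp only [Submodule.coe_smul, interp_smul, Pi.smul_apply, inner_smul_right]

theorem dirichletForm_injective : Function.Injective Ω.dirichletForm := by
  refine (injective_iff_map_eq_zero Ω.dirichletForm).2 fun v hv => ?_
  have h1 : dirichlet Ω.carrier (T.interp v.1) (T.interp v.1) = 0 := DFunLike.congr_fun hv v
  have h2 : gradNorm Ω.carrier (T.interp v.1) = 0 := by rw [gradNorm, h1, Real.sqrt_zero]
  rw [gradNorm_carrier_eq v.2] at h2
  exact Subtype.ext (eq_zero_of_normU12_eq_zero v.2 h2)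

/-- In finite dimension definiteness gives solvability, so `phi` never takes its default value. -/
theorem dirichletForm_surjective : Function.Surjective Ω.dirichletForm :=
  (LinearMap.injective_iff_surjective_of_finrank_eq_finrank
    Subspace.dual_finrank_eq.symm).1 Ω.dirichletForm_injective

/-- The discrete Poisson problem has a solution. -/
theorem exists_isPoissonSolution (P : SitePotential L) (u : L.sites → Plane) :
    ∃ φ, Ω.IsPoissonSolution P u φ := by
  have hF : Continuous (forceInterp T P u) := T.continuous_interp _
  obtain ⟨φ, hφ⟩ := Ω.dirichletForm_surjective (Ω.loadForm hF)
  refine ⟨φ.1, φ.2, fun v hv => ?_⟩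
  have h : Ω.dirichletForm φ ⟨v, hv⟩ = Ω.loadForm hF ⟨v, hv⟩ := by rw [hφ]
  exact h

/-- The error estimator is the dual norm of the residual forces on the finite element space. -/
theorem abs_integral_force_le (P : SitePotential L) (u : L.sites → Plane) {v : L.sites → Plane}
    (hv : v ∈ Ω.feSpace) :
    |∫ x in Ω.carrier, inner ℝ (forceInterp T P u x) (T.interp v x)| ≤
      Ω.eta P u * T.normU12 v := by
  have h := Ω.exists_isPoissonSolution P u
  rw [eta, phi, dif_pos h, ← h.choose_spec.2 v hv, ← gradNorm_carrier_eq hv]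
  exact abs_dirichlet_le (isU12_of_mem_feSpace h.choose_spec.1) (isU12_of_mem_feSpace hv) _

theorem eta_nonneg (P : SitePotential L) (u : L.sites → Plane) : 0 ≤ Ω.eta P u :=
  Real.sqrt_nonneg _

theorem rhoTr_nonneg (P : SitePotential L) (u : L.sites → Plane) : 0 ≤ Ω.rhoTr P u :=
  add_nonneg (mul_nonneg Ω.R_pos.le (Real.sqrt_nonneg _)) (Real.sqrt_nonneg _)

end CompDomain

end

noncomputable section

open BackgroundMesh

variable {L : DefectLattice} {T : BackgroundMesh L}

/-! ### The residual estimate -/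

theorem sum_mul_le_sqrt_mul_sqrt {ι : Type*} (S : Finset ι) (a b : ι → ℝ) :
    ∑ i ∈ S, a i * b i ≤ √(∑ i ∈ S, a i ^ 2) * √(∑ i ∈ S, b i ^ 2) :=
  Real.sum_mul_le_sqrt_mul_sqrt S a b

theorem integrable_inner_interp {f u : L.sites → Plane} {S : Finset L.sites}
    (hu : ∀ ℓ ∉ S, u ℓ = 0) : Integrable fun x => inner ℝ (T.interp f x) (T.interp u x) := by
  have h1 : Continuous fun x => inner ℝ (T.interp f x) (T.interp u x) :=
    (T.continuous_interp f).inner (T.continuous_interp u)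
  refine h1.integrable_of_hasCompactSupport ?_
  refine (hasCompactSupport_interp (T := T) hu).mono (f := T.interp u) fun x hx h => hx ?_
  change T.interp u x = 0 at h
  change inner ℝ (T.interp f x) (T.interp u x) = 0
  rw [h, inner_zero_right]

namespace BackgroundMesh

/-- The error of mass lumping. -/
theorem abs_lumping_sub_le (T : BackgroundMesh L) : ∃ C : ℝ, 0 ≤ C ∧
    ∀ (f u : L.sites → Plane) (S S' : Finset L.sites), (∀ ℓ ∉ S, f ℓ = 0) → (∀ ℓ ∉ S', u ℓ = 0) →
      |∑ ℓ ∈ S, (∫ x, T.zeta ℓ x) * inner ℝ (f ℓ) (u ℓ) -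
        ∫ x, inner ℝ (T.interp f x) (T.interp u x)| ≤
      C * √(∑ ℓ ∈ S, ‖f ℓ‖ ^ 2) * T.normU12 u := by
  set N := L.siteBound (T.diam + T.diam)
  have hd := T.diam_pos
  have hlip := T.lip_pos
  refine ⟨T.ballArea * (T.lip * T.diam) * √(N * T.oscConst), ?_, fun f u S S' hf hu => ?_⟩
  · have := T.ballArea_nonneg
    positivity
  have hU := isU12_of_support (T := T) hu
  set e : L.sites → ℝ := fun ℓ => ∑ t ∈ T.near ℓ T.diam, osc t (T.interp u) with he
  have he0 : ∀ ℓ, 0 ≤ e ℓ := fun ℓ => Finset.sum_nonneg fun t _ => osc_nonneg _ _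
  have hi1 : ∀ ℓ, Integrable fun x => T.zeta ℓ x * inner ℝ (f ℓ) (u ℓ) :=
    fun ℓ => (T.integrable_zeta ℓ).mul_const _
  have hi2 : ∀ ℓ, Integrable fun x => T.zeta ℓ x * inner ℝ (f ℓ) (T.interp u x) := by
    intro ℓ
    have h1 : Continuous fun x => T.zeta ℓ x * inner ℝ (f ℓ) (T.interp u x) :=
      (T.continuous_zeta ℓ).mul (continuous_const.inner (T.continuous_interp u))
    exact h1.integrable_of_hasCompactSupport ((T.hasCompactSupport_zeta ℓ).mul_right)
  -- Both terms carry the weights `ζ_ℓ`, so the error only sees `u ℓ - u(x)` on the support of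
  -- `ζ_ℓ`, which is bounded by the oscillations of `u` near `ℓ`.
  have h1 : ∑ ℓ ∈ S, (∫ x, T.zeta ℓ x) * inner ℝ (f ℓ) (u ℓ) -
      ∫ x, inner ℝ (T.interp f x) (T.interp u x) =
      ∑ ℓ ∈ S, ∫ x, T.zeta ℓ x * inner ℝ (f ℓ) (u ℓ - T.interp u x) := by
    have h2 : ∀ x, inner ℝ (T.interp f x) (T.interp u x) =
        ∑ ℓ ∈ S, T.zeta ℓ x * inner ℝ (f ℓ) (T.interp u x) := by
      intro x
      rw [interp_eq_sum_of_support hf, sum_inner]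
      exact Finset.sum_congr rfl fun ℓ _ => real_inner_smul_left _ _ _
    simp only [h2]
    rw [integral_finsetSum _ fun ℓ _ => hi2 ℓ, ← Finset.sum_sub_distrib]
    refine Finset.sum_congr rfl fun ℓ _ => ?_
    rw [← integral_mul_const, ← integral_sub (hi1 ℓ) (hi2 ℓ)]
    refine integral_congr_ae (ae_of_all _ fun x => ?_)
    simp only [inner_sub_right, mul_sub]
  have h3 : ∀ ℓ ∈ S, |∫ x, T.zeta ℓ x * inner ℝ (f ℓ) (u ℓ - T.interp u x)| ≤
      T.ballArea * (T.lip * T.diam) * (‖f ℓ‖ * √(e ℓ)) := by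
    intro ℓ _
    have h4 : ∀ x, ‖T.zeta ℓ x * inner ℝ (f ℓ) (u ℓ - T.interp u x)‖ ≤
        T.zeta ℓ x * (‖f ℓ‖ * (T.lip * T.diam * √(e ℓ))) := by
      intro x
      rw [norm_mul, Real.norm_of_nonneg (zeta_nonneg _ _)]
      by_cases hx : T.diam < dist x ℓ
      · rw [zeta_eq_zero_of_dist hx, zero_mul, zero_mul]
      · refine mul_le_mul_of_nonneg_left ?_ (zeta_nonneg _ _)
        refine (norm_inner_le_norm _ _).trans ?_
        gcongr
        have h5 := (T.isPL_interp u).norm_sub_le_of_dist_le (x := (ℓ : Plane)) (y := x)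
          (r := T.diam) (by rw [dist_comm]; exact not_lt.1 hx)
        rw [interp_site] at h5
        refine (sq_le_sq₀ (norm_nonneg _) (by positivity)).1 (h5.trans_eq ?_)
        rw [mul_pow, mul_pow, Real.sq_sqrt (he0 ℓ)]
    have h6 := norm_integral_le_of_norm_le ((T.integrable_zeta ℓ).mul_const _) (ae_of_all _ h4)
    rw [integral_mul_const] at h6
    refine h6.trans ?_
    calc _ ≤ T.ballArea * (‖f ℓ‖ * (T.lip * T.diam * √(e ℓ))) := by
          gcongr
          exact T.integral_zeta_le ℓ
      _ = _ := by ring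
  rw [h1]
  have hsum : ∑ ℓ ∈ S, e ℓ ≤ N * (T.oscConst * T.normU12 u ^ 2) :=
    sum_near_osc_le hU S (fun ℓ => (ℓ : Plane)) fun p J _ hJ => L.card_sites_le J hJ
  have h7 : √(∑ ℓ ∈ S, √(e ℓ) ^ 2) ≤ √(N * T.oscConst) * T.normU12 u := by
    simp only [Real.sq_sqrt (he0 _)]
    rw [← Real.sqrt_sq (T.normU12_nonneg u), ← Real.sqrt_mul
      (mul_nonneg (Nat.cast_nonneg _) T.oscConst_nonneg)]
    refine Real.sqrt_le_sqrt (hsum.trans_eq ?_)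
    ring
  have hB := T.ballArea_nonneg
  calc _ ≤ ∑ ℓ ∈ S, T.ballArea * (T.lip * T.diam) * (‖f ℓ‖ * √(e ℓ)) :=
        (Finset.abs_sum_le_sum_abs _ _).trans (Finset.sum_le_sum h3)
    _ ≤ T.ballArea * (T.lip * T.diam) * (√(∑ ℓ ∈ S, ‖f ℓ‖ ^ 2) * √(∑ ℓ ∈ S, √(e ℓ) ^ 2)) := by
        rw [← Finset.mul_sum]
        gcongr
        exact sum_mul_le_sqrt_mul_sqrt _ _ _
    _ ≤ T.ballArea * (T.lip * T.diam) *
          (√(∑ ℓ ∈ S, ‖f ℓ‖ ^ 2) * (√(N * T.oscConst) * T.normU12 u)) := by gcongr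
    _ = _ := by ring

end BackgroundMesh

/-! ### Control of the nodal load by the estimator -/

namespace CompDomain

variable (Ω : CompDomain T)

/-- The scaling factor with which triangles at sites near the boundary are shrunk into the outer
part of the domain. -/
def shrink (T : BackgroundMesh L) : ℝ := min 1 (minRadius T / (8 * T.diam))

theorem shrink_pos (T : BackgroundMesh L) : 0 < shrink T :=
  lt_min one_pos (div_pos (minRadius_pos T) (by have := T.diam_pos; positivity))

/-- The sites in the outer part of the domain. -/
def outerSites : Finset L.sites :=
  open Classical in Ω.sites.filter fun ℓ => 3 / 4 * Ω.R ≤ ‖(ℓ : Plane)‖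

theorem mem_outerSites {ℓ : L.sites} :
    ℓ ∈ Ω.outerSites ↔ ℓ ∈ Ω.sites ∧ 3 / 4 * Ω.R ≤ ‖(ℓ : Plane)‖ := by
  classical
  simp [outerSites]

theorem integrableOn_outer (u : L.sites → Plane) :
    IntegrableOn (fun x => ‖T.interp u x‖ ^ 2) Ω.outer :=
  (((T.continuous_interp u).norm.pow 2).continuousOn.integrableOn_compact
    Ω.isCompact_carrier).mono_set sdiff_subset

/-- When `R` is comparable to the mesh size, a triangle at an outer site may reach into `B_{R/2}`.
Shrunk towards the site by a fixed factor it stays in the outer part, where its integral still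
controls the nodal value. -/
theorem sum_outerSites_le (T : BackgroundMesh L) : ∃ C : ℝ, 0 ≤ C ∧ ∀ (Ω : CompDomain T)
    (f : L.sites → Plane),
      ∑ ℓ ∈ Ω.outerSites, ‖f ℓ‖ ^ 2 ≤ C * ∫ x in Ω.outer, ‖T.interp f x‖ ^ 2 := by
  have hs := shrink_pos T
  have hA := T.area_pos
  refine ⟨L.siteBound T.diam / (shrink T ^ 2 * T.area / 80), by positivity, fun Ω f => ?_⟩
  have h := (T.isPL_interp f).sum_norm_sq_le_integral Ω.outerSites Ω.measurableSet_outer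
    (Ω.integrableOn_outer f) hs (min_le_left _ _) fun ℓ hℓ => by
      obtain ⟨h1, h2⟩ := Ω.mem_outerSites.1 hℓ
      have h3 := Ω.mem_sites.1 h1
      simp only [carrier, mem_iUnion] at h3
      obtain ⟨t, ht, hlt⟩ := h3
      have htK := Ω.elements_mem t ht
      have hlt' := mem_of_mem_tri htK.1 ℓ.2 hlt
      refine ⟨t, htK, hlt', fun x hx => ⟨mem_biUnion ht ?_, fun hx2 => ?_⟩⟩
      · obtain ⟨y, hy, rfl⟩ := hx
        rw [AffineMap.homothety_apply, vsub_eq_sub, vadd_eq_add, add_comm]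
        exact (convex_convexHull ℝ (t : Set Plane)).add_smul_sub_mem hlt hy
          ⟨hs.le, min_le_left _ _⟩
      · have h4 := homothety_subset_ball htK hlt' hs.le hx
        -- The gap between the radii `3R/4` and `R/2` is `R/4`, so a displacement of `R/8` cannot
        -- bridge it.
        have h5 : shrink T * T.diam ≤ Ω.R / 8 := by
          have hd := T.diam_pos
          calc shrink T * T.diam ≤ minRadius T / (8 * T.diam) * T.diam := by
                gcongr; exact min_le_right _ _
            _ = minRadius T / 8 := by field_simp
            _ ≤ Ω.R / 8 := by gcongr; exact Ω.minRadius_le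
        rw [Metric.mem_closedBall] at h4
        rw [mem_closedBall_zero_iff] at hx2
        have h6 : ‖(ℓ : Plane)‖ ≤ dist x ℓ + ‖x‖ := by
          rw [dist_comm, dist_eq_norm]
          simpa using norm_add_le ((ℓ : Plane) - x) x
        have := Ω.R_pos
        linarith
  simp only [interp_site] at h
  rw [div_mul_eq_mul_div, le_div_iff₀ (by positivity), mul_comm]
  exact h

/-- Completing the square absorbs the linear term. -/
theorem young {c k y D : ℝ} (hc : 0 < c) (h : c * y ^ 2 ≤ k * y + D) :
    y ^ 2 ≤ (k ^ 2 / c + 2 * D) / c := by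
  rw [le_div_iff₀ hc]
  have h1 : 0 ≤ (c * y - k) ^ 2 / c := by positivity
  have h2 : (c * y - k) ^ 2 / c = c * y ^ 2 - 2 * k * y + k ^ 2 / c := by
    field_simp
    ring
  linarith

/-- The nodal values of a load are controlled by its dual norm on the finite element space and by
its `L²` norm on the outer part of the domain. -/
theorem sum_load_sq_le (T : BackgroundMesh L) : ∃ C : ℝ, 0 ≤ C ∧ ∀ (Ω : CompDomain T)
    (f : L.sites → Plane) (η : ℝ), 0 ≤ η → (∀ ℓ ∉ Ω.sites, f ℓ = 0) →
      (∀ v ∈ Ω.feSpace, |∫ x in Ω.carrier, inner ℝ (T.interp f x) (T.interp v x)| ≤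
        η * T.normU12 v) →
      ∑ ℓ ∈ Ω.sites, ‖f ℓ‖ ^ 2 ≤ C * (η ^ 2 + ∫ x in Ω.outer, ‖T.interp f x‖ ^ 2) := by
  classical
  obtain ⟨C₀, hC₀, houter⟩ := sum_outerSites_le T
  set N : ℝ := (L.siteBound T.diam : ℝ)
  set C₁ := T.normConst * (12 * T.nearBound 0) with hC₁
  have hC₁0 : 0 ≤ C₁ := mul_nonneg T.normConst_nonneg (by positivity)
  have hN : 0 ≤ N := Nat.cast_nonneg _
  have hA := T.area_pos
  have hBA := T.ballArea_nonneg
  set c := T.area / 160 with hc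
  have hc0 : 0 < c := by positivity
  refine ⟨(N ^ 2 * C₁ / c + N * T.ballArea * C₀) / c + C₀, by positivity,
    fun Ω f η hη hf hdual => ?_⟩
  set ω := ∫ x in Ω.outer, ‖T.interp f x‖ ^ 2 with hω
  have hω0 : 0 ≤ ω := integral_nonneg fun _ => by positivity
  -- The part of the load in the open ball is an admissible test function; the remainder `h` sits at
  -- outer sites and is bounded by the outer integral.
  set g : L.sites → Plane := fun ℓ => if ‖(ℓ : Plane)‖ < Ω.R then f ℓ else 0 with hg
  set h : L.sites → Plane := f - g with hh
  have hgS : ∀ ℓ ∉ Ω.sites, g ℓ = 0 := fun ℓ hℓ => by simp [hg, hf ℓ hℓ]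
  have hhS : ∀ ℓ ∉ Ω.sites, h ℓ = 0 := fun ℓ hℓ => by simp [hh, hgS ℓ hℓ, hf ℓ hℓ]
  have hgfe : g ∈ Ω.feSpace := Ω.mem_feSpace fun ℓ hℓ => by simp [hg, not_lt.2 hℓ]
  set A := ∑ ℓ ∈ Ω.sites, ‖g ℓ‖ ^ 2 with hAdef
  set B := ∑ ℓ ∈ Ω.sites, ‖h ℓ‖ ^ 2 with hBdef
  have hA0 : 0 ≤ A := Finset.sum_nonneg fun _ _ => by positivity
  have hB : B ≤ C₀ * ω := by
    refine le_trans ?_ (houter Ω f)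
    have hsub : B = ∑ ℓ ∈ Ω.outerSites, ‖h ℓ‖ ^ 2 := by
      refine (Finset.sum_subset (fun ℓ hℓ => (Ω.mem_outerSites.1 hℓ).1) fun ℓ hℓ hn => ?_).symm
      have : ‖(ℓ : Plane)‖ < Ω.R := by
        by_contra hlt
        exact hn (Ω.mem_outerSites.2 ⟨hℓ, by linarith [Ω.R_pos]⟩)
      simp [hh, hg, this]
    rw [hsub]
    refine Finset.sum_le_sum fun ℓ _ => ?_
    change ‖f ℓ - g ℓ‖ ^ 2 ≤ ‖f ℓ‖ ^ 2
    simp only [hg]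
    split_ifs <;> simp
  have hAB : ∑ ℓ ∈ Ω.sites, ‖f ℓ‖ ^ 2 ≤ A + B := by
    rw [hAdef, hBdef, ← Finset.sum_add_distrib]
    refine Finset.sum_le_sum fun ℓ _ => ?_
    simp only [hh, hg, Pi.sub_apply]
    split_ifs <;> simp
  have hig := integrable_norm_interp_sq (T := T) hgS
  have hih := integrable_norm_interp_sq (T := T) hhS
  -- Pointwise, with `f = g + h`, the difference of the two sides is `‖g + h‖²`.
  have h1 : ∫ x, ‖T.interp g x‖ ^ 2 ≤ 2 * (∫ x in Ω.carrier, inner ℝ (T.interp f x) (T.interp g x)) +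
      ∫ x, ‖T.interp h x‖ ^ 2 := by
    have hw : ∫ x in Ω.carrier, inner ℝ (T.interp f x) (T.interp g x) =
        ∫ x, inner ℝ (T.interp f x) (T.interp g x) :=
      setIntegral_eq_integral_of_forall_compl_eq_zero fun x hx => by
        rw [hgfe x fun h => hx (interior_subset h), inner_zero_right]
    have hifg := integrable_inner_interp (T := T) (f := f) hgS
    rw [hw, ← integral_const_mul, ← integral_add (hifg.const_mul 2) hih]
    refine integral_mono hig ((hifg.const_mul 2).add hih) fun x => ?_
    have hx : T.interp f x = T.interp g x + T.interp h x := by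
      rw [hh, interp_sub, Pi.sub_apply]; abel
    beta_reduce
    rw [hx, inner_add_left, real_inner_self_eq_norm_sq]
    have h2 := norm_add_sq_real (T.interp g x) (T.interp h x)
    have h3 := sq_nonneg ‖T.interp g x + T.interp h x‖
    rw [real_inner_comm]
    nlinarith
  have h2 : ∫ x in Ω.carrier, inner ℝ (T.interp f x) (T.interp g x) ≤ η * (√C₁ * √A) := by
    refine (le_abs_self _).trans ((hdual g hgfe).trans ?_)
    gcongr
    rw [← Real.sqrt_mul hC₁0]
    exact Real.le_sqrt_of_sq_le (normU12_sq_le_sum hgS)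
  have h3 := integral_norm_interp_sq_le (T := T) hhS
  have h4 := sum_norm_sq_le_integral_interp (T := T) hgS
  -- The dual bound followed by the inverse inequality makes the load term linear in `√A`, so that
  -- `young` applies.
  have h5 : c * √A ^ 2 ≤ N * η * √C₁ * √A + N * T.ballArea * C₀ * ω / 2 := by
    rw [Real.sq_sqrt hA0]
    have h6 : N * ∫ x, ‖T.interp g x‖ ^ 2 ≤
        N * (2 * (η * (√C₁ * √A)) + T.ballArea * (C₀ * ω)) := by
      gcongr
      refine h1.trans ?_
      gcongr
      exact h3.trans (by gcongr)
    have : c * A = (T.area / 80 * A) / 2 := by rw [hc]; ring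
    rw [this]
    linarith
  have h6 := young hc0 h5
  rw [Real.sq_sqrt hA0] at h6
  refine hAB.trans ((add_le_add h6 hB).trans ?_)
  have e1 : (N * η * √C₁) ^ 2 = N ^ 2 * C₁ * η ^ 2 := by
    rw [mul_pow, mul_pow, Real.sq_sqrt hC₁0]; ring
  rw [e1]
  have p1 : 0 ≤ N ^ 2 * C₁ / c / c * ω := by positivity
  have p2 : 0 ≤ N * T.ballArea * C₀ / c * η ^ 2 := by positivity
  have p3 : 0 ≤ C₀ * η ^ 2 := by positivity
  have e2 : ((N ^ 2 * C₁ / c + N * T.ballArea * C₀) / c + C₀) * (η ^ 2 + ω) =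
      (N ^ 2 * C₁ * η ^ 2 / c + 2 * (N * T.ballArea * C₀ * ω / 2)) / c + C₀ * ω +
      (N ^ 2 * C₁ / c / c * ω + N * T.ballArea * C₀ / c * η ^ 2 + C₀ * η ^ 2) := by ring
  rw [e2]
  linarith

end CompDomain

end

noncomputable section

open BackgroundMesh

variable {L : DefectLattice} {T : BackgroundMesh L}

namespace CompDomain

variable (Ω : CompDomain T)

/-! ### Truncation -/

/-- The cut-off function of a computational domain. -/
def cutoff (x : Plane) : ℝ := max 0 (min 1 (4 - 4 / Ω.R * ‖x‖))

theorem cutoff_nonneg (x : Plane) : 0 ≤ Ω.cutoff x := le_max_left _ _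

theorem cutoff_le_one (x : Plane) : Ω.cutoff x ≤ 1 := max_le zero_le_one (min_le_left _ _)

theorem cutoff_eq_one {x : Plane} (hx : ‖x‖ ≤ 3 / 4 * Ω.R) : Ω.cutoff x = 1 := by
  have h : 4 / Ω.R * ‖x‖ ≤ 3 := by
    rw [div_mul_eq_mul_div, div_le_iff₀ Ω.R_pos]
    linarith
  rw [cutoff, min_eq_left (by linarith), max_eq_right zero_le_one]

theorem cutoff_eq_zero {x : Plane} (hx : Ω.R ≤ ‖x‖) : Ω.cutoff x = 0 := by
  have h : 4 ≤ 4 / Ω.R * ‖x‖ := by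
    rw [div_mul_eq_mul_div, le_div_iff₀ Ω.R_pos]
    linarith
  rw [cutoff, max_eq_left]
  exact (min_le_right _ _).trans (by linarith)

theorem abs_cutoff_sub_le (x y : Plane) : |Ω.cutoff x - Ω.cutoff y| ≤ 4 / Ω.R * dist x y := by
  have h1 := abs_max_sub_max_le_abs (min 1 (4 - 4 / Ω.R * ‖x‖)) (min 1 (4 - 4 / Ω.R * ‖y‖)) 0
  rw [max_comm _ 0, max_comm _ 0] at h1
  have h2 := abs_min_sub_min_le_max 1 (4 - 4 / Ω.R * ‖x‖) 1 (4 - 4 / Ω.R * ‖y‖)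
  rw [sub_self, abs_zero, max_eq_right (abs_nonneg _)] at h2
  have h3 : 4 - 4 / Ω.R * ‖x‖ - (4 - 4 / Ω.R * ‖y‖) = 4 / Ω.R * (‖y‖ - ‖x‖) := by ring
  have hR := Ω.R_pos
  rw [h3, abs_mul, abs_of_nonneg (show 0 ≤ 4 / Ω.R by positivity), abs_sub_comm ‖y‖] at h2
  refine h1.trans (h2.trans ?_)
  rw [dist_eq_norm]
  gcongr
  exact abs_norm_sub_norm_le x y

/-- The truncation of a displacement of finite energy to the finite element space. -/
theorem exists_truncation (T : BackgroundMesh L) : ∃ C : ℝ, 0 ≤ C ∧ ∀ (Ω : CompDomain T)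
    (v : L.sites → Plane), T.IsU12 v → ∃ (c : Plane) (u : L.sites → Plane), u ∈ Ω.feSpace ∧
      T.normU12 u ^ 2 ≤ C * T.normU12 v ^ 2 ∧
      ∑ ℓ ∈ Ω.sites, ‖v ℓ - c‖ ^ 2 ≤ C * Ω.R ^ 2 * T.normU12 v ^ 2 ∧
      (∀ ℓ : L.sites, ‖(ℓ : Plane)‖ ≤ 3 / 4 * Ω.R → u ℓ = v ℓ - c) ∧
      ∀ ℓ, ‖v ℓ - c - u ℓ‖ ≤ ‖v ℓ - c‖ := by
  classical
  obtain ⟨C₀, hC₀, hpoinc⟩ := T.poincare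
  have hr := minRadius_pos T
  set r := minRadius T
  have hd := T.diam_pos
  have hO := T.oscConst_nonneg
  have hNC := T.normConst_nonneg
  set C₁ := C₀ * (2 + 1 / r) ^ 2 with hC₁
  have hC₁0 : 0 ≤ C₁ := by positivity
  set C₂ := T.normConst * (2 * T.oscConst + 24 * (4 * T.diam) ^ 2 * T.nearBound 0 * C₁) with hC₂
  have hC₂0 : 0 ≤ C₂ := by positivity
  refine ⟨C₁ + C₂, by positivity, fun Ω v hv => ?_⟩
  have hR := Ω.R_pos
  obtain ⟨c, hc⟩ := hpoinc v hv (2 * Ω.R) (by linarith)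
  have hpv := hc Ω.sites fun ℓ hℓ => Ω.norm_le_of_mem (Ω.mem_sites.1 hℓ)
  have hv2 : 0 ≤ T.normU12 v ^ 2 := sq_nonneg _
  have hpv' : ∑ ℓ ∈ Ω.sites, ‖v ℓ - c‖ ^ 2 ≤ C₁ * Ω.R ^ 2 * T.normU12 v ^ 2 := by
    refine hpv.trans ?_
    -- The lower bound for `R` turns the inhomogeneous Poincaré constant into a multiple of `R²`.
    have : 2 * Ω.R + 1 ≤ (2 + 1 / r) * Ω.R := by
      have : 1 ≤ 1 / r * Ω.R := by
        rw [div_mul_eq_mul_div, one_mul, le_div_iff₀ hr, one_mul]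
        exact Ω.minRadius_le
      linarith
    calc C₀ * (2 * Ω.R + 1) ^ 2 * T.normU12 v ^ 2 ≤
        C₀ * ((2 + 1 / r) * Ω.R) ^ 2 * T.normU12 v ^ 2 := by gcongr
      _ = _ := by rw [hC₁]; ring
  set w : L.sites → Plane := fun ℓ => v ℓ - c with hw
  set u : L.sites → Plane := fun ℓ => Ω.cutoff ℓ • w ℓ with hu
  have hufe : u ∈ Ω.feSpace := Ω.mem_feSpace fun ℓ hℓ => by simp [hu, Ω.cutoff_eq_zero hℓ]
  refine ⟨c, u, hufe, ?_, hpv'.trans ?_, fun ℓ hℓ => ?_, fun ℓ => ?_⟩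
  -- Triangles touching `Ω` may have vertices outside it, where the Poincaré bound says nothing
  -- about `w`. Only values in the open ball are allowed to enter.
  · set a : Plane → ℝ := fun p => if ‖p‖ < Ω.R then ‖T.interp w p‖ ^ 2 else 0 with ha
    have ha0 : ∀ p, 0 ≤ a p := fun p => by
      simp only [ha]; split_ifs <;> positivity
    have hwv : ∀ x, T.interp w x = T.interp v x - c := by
      intro x
      have : w = v - fun _ => c := rfl
      rw [this, interp_sub, interp_const]
      rfl
    have haS : ∀ p : L.sites, p ∉ Ω.sites → a p = 0 := by
      intro p hp
      simp only [ha]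
      rw [if_neg]
      intro h
      refine hp (Ω.mem_sites.2 (Ω.ball_subset ?_))
      simpa using h.le
    set F := T.star Ω.sites
    have hF : ∀ t ∈ F, t ∈ triangles T.K := fun _ ht => (mem_star.1 ht).1
    set κ := 4 * T.diam / Ω.R with hκ
    have hκ0 : 0 ≤ κ := by positivity
    have hnode : ∀ t ∈ F, ∀ p ∈ t, T.interp u p = Ω.cutoff p • T.interp w p := by
      intro t ht p hp
      have hps := vertex_mem_sites (hF t ht).1 hp
      rw [interp_site (T := T) u ⟨p, hps⟩, interp_site (T := T) w ⟨p, hps⟩]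
    have hpair : ∀ t ∈ F, ∀ p ∈ t, ∀ q ∈ t, ‖T.interp u p - T.interp u q‖ ^ 2 ≤
        2 * ‖T.interp v p - T.interp v q‖ ^ 2 + 4 * κ ^ 2 * (a p + a q) := by
      intro t ht p hp q hq
      rw [hnode t ht p hp, hnode t ht q hq]
      have hvw : T.interp v p - T.interp v q = T.interp w p - T.interp w q := by
        rw [hwv, hwv]; abel
      rw [hvw]
      set P := T.interp w p with hP
      set Q := T.interp w q with hQ
      have hlip : |Ω.cutoff p - Ω.cutoff q| ≤ κ := by
        refine (Ω.abs_cutoff_sub_le p q).trans ?_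
        rw [hκ, div_mul_eq_mul_div]
        gcongr
        exact dist_le (hF t ht) (vertex_mem_tri hp) (vertex_mem_tri hq)
      have key : ∀ α β : ℝ, |α| ≤ 1 → |β| ≤ κ → ∀ x y : Plane,
          ‖α • x + β • y‖ ^ 2 ≤ 2 * ‖x‖ ^ 2 + 2 * κ ^ 2 * ‖y‖ ^ 2 := by
        intro α β hα hβ x y
        have h1 : ‖α • x + β • y‖ ≤ ‖x‖ + κ * ‖y‖ := by
          refine (norm_add_le _ _).trans ?_
          rw [norm_smul, norm_smul, Real.norm_eq_abs, Real.norm_eq_abs]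
          gcongr
          exact mul_le_of_le_one_left (norm_nonneg _) hα
        calc _ ≤ (‖x‖ + κ * ‖y‖) ^ 2 := by gcongr
          _ ≤ _ := by nlinarith [sq_nonneg (‖x‖ - κ * ‖y‖)]
      have hcp : ∀ x, |Ω.cutoff x| ≤ 1 := fun x => by
        rw [abs_of_nonneg (Ω.cutoff_nonneg x)]; exact Ω.cutoff_le_one x
      have hκ2 : 0 ≤ κ ^ 2 := sq_nonneg κ
      -- In the discrete product rule, the difference of the cut-off values may multiply the value
      -- of `w` at either vertex; the one inside the ball is taken. If neither is inside, both
      -- products vanish.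
      by_cases hqR : ‖q‖ < Ω.R
      · have h1 := key _ _ (hcp p) hlip (P - Q) Q
        have h2 : Ω.cutoff p • (P - Q) + (Ω.cutoff p - Ω.cutoff q) • Q =
            Ω.cutoff p • P - Ω.cutoff q • Q := by module
        rw [h2] at h1
        have h3 : a q = ‖Q‖ ^ 2 := by simp only [ha]; rw [if_pos hqR]
        have := ha0 p
        rw [← h3] at h1
        have := mul_nonneg hκ2 (ha0 p)
        have := mul_nonneg hκ2 (ha0 q)
        linarith
      · have hq0 := Ω.cutoff_eq_zero (not_lt.1 hqR)
        by_cases hpR : ‖p‖ < Ω.R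
        · have h1 := key 0 _ (by simp) hlip (P - Q) P
          have h2 : (0 : ℝ) • (P - Q) + (Ω.cutoff p - Ω.cutoff q) • P =
              Ω.cutoff p • P - Ω.cutoff q • Q := by rw [hq0]; module
          rw [h2] at h1
          have h3 : a p = ‖P‖ ^ 2 := by simp only [ha]; rw [if_pos hpR]
          rw [← h3] at h1
          have := mul_nonneg hκ2 (ha0 p)
          have := mul_nonneg hκ2 (ha0 q)
          linarith
        · rw [hq0, Ω.cutoff_eq_zero (not_lt.1 hpR), zero_smul, zero_smul, sub_zero, norm_zero,
            zero_pow two_ne_zero]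
          have := ha0 p
          have := ha0 q
          positivity
    have hosc : ∀ t ∈ F, osc t (T.interp u) ≤
        2 * osc t (T.interp v) + 24 * κ ^ 2 * ∑ p ∈ t, a p := by
      intro t ht
      refine (Finset.sum_le_sum fun p hp => Finset.sum_le_sum fun q hq =>
        hpair t ht p hp q hq).trans_eq ?_
      simp only [osc, Finset.sum_add_distrib, ← Finset.mul_sum, Finset.sum_const, (hF t ht).2,
        nsmul_eq_mul]
      push_cast
      ring
    have hsuma : ∑ ℓ ∈ Ω.sites, a ℓ ≤ ∑ ℓ ∈ Ω.sites, ‖v ℓ - c‖ ^ 2 := by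
      refine Finset.sum_le_sum fun ℓ _ => ?_
      simp only [ha, interp_site]
      split_ifs
      · exact le_rfl
      · positivity
    calc T.normU12 u ^ 2 ≤ T.normConst * ∑ t ∈ F, osc t (T.interp u) :=
          normU12_sq_le_of_support (eq_zero_of_mem_feSpace hufe)
      _ ≤ T.normConst * (2 * (T.oscConst * T.normU12 v ^ 2) +
            24 * κ ^ 2 * (T.nearBound 0 * (C₁ * Ω.R ^ 2 * T.normU12 v ^ 2))) := by
          refine mul_le_mul_of_nonneg_left ?_ hNC
          refine (Finset.sum_le_sum hosc).trans ?_
          rw [Finset.sum_add_distrib, ← Finset.mul_sum, ← Finset.mul_sum]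
          gcongr
          · exact sum_osc_le hv F hF
          · refine (sum_triangles_le F hF Ω.sites ha0 haS).trans ?_
            gcongr
            exact hsuma.trans hpv'
      _ = C₂ * T.normU12 v ^ 2 := by
          -- The slope `4 / R` of the cut-off cancels the factor `R²` of the Poincaré inequality.
          have : κ ^ 2 * Ω.R ^ 2 = (4 * T.diam) ^ 2 := by
            rw [hκ]; field_simp
          rw [hC₂]
          linear_combination 24 * T.normConst * T.nearBound 0 * C₁ * T.normU12 v ^ 2 * this
      _ ≤ _ := by
          gcongr
          linarith
  · gcongr
    linarith
  · simp only [hu, Ω.cutoff_eq_one hℓ, one_smul]; rfl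
  · have h1 : v ℓ - c - u ℓ = (1 - Ω.cutoff ℓ) • (v ℓ - c) := by
      simp only [hu, hw]; module
    rw [h1, norm_smul, Real.norm_of_nonneg (by linarith [Ω.cutoff_le_one ℓ])]
    refine mul_le_of_le_one_left (norm_nonneg _) ?_
    linarith [Ω.cutoff_nonneg ℓ]

/-! ### The residual in the dual norm -/

/-- The residual is controlled by the error estimator and the truncation indicator. -/
theorem residual_le (P : SitePotential L) (T : BackgroundMesh L) : ∃ C : ℝ, 0 ≤ C ∧
    ∀ (Ω : CompDomain T) (y : L.sites → Plane),
      (∀ ℓ : L.sites, (ℓ : Plane) ∉ Ω.carrier → P.force y ℓ = 0) →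
      ∑ ℓ ∈ Ω.sites, P.force y ℓ = 0 → ∀ v : L.sites → Plane, T.IsU12 v →
      ∑ ℓ ∈ Ω.sites, inner ℝ (P.force y ℓ) (v ℓ) ≤
        C * (Ω.eta P y + Ω.rhoTr P y) * T.normU12 v := by
  obtain ⟨C₁, hC₁, hlump⟩ := T.abs_lumping_sub_le
  obtain ⟨C₂, hC₂, hout⟩ := sum_outerSites_le T
  obtain ⟨C₃, hC₃, hload⟩ := sum_load_sq_le T
  obtain ⟨C₄, hC₄, htrunc⟩ := exists_truncation T
  have hr := minRadius_pos T
  set r := minRadius T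
  have hBA := T.ballArea_nonneg
  refine ⟨C₁ * √(C₃ * (1 + 1 / r ^ 2)) * √C₄ + √C₄ + T.ballArea * √C₂ * √C₄,
    by positivity, fun Ω y hF hF0 v hv => ?_⟩
  have hR := Ω.R_pos
  have hη := Ω.eta_nonneg P y
  have hρ := Ω.rhoTr_nonneg P y
  have hV := T.normU12_nonneg v
  obtain ⟨c, u, hufe, hu1, hu2, hu3, hu4⟩ := htrunc Ω v hv
  set f : L.sites → Plane := fun ℓ => (∫ x, T.zeta ℓ x)⁻¹ • P.force y ℓ with hf
  have hM : ∀ ℓ, 0 < ∫ x, T.zeta ℓ x := fun ℓ =>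
    (div_pos T.area_pos (by norm_num)).trans_le (T.le_integral_zeta ℓ)
  have hFf : ∀ ℓ, P.force y ℓ = (∫ x, T.zeta ℓ x) • f ℓ := fun ℓ => by
    simp only [hf]
    rw [smul_inv_smul₀ (hM ℓ).ne']
  have hfS : ∀ ℓ ∉ Ω.sites, f ℓ = 0 := fun ℓ hℓ => by
    simp only [hf]
    rw [hF ℓ fun h => hℓ (Ω.mem_sites.2 h), smul_zero]
  have hI : forceInterp T P y = T.interp f := rfl
  clear_value f
  set ω := √(∫ x in Ω.outer, ‖T.interp f x‖ ^ 2) with hω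
  have hω0 : 0 ≤ ω := Real.sqrt_nonneg _
  have hω2 : ω ^ 2 = ∫ x in Ω.outer, ‖T.interp f x‖ ^ 2 :=
    Real.sq_sqrt (integral_nonneg fun _ => by positivity)
  have hRω : Ω.R * ω ≤ Ω.rhoTr P y := by
    rw [rhoTr, hI, ← hω]
    exact le_add_of_nonneg_right (Real.sqrt_nonneg _)
  -- The indicator contains `R ω`; the lower bound for `R` makes it control `ω` alone, as the bound
  -- for the nodal load requires.
  have hωr : ω ≤ Ω.rhoTr P y / r := by
    rw [le_div_iff₀ hr, mul_comm]
    exact (mul_le_mul_of_nonneg_right Ω.minRadius_le hω0).trans hRω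
  have hdual : ∀ w ∈ Ω.feSpace, |∫ x in Ω.carrier, inner ℝ (T.interp f x) (T.interp w x)| ≤
      Ω.eta P y * T.normU12 w := fun w hw => by
    rw [← hI]; exact Ω.abs_integral_force_le P y hw
  set η := Ω.eta P y
  set ρ := Ω.rhoTr P y
  have hsumf : √(∑ ℓ ∈ Ω.sites, ‖f ℓ‖ ^ 2) ≤ √(C₃ * (1 + 1 / r ^ 2)) * (η + ρ) := by
    rw [← Real.sqrt_sq (add_nonneg hη hρ), ← Real.sqrt_mul (by positivity)]
    refine Real.sqrt_le_sqrt ((hload Ω f η hη hfS hdual).trans ?_)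
    rw [← hω2, mul_assoc]
    gcongr
    have h1 : ω ^ 2 ≤ (ρ / r) ^ 2 := by gcongr
    have h2 : (ρ / r) ^ 2 = 1 / r ^ 2 * ρ ^ 2 := by ring
    have h3 : 0 ≤ 1 / r ^ 2 := by positivity
    rw [h2] at h1
    have e : (1 + 1 / r ^ 2) * (η + ρ) ^ 2 =
        η ^ 2 + 1 / r ^ 2 * ρ ^ 2 + (ρ ^ 2 + 2 * η * ρ + 1 / r ^ 2 * (η ^ 2 + 2 * η * ρ)) := by ring
    rw [e]
    have : 0 ≤ ρ ^ 2 + 2 * η * ρ + 1 / r ^ 2 * (η ^ 2 + 2 * η * ρ) := by positivity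
    linarith
  have hun : T.normU12 u ≤ √C₄ * T.normU12 v := by
    rw [← Real.sqrt_sq hV, ← Real.sqrt_mul hC₄, ← Real.sqrt_sq (T.normU12_nonneg u)]
    exact Real.sqrt_le_sqrt hu1
  -- Equilibrium of the forces permits subtracting `c`. The truncated part is handled by lumping and
  -- the Poisson problem, the rest by the outer norm of the forces.
  have hsplit : ∑ ℓ ∈ Ω.sites, inner ℝ (P.force y ℓ) (v ℓ) =
      ∑ ℓ ∈ Ω.sites, (∫ x, T.zeta ℓ x) * inner ℝ (f ℓ) (u ℓ) +
        ∑ ℓ ∈ Ω.sites, (∫ x, T.zeta ℓ x) * inner ℝ (f ℓ) (v ℓ - c - u ℓ) := by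
    have h0 : ∑ ℓ ∈ Ω.sites, inner ℝ (P.force y ℓ) c = 0 := by
      rw [← sum_inner, hF0, inner_zero_left]
    rw [← Finset.sum_add_distrib, ← sub_zero (∑ ℓ ∈ Ω.sites, inner ℝ (P.force y ℓ) (v ℓ)), ← h0,
      ← Finset.sum_sub_distrib]
    refine Finset.sum_congr rfl fun ℓ _ => ?_
    rw [hFf]
    simp only [real_inner_smul_left, inner_sub_right]
    ring
  have h1 : ∑ ℓ ∈ Ω.sites, (∫ x, T.zeta ℓ x) * inner ℝ (f ℓ) (u ℓ) ≤
      C₁ * √(∑ ℓ ∈ Ω.sites, ‖f ℓ‖ ^ 2) * T.normU12 u + η * T.normU12 u := by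
    have a1 := hlump f u Ω.sites Ω.sites hfS (eq_zero_of_mem_feSpace hufe)
    have a2 := hdual u hufe
    have hw : ∫ x in Ω.carrier, inner ℝ (T.interp f x) (T.interp u x) =
        ∫ x, inner ℝ (T.interp f x) (T.interp u x) :=
      setIntegral_eq_integral_of_forall_compl_eq_zero fun x hx => by
        rw [hufe x fun h => hx (interior_subset h), inner_zero_right]
    rw [hw] at a2
    linarith [le_abs_self (∑ ℓ ∈ Ω.sites, (∫ x, T.zeta ℓ x) * inner ℝ (f ℓ) (u ℓ) -
      ∫ x, inner ℝ (T.interp f x) (T.interp u x)),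
      le_abs_self (∫ x, inner ℝ (T.interp f x) (T.interp u x))]
  -- The truncation error vanishes up to radius `3R/4`. Cauchy–Schwarz with the Poincaré bound for
  -- `v - c` supplies the weight `R` of the truncation indicator.
  have h2 : ∑ ℓ ∈ Ω.sites, (∫ x, T.zeta ℓ x) * inner ℝ (f ℓ) (v ℓ - c - u ℓ) ≤
      T.ballArea * (√C₂ * ω * (√C₄ * Ω.R * T.normU12 v)) := by
    have b1 : ∑ ℓ ∈ Ω.sites, (∫ x, T.zeta ℓ x) * inner ℝ (f ℓ) (v ℓ - c - u ℓ) =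
        ∑ ℓ ∈ Ω.outerSites, (∫ x, T.zeta ℓ x) * inner ℝ (f ℓ) (v ℓ - c - u ℓ) := by
      refine (Finset.sum_subset (fun ℓ hℓ => (Ω.mem_outerSites.1 hℓ).1) fun ℓ hℓ hn => ?_).symm
      have : ‖(ℓ : Plane)‖ ≤ 3 / 4 * Ω.R := by
        by_contra h
        exact hn (Ω.mem_outerSites.2 ⟨hℓ, (not_le.1 h).le⟩)
      rw [hu3 ℓ this, sub_self, inner_zero_right, mul_zero]
    have b2 : ∀ ℓ ∈ Ω.outerSites, (∫ x, T.zeta ℓ x) * inner ℝ (f ℓ) (v ℓ - c - u ℓ) ≤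
        T.ballArea * (‖f ℓ‖ * ‖v ℓ - c‖) := by
      intro ℓ _
      have b3 : inner ℝ (f ℓ) (v ℓ - c - u ℓ) ≤ ‖f ℓ‖ * ‖v ℓ - c‖ :=
        (real_inner_le_norm _ _).trans (by gcongr; exact hu4 ℓ)
      calc _ ≤ (∫ x, T.zeta ℓ x) * (‖f ℓ‖ * ‖v ℓ - c‖) := by
            have := (hM ℓ).le
            gcongr
        _ ≤ _ := by
            gcongr
            exact T.integral_zeta_le ℓ
    rw [b1]
    refine (Finset.sum_le_sum b2).trans ?_
    rw [← Finset.mul_sum]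
    gcongr
    refine (sum_mul_le_sqrt_mul_sqrt _ _ _).trans ?_
    gcongr
    · rw [hω, ← Real.sqrt_mul hC₂]
      exact Real.sqrt_le_sqrt (hout Ω f)
    · rw [mul_assoc, ← Real.sqrt_sq (show 0 ≤ Ω.R * T.normU12 v by positivity), ← Real.sqrt_mul hC₄]
      refine Real.sqrt_le_sqrt (le_trans ?_ (hu2.trans_eq ?_))
      · exact Finset.sum_le_sum_of_subset_of_nonneg (fun ℓ hℓ => (Ω.mem_outerSites.1 hℓ).1)
          fun _ _ _ => by positivity
      · ring
  have hU0 := T.normU12_nonneg u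
  have hηρ : η ≤ η + ρ := le_add_of_nonneg_right hρ
  rw [hsplit]
  calc _ ≤ (C₁ * √(∑ ℓ ∈ Ω.sites, ‖f ℓ‖ ^ 2) * T.normU12 u + η * T.normU12 u) +
        T.ballArea * (√C₂ * ω * (√C₄ * Ω.R * T.normU12 v)) := add_le_add h1 h2
    _ = (C₁ * √(∑ ℓ ∈ Ω.sites, ‖f ℓ‖ ^ 2) * T.normU12 u + η * T.normU12 u) +
        T.ballArea * √C₂ * √C₄ * (Ω.R * ω) * T.normU12 v := by ring
    _ ≤ (C₁ * (√(C₃ * (1 + 1 / r ^ 2)) * (η + ρ)) * (√C₄ * T.normU12 v) +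
          (η + ρ) * (√C₄ * T.normU12 v)) + T.ballArea * √C₂ * √C₄ * (η + ρ) * T.normU12 v := by
        gcongr
        exact hRω.trans (le_add_of_nonneg_left hη)
    _ = _ := by ring

end CompDomain

end

noncomputable section

open BackgroundMesh

/-! ### Taylor expansion -/

section Taylor

variable {E : Type*} [NormedAddCommGroup E] [NormedSpace ℝ E]

/-- First and second order bounds for the increments of a function on a ball. -/
def TaylorBound (f : E → ℝ) (M C : ℝ) : Prop := ∀ g k : E, ‖g‖ ≤ M → ‖k‖ ≤ M →
  ‖fderiv ℝ f (g + k) - fderiv ℝ f g‖ ≤ C * ‖k‖ ∧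
  |f (g + k) - f g - fderiv ℝ f g k| ≤ C * ‖k‖ ^ 2 ∧
  |fderiv ℝ (fderiv ℝ f) g k k| ≤ C * ‖k‖ ^ 2

/-- Approximation of the increments of the derivative by the second derivative. -/
def HessianBound (f : E → ℝ) (M ε δ : ℝ) : Prop := ∀ g k : E, ‖g‖ ≤ M → ‖k‖ ≤ δ →
  |(fderiv ℝ f (g + k) - fderiv ℝ f g) k - fderiv ℝ (fderiv ℝ f) g k k| ≤ ε * ‖k‖ ^ 2

theorem exists_taylorBound [FiniteDimensional ℝ E] {f : E → ℝ} (hf : ContDiff ℝ 2 f) (M : ℝ) :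
    ∃ C, TaylorBound f M C := by
  have hf1 : ContDiff ℝ 1 (fderiv ℝ f) := hf.fderiv_right (by norm_num)
  have hf2 : Continuous (fderiv ℝ (fderiv ℝ f)) := hf1.continuous_fderiv (by norm_num)
  obtain ⟨C, hC⟩ : ∃ C, ∀ x ∈ Metric.closedBall (0 : E) (2 * M),
      ‖fderiv ℝ (fderiv ℝ f) x‖ ≤ C := by
    obtain ⟨C, hC⟩ := (isCompact_closedBall (0 : E) (2 * M)).bddAbove_image
      ((continuous_norm (E := E →L[ℝ] E →L[ℝ] ℝ)).comp hf2).continuousOn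
    exact ⟨C, fun x hx => hC ⟨x, hx, rfl⟩⟩
  have key : ∀ g k : E, ‖g‖ ≤ M → ‖k‖ ≤ M →
      ‖fderiv ℝ f (g + k) - fderiv ℝ f g‖ ≤ C * ‖k‖ := by
    intro g k hg hk
    have hM : 0 ≤ M := (norm_nonneg g).trans hg
    have := (convex_closedBall (0 : E) (2 * M)).norm_image_sub_le_of_norm_fderiv_le (𝕜 := ℝ)
      (f := fderiv ℝ f) (C := C) (x := g) (y := g + k)
      (fun x _ => hf1.differentiable (by norm_num) x) hC
      (by simpa using by linarith) (by simpa using (norm_add_le g k).trans (by linarith))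
    simpa using this
  refine ⟨C, fun g k hg hk => ⟨key g k hg hk, ?_, ?_⟩⟩
  · have := (convex_closedBall g ‖k‖).norm_image_sub_le_of_norm_fderiv_le' (𝕜 := ℝ)
      (f := f) (φ := fderiv ℝ f g) (C := C * ‖k‖) (x := g) (y := g + k)
      (fun x _ => hf.differentiable (by norm_num) x)
      (fun x hx => by
        have hx' : ‖x - g‖ ≤ ‖k‖ := by rwa [Metric.mem_closedBall, dist_eq_norm] at hx
        have h1 := key g (x - g) hg (hx'.trans hk)
        rw [add_sub_cancel] at h1
        refine h1.trans ?_
        have hC0 : 0 ≤ C := (norm_nonneg (fderiv ℝ (fderiv ℝ f) 0)).trans (hC 0 (by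
          simpa using (norm_nonneg g).trans hg))
        gcongr)
      (by simp) (by simp)
    rw [add_sub_cancel_left, Real.norm_eq_abs] at this
    calc _ ≤ _ := this
      _ = _ := by ring
  · have hM : 0 ≤ M := (norm_nonneg g).trans hg
    have h1 := hC g (by simpa using by linarith)
    rw [← Real.norm_eq_abs]
    calc _ ≤ ‖fderiv ℝ (fderiv ℝ f) g‖ * ‖k‖ * ‖k‖ := ContinuousLinearMap.le_opNorm₂ _ _ _
      _ ≤ C * ‖k‖ * ‖k‖ := by gcongr
      _ = _ := by ring

/-- For a `C²` function the second derivative is merely uniformly continuous on compact balls, so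
there is a modulus and no rate. Requiring `δ ≤ 1` keeps `g + k` in the ball of radius `M + 1`. -/
theorem exists_hessianBound [FiniteDimensional ℝ E] {f : E → ℝ} (hf : ContDiff ℝ 2 f) (M : ℝ)
    {ε : ℝ} (hε : 0 < ε) : ∃ δ > 0, HessianBound f M ε δ := by
  have hf1 : ContDiff ℝ 1 (fderiv ℝ f) := hf.fderiv_right (by norm_num)
  have hf2 : Continuous (fderiv ℝ (fderiv ℝ f)) := hf1.continuous_fderiv (by norm_num)
  have huc := (isCompact_closedBall (0 : E) (M + 1)).uniformContinuousOn_of_continuous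
    hf2.continuousOn
  obtain ⟨δ, hδ, h⟩ : ∃ δ > 0, ∀ x ∈ Metric.closedBall (0 : E) (M + 1),
      ∀ y ∈ Metric.closedBall (0 : E) (M + 1), dist x y ≤ δ →
        dist (fderiv ℝ (fderiv ℝ f) x) (fderiv ℝ (fderiv ℝ f) y) ≤ ε :=
    Metric.uniformContinuousOn_iff_le.1 huc ε hε
  refine ⟨min δ 1, lt_min hδ one_pos, fun g k hg hk => ?_⟩
  have hk1 : ‖k‖ ≤ 1 := hk.trans (min_le_right _ _)
  have hkδ : ‖k‖ ≤ δ := hk.trans (min_le_left _ _)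
  have := (convex_closedBall g ‖k‖).norm_image_sub_le_of_norm_fderiv_le' (𝕜 := ℝ)
    (f := fderiv ℝ f) (φ := fderiv ℝ (fderiv ℝ f) g) (C := ε) (x := g) (y := g + k)
    (fun x _ => hf1.differentiable (by norm_num) x)
    (fun x hx => by
      have hx' : dist x g ≤ ‖k‖ := hx
      rw [← dist_eq_norm]
      refine h x ?_ g ?_ (hx'.trans hkδ)
      · rw [mem_closedBall_zero_iff]
        have := norm_le_norm_add_norm_sub' x g
        rw [← dist_eq_norm] at this
        linarith
      · rw [mem_closedBall_zero_iff]
        linarith)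
    (by simp) (by simp)
  rw [add_sub_cancel_left] at this
  rw [← sub_apply, ← Real.norm_eq_abs]
  refine (ContinuousLinearMap.le_opNorm _ _).trans ?_
  calc _ ≤ ε * ‖k‖ * ‖k‖ := by gcongr
    _ = _ := by ring

/-- A quadratic remainder bound identifies the derivative of the energy series without
differentiating it term by term. -/
theorem hasFDerivAt_of_quadratic {f : E → ℝ} {A : E →L[ℝ] ℝ} {x : E} {C : ℝ}
    (h : ∀ᶠ k in 𝓝 (0 : E), |f (x + k) - f x - A k| ≤ C * ‖k‖ ^ 2) : HasFDerivAt f A x := by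
  rw [hasFDerivAt_iff_isLittleO_nhds_zero]
  refine Asymptotics.IsBigO.trans_isLittleO (g := fun k : E => ‖k‖ ^ 2) ?_
    (Asymptotics.isLittleO_norm_pow_id one_lt_two)
  refine Asymptotics.IsBigO.of_bound C ?_
  filter_upwards [h] with k hk
  rw [Real.norm_eq_abs, norm_pow, norm_norm]
  exact hk

end Taylor

variable {L : DefectLattice}

namespace SitePotential

variable (P : SitePotential L)

/-! ### Uniformity over the sites -/

/-- Far from the defect all sites have the interaction range and the potential of the
homogeneous lattice. -/
theorem exists_far : ∃ R : ℝ, ∀ ℓ : L.sites, R < ‖(ℓ : Plane)‖ →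
    (L.range P.rcut ℓ = L.homRange P.rcut) ∧
    (∀ g : Plane → Plane, P.V ℓ (fun ρ => g ρ) = P.Vhom fun ρ => g ρ) ∧
    ∀ ρ ∈ L.homRange P.rcut, (ℓ : Plane) - ρ ∈ L.sites := by
  obtain ⟨R, hR⟩ := P.far
  have hrc := P.rcut_pos
  have hfar : ∀ x : Plane, L.rDef < ‖x‖ → (x ∈ L.sites ↔ x ∈ homLattice L.A) := by
    intro x hx
    have h : x ∉ Metric.closedBall (0 : Plane) L.rDef := by simpa using hx
    have h1 : x ∈ L.sites \ Metric.closedBall 0 L.rDef ↔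
        x ∈ homLattice L.A \ Metric.closedBall 0 L.rDef := by rw [L.far_eq]
    simpa only [Set.mem_sdiff, h, not_false_iff, and_true] using h1
  have hneg : ∀ x ∈ homLattice L.A, ∀ y ∈ homLattice L.A, x + y ∈ homLattice L.A := by
    intro x hx y hy
    have h0 : (0 : Plane) ∈ homLattice L.A := by
      have := homLattice_sub_mem hx hx
      rwa [sub_self] at this
    have := homLattice_sub_mem hx (homLattice_sub_mem h0 hy)
    rwa [zero_sub, sub_neg_eq_add] at this
  refine ⟨max R L.rDef + P.rcut, fun ℓ hℓ => ?_⟩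
  have hRℓ : R < ‖(ℓ : Plane)‖ := by linarith [le_max_left R L.rDef]
  have hdℓ : L.rDef + P.rcut < ‖(ℓ : Plane)‖ := by linarith [le_max_right R L.rDef]
  have hℓh : (ℓ : Plane) ∈ homLattice L.A := (hfar _ (by linarith)).1 ℓ.2
  have hadd : ∀ ρ : Plane, ‖ρ‖ ≤ P.rcut → L.rDef < ‖(ℓ : Plane) + ρ‖ := fun ρ hρ => by
    have := norm_sub_le_norm_add (ℓ : Plane) ρ
    linarith
  refine ⟨?_, hR ℓ hRℓ, fun ρ hρ => ?_⟩
  · ext ρ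
    simp only [interactionRange, Set.mem_ofPred_eq, zero_add]
    refine and_congr_right fun _ => and_congr_right fun h2 => ?_
    rw [hfar _ (hadd ρ h2)]
    refine ⟨fun h => ?_, fun h => hneg _ hℓh _ h⟩
    have := homLattice_sub_mem h hℓh
    rwa [add_sub_cancel_left] at this
  · obtain ⟨-, h2, h3⟩ := hρ
    rw [zero_add] at h3
    have h4 := hadd (-ρ) (by rwa [norm_neg])
    rw [← sub_eq_add_neg] at h4
    exact (hfar _ h4).2 (homLattice_sub_mem hℓh h3)

/-- The type of a stencil depends on the site, so potentials at different sites can be compared only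
after their index sets are identified. Quantifying `Q` over the index set makes substitution
possible. -/
theorem transport_potential (Q : ∀ (S : Set Plane) [Fintype S], ((S → Plane) → ℝ) → Prop)
    {S S' : Set Plane} [iS : Fintype S] [iS' : Fintype S'] (h : S = S') {f : (S → Plane) → ℝ}
    {f' : (S' → Plane) → ℝ} (hff : ∀ g : Plane → Plane, f (fun ρ => g ρ) = f' fun ρ => g ρ)
    (hQ : Q S f) : Q S' f' := by
  classical
  subst h
  obtain rfl := Subsingleton.elim iS iS'
  have : f = f' := by
    funext g
    have := hff fun x => if h : x ∈ S then g ⟨x, h⟩ else 0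
    simpa using this
  rwa [← this]

/-- A property of the site potentials that depends monotonically on a constant holds with a
constant that does not depend on the site. -/
theorem exists_uniform (Q : ∀ (S : Set Plane) [Fintype S], ((S → Plane) → ℝ) → ℝ → Prop)
    (hmono : ∀ (S : Set Plane) [Fintype S] (f : (S → Plane) → ℝ) (C C' : ℝ), C ≤ C' →
      Q S f C → Q S f C')
    (hex : ∀ ℓ : L.sites, ∃ C, Q (L.range P.rcut ℓ) (P.V ℓ) C) :
    ∃ C, ∀ ℓ : L.sites, Q (L.range P.rcut ℓ) (P.V ℓ) C := by
  classical
  obtain ⟨R, hR⟩ := P.exists_far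
  choose c hc using hex
  have hfin : {ℓ : L.sites | ‖(ℓ : Plane)‖ ≤ R}.Finite := by
    refine Set.Finite.of_finite_image ((L.inter_ball_finite 0 R).subset ?_)
      (Subtype.val_injective.injOn)
    rintro _ ⟨m, hm, rfl⟩
    exact ⟨m.2, by simpa using hm⟩
  obtain ⟨C₁, hC₁⟩ := (hfin.image c).bddAbove
  -- The finitely many near sites have a largest constant; all far sites share the constant of one
  -- representative `ℓ₀`.
  by_cases hfar : ∃ ℓ₀ : L.sites, R < ‖(ℓ₀ : Plane)‖
  · obtain ⟨ℓ₀, hℓ₀⟩ := hfar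
    refine ⟨max C₁ (c ℓ₀), fun ℓ => ?_⟩
    by_cases hℓ : ‖(ℓ : Plane)‖ ≤ R
    · exact hmono _ _ _ _ ((hC₁ ⟨ℓ, hℓ, rfl⟩).trans (le_max_left _ _)) (hc ℓ)
    · have h1 := hR ℓ (not_le.1 hℓ)
      have h0 := hR ℓ₀ hℓ₀
      exact transport_potential (fun S _ f => Q S f (max C₁ (c ℓ₀))) (h0.1.trans h1.1.symm)
        (fun g => (h0.2.1 g).trans (h1.2.1 g).symm) (hmono _ _ _ _ (le_max_right _ _) (hc ℓ₀))
  · push Not at hfar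
    exact ⟨C₁, fun ℓ => hmono _ _ _ _ (hC₁ ⟨ℓ, hfar ℓ, rfl⟩) (hc ℓ)⟩

theorem contDiff_sub_linear {E : Type*} [NormedAddCommGroup E] [NormedSpace ℝ E] {f : E → ℝ}
    (hf : ContDiff ℝ 2 f) : ContDiff ℝ 2 fun g => f g - fderiv ℝ f 0 g :=
  hf.sub (fderiv ℝ f 0).contDiff

theorem exists_taylorBound_V2 (M : ℝ) : ∃ C, 0 ≤ C ∧ ∀ ℓ, TaylorBound (P.V2 ℓ) M C := by
  obtain ⟨C, hC⟩ := P.exists_uniform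
    (fun S _ f C => TaylorBound (fun g => f g - fderiv ℝ f 0 g) M (max C 0))
    (fun S _ f C C' h hQ g k hg hk => by
      have hm : max C 0 ≤ max C' 0 := max_le_max_right 0 h
      obtain ⟨h1, h2, h3⟩ := hQ g k hg hk
      exact ⟨h1.trans (by gcongr), h2.trans (by gcongr), h3.trans (by gcongr)⟩)
    (fun ℓ => by
      obtain ⟨C, hC⟩ := exists_taylorBound (contDiff_sub_linear (P.contDiff ℓ)) M
      refine ⟨C, fun g k hg hk => ?_⟩
      have hm : C ≤ max C 0 := le_max_left _ _
      obtain ⟨h1, h2, h3⟩ := hC g k hg hk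
      exact ⟨h1.trans (by gcongr), h2.trans (by gcongr), h3.trans (by gcongr)⟩)
  exact ⟨max C 0, le_max_right _ _, hC⟩

theorem exists_hessianBound_V2 (M : ℝ) {ε : ℝ} (hε : 0 < ε) :
    ∃ δ > 0, ∀ ℓ, HessianBound (P.V2 ℓ) M ε δ := by
  have hpos : ∀ C : ℝ, 0 < max C 1 := fun C => one_pos.trans_le (le_max_right _ _)
  obtain ⟨C, hC⟩ := P.exists_uniform
    -- A smaller `δ` weakens the bound, so the inverse makes it monotone in the parameter, and the
    -- maximum keeps `δ` positive.
    (fun S _ f C => HessianBound (fun g => f g - fderiv ℝ f 0 g) M ε (max C 1)⁻¹)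
    (fun S _ f C C' h hQ g k hg hk => hQ g k hg (hk.trans (by
      have := hpos C
      gcongr)))
    (fun ℓ => by
      obtain ⟨δ, hδ, hH⟩ := exists_hessianBound (contDiff_sub_linear (P.contDiff ℓ)) M hε
      refine ⟨δ⁻¹, fun g k hg hk => hH g k hg (hk.trans ?_)⟩
      exact (inv_anti₀ (inv_pos.2 hδ) (le_max_left _ _)).trans_eq (inv_inv δ))
  exact ⟨(max C 1)⁻¹, inv_pos.2 (hpos C), hC⟩

theorem V2_zero (ℓ : L.sites) : P.V2 ℓ 0 = 0 := by
  simp [V2, P.zero]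

/-- The renormalised potentials vanish to second order, so square summability of the stencils
suffices for the energy series to converge. -/
theorem fderiv_V2_zero (ℓ : L.sites) : fderiv ℝ (P.V2 ℓ) 0 = 0 := by
  have h : P.V2 ℓ = fun g => P.V ℓ g - fderiv ℝ (P.V ℓ) 0 g := rfl
  rw [h, fderiv_fun_sub ((P.contDiff ℓ).differentiable (by norm_num) 0)
    (fderiv ℝ (P.V ℓ) 0).differentiableAt, ContinuousLinearMap.fderiv, sub_self]

/-! ### The reference forces -/

theorem D_add (u v : L.sites → Plane) (ℓ : L.sites) : P.D (u + v) ℓ = P.D u ℓ + P.D v ℓ := by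
  funext ρ; simp [DefectLattice.D]; abel

theorem D_smul (c : ℝ) (u : L.sites → Plane) (ℓ : L.sites) : P.D (c • u) ℓ = c • P.D u ℓ := by
  funext ρ; simp [DefectLattice.D, smul_sub]

theorem D_const (c : Plane) (ℓ : L.sites) : P.D (fun _ => c) ℓ = 0 := by
  funext ρ; simp [DefectLattice.D]

/-- The difference stencil as a linear map. -/
def DLinear (ℓ : L.sites) : (L.sites → Plane) →ₗ[ℝ] (L.range P.rcut ℓ → Plane) where
  toFun u := P.D u ℓ
  map_add' u v := P.D_add u v ℓ
  map_smul' c u := P.D_smul c u ℓ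

/-- The displacement of a single site as a linear map. -/
def bumpLinear (ℓ : L.sites) : Plane →ₗ[ℝ] (L.sites → Plane) where
  toFun := bump ℓ
  map_add' := by intro a b; funext m; by_cases h : m = ℓ <;> simp [bump, h]
  map_smul' := by intro a b; funext m; by_cases h : m = ℓ <;> simp [bump, h]

theorem inner_refForce (ℓ : L.sites) (N : Finset L.sites)
    (hN : ∀ m ∉ N, ∀ a, P.D (bump ℓ a) m = 0) (a : Plane) :
    inner ℝ (P.refForce ℓ) a = ∑ m ∈ N, fderiv ℝ (P.V m) 0 (P.D (bump ℓ a) m) := by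
  have h1 : (fun a => P.formalEnergy (bump ℓ a)) =
      fun a => ∑ m ∈ N, P.V m ((P.DLinear m ∘ₗ bumpLinear ℓ).toContinuousLinearMap a) := by
    funext a
    refine finsum_eq_sum_of_support_subset _ fun m hm => ?_
    by_contra h
    refine hm ?_
    change P.V m (P.D (bump ℓ a) m) = 0
    rw [hN m h, P.zero]
  have h2 : HasFDerivAt
      (fun a => ∑ m ∈ N, P.V m ((P.DLinear m ∘ₗ bumpLinear ℓ).toContinuousLinearMap a))
      (∑ m ∈ N, (fderiv ℝ (P.V m) 0).comp (P.DLinear m ∘ₗ bumpLinear ℓ).toContinuousLinearMap)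
      0 := by
    refine HasFDerivAt.fun_sum fun m _ => ?_
    refine HasFDerivAt.comp (g := P.V m) 0 ?_ (ContinuousLinearMap.hasFDerivAt _)
    rw [map_zero]
    exact ((P.contDiff m).differentiable (by norm_num) 0).hasFDerivAt
  rw [SitePotential.refForce, gradient, InnerProductSpace.toDual_symm_apply, h1, h2.fderiv]
  simp
  rfl

theorem finite_norm_le (L : DefectLattice) (R : ℝ) :
    {ℓ : L.sites | ‖(ℓ : Plane)‖ ≤ R}.Finite := by
  refine Set.Finite.of_finite_image ((L.inter_ball_finite 0 R).subset ?_)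
    (Subtype.val_injective.injOn)
  rintro _ ⟨m, hm, rfl⟩
  exact ⟨m.2, by simpa using hm⟩

/-- The reference forces vanish far from the defect. -/
theorem finite_refForce : {ℓ : L.sites | P.refForce ℓ ≠ 0}.Finite := by
  classical
  obtain ⟨R, hR⟩ := P.exists_far
  refine (finite_norm_le L (R + P.rcut)).subset fun ℓ hℓ => ?_
  by_contra hnot
  have hfar : R + P.rcut < ‖(ℓ : Plane)‖ := not_le.1 hnot
  refine hℓ ?_
  have hrc := P.rcut_pos
  have hfℓ := hR ℓ (by linarith)
  -- These are the sites other than `ℓ` whose stencil reaches `ℓ`. All are far from the defect, so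
  -- they have the same linearised potential `Λ`.
  let nb : L.homRange P.rcut → L.sites := fun ρ => ⟨ℓ - ρ, hfℓ.2.2 ρ ρ.2⟩
  have hnbfar : ∀ ρ, R < ‖(nb ρ : Plane)‖ := fun ρ => by
    have h1 := norm_sub_norm_le (ℓ : Plane) ρ
    have h2 := ρ.2.2.1
    change R < ‖(ℓ : Plane) - ρ‖
    linarith
  have hnb_inj : Function.Injective nb := by
    intro ρ ρ' h
    have : (ℓ : Plane) - ρ = ℓ - ρ' := congrArg (fun m : L.sites => (m : Plane)) h
    exact Subtype.ext (sub_right_injective this)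
  have hnb_ne : ∀ ρ, nb ρ ≠ ℓ := fun ρ h => by
    have h1 : (ℓ : Plane) - ρ = ℓ := congrArg (fun m : L.sites => (m : Plane)) h
    have h2 := ρ.2.1
    rw [sub_eq_self.1 h1, norm_zero] at h2
    exact lt_irrefl _ h2
  let N : Finset L.sites := insert ℓ (Finset.univ.image nb)
  have hN : ∀ m ∉ N, ∀ a, P.D (bump ℓ a) m = 0 := by
    intro m hm a
    have h1 : m ≠ ℓ := fun h => hm (by simp [N, h])
    funext ρ
    have h2 : (⟨m + ρ, ρ.2.2.2⟩ : L.sites) ≠ ℓ := by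
      intro h
      have h3 : (m : Plane) + ρ = ℓ := congrArg (fun m : L.sites => (m : Plane)) h
      have h4 : (m : Plane) = ℓ - ρ := eq_sub_of_add_eq h3
      have h5 : R < ‖(m : Plane)‖ := by
        have k1 := norm_sub_norm_le (ℓ : Plane) ρ
        have k2 := ρ.2.2.1
        rw [h4]
        linarith
      have h6 : (ρ : Plane) ∈ L.homRange P.rcut := by
        rw [← (hR m h5).1]; exact ρ.2
      refine hm (Finset.mem_insert_of_mem (Finset.mem_image.2 ⟨⟨ρ, h6⟩, Finset.mem_univ _, ?_⟩))
      exact Subtype.ext h4.symm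
    simp [DefectLattice.D, bump, h1, h2]
  let Λ : (Plane → Plane) → ℝ := fun g => fderiv ℝ (P.V ℓ) 0 (fun ρ => g ρ)
  have hΛ : ∀ m : L.sites, R < ‖(m : Plane)‖ → ∀ g : Plane → Plane,
      fderiv ℝ (P.V m) 0 (fun ρ => g ρ) = Λ g := by
    intro m hm
    have h0 := hR m hm
    exact transport_potential (fun S _ f => ∀ g : Plane → Plane,
      fderiv ℝ f 0 (fun ρ => g ρ) = Λ g) (hfℓ.1.trans h0.1.symm)
      (fun g => (hfℓ.2.1 g).trans (h0.2.1 g).symm) fun g => rfl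
  refine ext_inner_right ℝ fun a => ?_
  rw [inner_zero_left, P.inner_refForce ℓ N hN, Finset.sum_insert (by
    simp only [Finset.mem_image, Finset.mem_univ, true_and, not_exists]
    exact hnb_ne), Finset.sum_image fun _ _ _ _ h => hnb_inj h]
  have hself : P.D (bump ℓ a) ℓ = fun _ => -a := by
    funext ρ
    have h2 : (⟨ℓ + ρ, ρ.2.2.2⟩ : L.sites) ≠ ℓ := fun h => by
      have h1 : (ℓ : Plane) + ρ = ℓ := congrArg (fun m : L.sites => (m : Plane)) h
      have h2 := ρ.2.1
      rw [add_eq_left.1 h1, norm_zero] at h2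
      exact lt_irrefl _ h2
    simp [DefectLattice.D, bump, h2]
  let dirac : L.homRange P.rcut → Plane → Plane := fun σ x => if x = σ then a else 0
  have hother : ∀ σ : L.homRange P.rcut,
      P.D (bump ℓ a) (nb σ) = fun ρ : L.range P.rcut (nb σ) => dirac σ ρ := by
    intro σ
    funext ρ
    have h1 : (⟨nb σ + ρ, ρ.2.2.2⟩ : L.sites) = ℓ ↔ (ρ : Plane) = σ := by
      rw [Subtype.ext_iff]
      change (ℓ : Plane) - σ + ρ = ℓ ↔ _
      rw [sub_add_eq_add_sub, sub_eq_iff_eq_add, add_right_inj]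
    simp [DefectLattice.D, bump, hnb_ne σ, h1, dirac]
  have e1 : ∀ σ : L.homRange P.rcut, fderiv ℝ (P.V (nb σ)) 0 (P.D (bump ℓ a) (nb σ)) =
      Λ (dirac σ) := fun σ => by
    rw [hother σ]
    exact hΛ _ (hnbfar σ) _
  -- The site `ℓ` contributes `Λ` of the constant `-a`, and its neighbours contribute `Λ` of one
  -- unit stencil each, which add up to the constant `a`: the two cancel.
  rw [hself, Finset.sum_congr rfl fun σ _ => e1 σ]
  simp only [Λ, dirac]
  rw [← map_sum, ← map_add]
  convert map_zero (fderiv ℝ (P.V ℓ) 0)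
  funext ρ
  have hρ : (ρ : Plane) ∈ L.homRange P.rcut := by rw [← hfℓ.1]; exact ρ.2
  rw [Pi.add_apply, Finset.sum_apply, Finset.sum_eq_single ⟨ρ, hρ⟩]
  · simp
  · intro σ _ hσ
    rw [if_neg]
    intro h
    exact hσ (Subtype.ext h.symm)
  · intro h
    exact absurd (Finset.mem_univ _) h

/-- The linear part of the energy. -/
def refWork (u : L.sites → Plane) : ℝ := ∑ᶠ ℓ : L.sites, inner ℝ (P.refForce ℓ) (u ℓ)

theorem refWork_eq_sum {N : Finset L.sites} (hN : P.finite_refForce.toFinset ⊆ N)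
    (u : L.sites → Plane) : P.refWork u = ∑ ℓ ∈ N, inner ℝ (P.refForce ℓ) (u ℓ) := by
  refine finsum_eq_sum_of_support_subset _ fun ℓ hℓ => hN ?_
  rw [Set.Finite.mem_toFinset]
  intro h
  exact hℓ (by simp [h])

theorem refWork_add (u v : L.sites → Plane) : P.refWork (u + v) = P.refWork u + P.refWork v := by
  simp only [P.refWork_eq_sum subset_rfl, Pi.add_apply, inner_add_right, Finset.sum_add_distrib]

theorem refWork_smul (c : ℝ) (u : L.sites → Plane) : P.refWork (c • u) = c * P.refWork u := by
  simp only [P.refWork_eq_sum subset_rfl, Pi.smul_apply, inner_smul_right, Finset.mul_sum]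

end SitePotential

end

/-! ### Calculus of the energy on the space of finite energy -/

noncomputable section

open BackgroundMesh

theorem abs_tsum_le_tsum {ι : Type*} {f g : ι → ℝ} (hg : Summable g) (h : ∀ i, |f i| ≤ g i) :
    |∑' i, f i| ≤ ∑' i, g i :=
  tsum_of_norm_bounded (f := f) hg.hasSum h

variable {L : DefectLattice}

namespace SitePotential

variable (P : SitePotential L) {T : BackgroundMesh L}

/-! ### Square summability of the difference stencils -/

variable (T) in
-- A stencil has bounded range, so it is bounded by the oscillations of the triangles near its site,
-- and these overlap boundedly. The bound for sums also bounds every single stencil by the energy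
-- norm.
theorem exists_sum_norm_D_sq_le : ∃ C, 0 ≤ C ∧ ∀ v : L.sites → Plane, T.IsU12 v →
    ∀ S : Finset L.sites, ∑ ℓ ∈ S, ‖P.D v ℓ‖ ^ 2 ≤ C * T.normU12 v ^ 2 := by
  refine ⟨T.lip ^ 2 * P.rcut ^ 2 * (L.siteBound (P.rcut + T.diam) * T.oscConst), ?_,
    fun v hv S => ?_⟩
  · have := T.oscConst_nonneg
    positivity
  have h1 : ∀ ℓ ∈ S, ‖P.D v ℓ‖ ^ 2 ≤
      T.lip ^ 2 * P.rcut ^ 2 * ∑ t ∈ T.near ℓ P.rcut, osc t (T.interp v) := by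
    intro ℓ _
    have h0 : 0 ≤ T.lip ^ 2 * P.rcut ^ 2 * ∑ t ∈ T.near ℓ P.rcut, osc t (T.interp v) :=
      mul_nonneg (by positivity) (Finset.sum_nonneg fun t _ => osc_nonneg t _)
    refine (Real.le_sqrt (norm_nonneg _) h0).1 ?_
    refine (pi_norm_le_iff_of_nonneg (Real.sqrt_nonneg _)).2 fun ρ => ?_
    refine Real.le_sqrt_of_sq_le ?_
    have h2 := (T.isPL_interp v).norm_sub_le_of_dist_le (x := ℓ) (y := ℓ + ρ) (r := P.rcut)
      (by simpa [dist_eq_norm] using ρ.2.2.1)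
    have h3 : T.interp v (ℓ + ρ) = v ⟨ℓ + ρ, ρ.2.2.2⟩ := interp_site v ⟨ℓ + ρ, ρ.2.2.2⟩
    rw [h3, interp_site, norm_sub_rev] at h2
    exact h2
  refine (Finset.sum_le_sum h1).trans ?_
  rw [← Finset.mul_sum, mul_assoc _ _ (T.normU12 v ^ 2), mul_assoc _ _ (T.normU12 v ^ 2)]
  gcongr
  exact sum_near_osc_le hv S _ fun p J _ hJ => L.card_sites_le J hJ

variable (T) in
/-- The constant in the estimate of the difference stencils by the energy norm. -/
def stencilConst : ℝ := (P.exists_sum_norm_D_sq_le T).choose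

theorem stencilConst_nonneg : 0 ≤ P.stencilConst T :=
  (P.exists_sum_norm_D_sq_le T).choose_spec.1

variable {u v w : L.sites → Plane}

theorem summable_norm_D_sq (hv : T.IsU12 v) : Summable fun ℓ => ‖P.D v ℓ‖ ^ 2 :=
  summable_of_sum_le (fun _ => by positivity) ((P.exists_sum_norm_D_sq_le T).choose_spec.2 v hv)

theorem tsum_norm_D_sq_le (hv : T.IsU12 v) :
    ∑' ℓ, ‖P.D v ℓ‖ ^ 2 ≤ P.stencilConst T * T.normU12 v ^ 2 :=
  (P.summable_norm_D_sq hv).tsum_le_of_sum_le ((P.exists_sum_norm_D_sq_le T).choose_spec.2 v hv)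

theorem norm_D_le (hv : T.IsU12 v) (ℓ : L.sites) :
    ‖P.D v ℓ‖ ≤ √(P.stencilConst T) * T.normU12 v := by
  have h := (P.exists_sum_norm_D_sq_le T).choose_spec.2 v hv {ℓ}
  rw [Finset.sum_singleton] at h
  rw [← Real.sqrt_sq (T.normU12_nonneg v), ← Real.sqrt_mul P.stencilConst_nonneg]
  exact Real.le_sqrt_of_sq_le h

/-! ### The variations of the energy -/

/-- The first variation `⟨δE(u), v⟩`. -/
def energyDeriv (u v : L.sites → Plane) : ℝ :=
  (∑' ℓ : L.sites, fderiv ℝ (P.V2 ℓ) (P.D u ℓ) (P.D v ℓ)) + P.refWork v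

/-- The quadratic form `⟨δ²E(u) v, v⟩` as a sum over the sites. -/
def energyHessian (u v : L.sites → Plane) : ℝ :=
  ∑' ℓ : L.sites, fderiv ℝ (fderiv ℝ (P.V2 ℓ)) (P.D u ℓ) (P.D v ℓ) (P.D v ℓ)

theorem summable_V2 (hu : T.IsU12 u) : Summable fun ℓ => P.V2 ℓ (P.D u ℓ) := by
  set M := √(P.stencilConst T) * T.normU12 u
  have hM : 0 ≤ M := mul_nonneg (Real.sqrt_nonneg _) (T.normU12_nonneg u)
  obtain ⟨C, -, hC⟩ := P.exists_taylorBound_V2 M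
  refine Summable.of_norm_bounded ((P.summable_norm_D_sq hu).mul_left C) fun ℓ => ?_
  have := (hC ℓ 0 (P.D u ℓ) (by simpa using hM) (P.norm_D_le hu ℓ)).2.1
  rwa [zero_add, V2_zero, fderiv_V2_zero, zero_apply, sub_zero, sub_zero] at this

theorem summable_fderiv_V2 (hu : T.IsU12 u) (hv : T.IsU12 v) :
    Summable fun ℓ => fderiv ℝ (P.V2 ℓ) (P.D u ℓ) (P.D v ℓ) := by
  set M := √(P.stencilConst T) * T.normU12 u
  have hM : 0 ≤ M := mul_nonneg (Real.sqrt_nonneg _) (T.normU12_nonneg u)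
  obtain ⟨C, hC0, hC⟩ := P.exists_taylorBound_V2 M
  refine Summable.of_norm_bounded
    (((P.summable_norm_D_sq hu).add (P.summable_norm_D_sq hv)).mul_left C) fun ℓ => ?_
  have := (hC ℓ 0 (P.D u ℓ) (by simpa using hM) (P.norm_D_le hu ℓ)).1
  rw [zero_add, fderiv_V2_zero, sub_zero] at this
  calc _ ≤ ‖fderiv ℝ (P.V2 ℓ) (P.D u ℓ)‖ * ‖P.D v ℓ‖ := ContinuousLinearMap.le_opNorm _ _
    _ ≤ C * ‖P.D u ℓ‖ * ‖P.D v ℓ‖ := by gcongr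
    _ = C * (‖P.D u ℓ‖ * ‖P.D v ℓ‖) := mul_assoc _ _ _
    _ ≤ _ := by
      gcongr
      nlinarith [sq_nonneg (‖P.D u ℓ‖ - ‖P.D v ℓ‖), sq_nonneg (‖P.D u ℓ‖ + ‖P.D v ℓ‖)]

theorem summable_fderiv_fderiv_V2 (hu : T.IsU12 u) (hv : T.IsU12 v) :
    Summable fun ℓ => fderiv ℝ (fderiv ℝ (P.V2 ℓ)) (P.D u ℓ) (P.D v ℓ) (P.D v ℓ) := by
  obtain ⟨C, -, hC⟩ := P.exists_taylorBound_V2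
    (max (√(P.stencilConst T) * T.normU12 u) (√(P.stencilConst T) * T.normU12 v))
  exact Summable.of_norm_bounded ((P.summable_norm_D_sq hv).mul_left C) fun ℓ =>
    (hC ℓ _ _ ((P.norm_D_le hu ℓ).trans (le_max_left _ _))
      ((P.norm_D_le hv ℓ).trans (le_max_right _ _))).2.2

theorem energyDeriv_add (hu : T.IsU12 u) (hv : T.IsU12 v) (hw : T.IsU12 w) :
    P.energyDeriv u (v + w) = P.energyDeriv u v + P.energyDeriv u w := by
  simp only [energyDeriv, D_add, map_add, refWork_add]
  rw [(P.summable_fderiv_V2 hu hv).tsum_add (P.summable_fderiv_V2 hu hw)]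
  ring

theorem energyDeriv_smul (u v : L.sites → Plane) (c : ℝ) :
    P.energyDeriv u (c • v) = c * P.energyDeriv u v := by
  simp only [energyDeriv, D_smul, map_smul, refWork_smul, smul_eq_mul, tsum_mul_left]
  ring

theorem energyDeriv_const (u : L.sites → Plane) (c : Plane) :
    P.energyDeriv u (fun _ => c) = P.refWork fun _ => c := by
  simp only [energyDeriv, D_const, map_zero, tsum_zero, zero_add]

theorem energyHessian_smul (u v : L.sites → Plane) (c : ℝ) :
    P.energyHessian u (c • v) = c ^ 2 * P.energyHessian u v := by
  simp only [energyHessian, D_smul, map_smul, smul_apply, smul_eq_mul, tsum_mul_left]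
  ring

/-- The site-wise Taylor remainders are summed with a common constant; the linear part of the energy
cancels exactly. -/
theorem exists_abs_energy_sub_le (hu : T.IsU12 u) : ∃ C, 0 ≤ C ∧ ∀ v, T.IsU12 v →
    T.normU12 v ≤ 1 →
      |P.energy (u + v) - P.energy u - P.energyDeriv u v| ≤ C * T.normU12 v ^ 2 := by
  obtain ⟨C, hC0, hC⟩ := P.exists_taylorBound_V2
    (max (√(P.stencilConst T) * T.normU12 u) (√(P.stencilConst T)))
  refine ⟨C * P.stencilConst T, mul_nonneg hC0 P.stencilConst_nonneg, fun v hv hv1 => ?_⟩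
  have e : P.energy (u + v) - P.energy u - P.energyDeriv u v = ∑' ℓ, (P.V2 ℓ (P.D u ℓ + P.D v ℓ) -
      P.V2 ℓ (P.D u ℓ) - fderiv ℝ (P.V2 ℓ) (P.D u ℓ) (P.D v ℓ)) := by
    have h1 := P.summable_V2 (hu.add hv)
    simp only [D_add] at h1
    rw [(h1.sub (P.summable_V2 hu)).tsum_sub (P.summable_fderiv_V2 hu hv),
      h1.tsum_sub (P.summable_V2 hu)]
    have h2 := P.refWork_add u v
    simp only [refWork] at h2
    simp only [energy, energyDeriv, refWork, D_add, h2]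
    ring
  rw [e, mul_assoc]
  refine (abs_tsum_le_tsum ((P.summable_norm_D_sq hv).mul_left C) fun ℓ => ?_).trans ?_
  · refine (hC ℓ _ _ ((P.norm_D_le hu ℓ).trans (le_max_left _ _))
      ((P.norm_D_le hv ℓ).trans ((mul_le_of_le_one_right (Real.sqrt_nonneg _) hv1).trans
        (le_max_right _ _)))).2.1
  · rw [tsum_mul_left]
    gcongr
    exact P.tsum_norm_D_sq_le hv

/-- A small energy norm makes all stencils small at once, so the uniform modulus of
`exists_hessianBound_V2` applies at every site and the errors sum in `ℓ²`. -/
theorem exists_abs_energyDeriv_sub_le (hu : T.IsU12 u) {ε : ℝ} (hε : 0 < ε) : ∃ δ > 0,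
    ∀ v, T.IsU12 v → T.normU12 v ≤ δ →
      |P.energyDeriv (u + v) v - P.energyDeriv u v - P.energyHessian u v| ≤
        ε * T.normU12 v ^ 2 := by
  have hs : 0 ≤ P.stencilConst T := P.stencilConst_nonneg
  obtain ⟨δ, hδ, hH⟩ := P.exists_hessianBound_V2 (√(P.stencilConst T) * T.normU12 u)
    (show 0 < ε / (P.stencilConst T + 1) by positivity)
  refine ⟨δ / (√(P.stencilConst T) + 1), by positivity, fun v hv hvδ => ?_⟩
  have hD : ∀ ℓ, ‖P.D v ℓ‖ ≤ δ := fun ℓ => by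
    refine (P.norm_D_le hv ℓ).trans ?_
    rw [le_div_iff₀ (by positivity)] at hvδ
    linarith [T.normU12_nonneg v]
  have e : P.energyDeriv (u + v) v - P.energyDeriv u v - P.energyHessian u v =
      ∑' ℓ, ((fderiv ℝ (P.V2 ℓ) (P.D u ℓ + P.D v ℓ) - fderiv ℝ (P.V2 ℓ) (P.D u ℓ)) (P.D v ℓ) -
        fderiv ℝ (fderiv ℝ (P.V2 ℓ)) (P.D u ℓ) (P.D v ℓ) (P.D v ℓ)) := by
    have h1 := P.summable_fderiv_V2 (hu.add hv) hv
    simp only [D_add] at h1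
    simp only [sub_apply]
    rw [(h1.sub (P.summable_fderiv_V2 hu hv)).tsum_sub (P.summable_fderiv_fderiv_V2 hu hv),
      h1.tsum_sub (P.summable_fderiv_V2 hu hv)]
    simp only [energyDeriv, energyHessian, D_add]
    ring
  rw [e]
  refine (abs_tsum_le_tsum
    ((P.summable_norm_D_sq hv).mul_left (ε / (P.stencilConst T + 1))) fun ℓ =>
      hH ℓ _ _ (P.norm_D_le hu ℓ) (hD ℓ)).trans ?_
  rw [tsum_mul_left]
  have h2 := P.tsum_norm_D_sq_le hv
  calc _ ≤ ε / (P.stencilConst T + 1) * ((P.stencilConst T + 1) * T.normU12 v ^ 2) := by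
        gcongr
        nlinarith [sq_nonneg (T.normU12 v)]
    _ = _ := by field_simp

/-! ### Derivatives along lines -/

theorem eventually_abs_mul_le (n : ℝ) {δ : ℝ} (hδ : 0 < δ) : ∀ᶠ k : ℝ in 𝓝 0, |k| * n < δ := by
  have h : Continuous fun k : ℝ => |k| * n := by fun_prop
  exact (h.tendsto' 0 0 (by simp)).eventually (gt_mem_nhds hδ)

theorem hasDerivAt_energy (hu : T.IsU12 u) (hv : T.IsU12 v) (s : ℝ) :
    HasDerivAt (fun s : ℝ => P.energy (u + s • v)) (P.energyDeriv (u + s • v) v) s := by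
  obtain ⟨C, -, hC⟩ := P.exists_abs_energy_sub_le (hu.add (hv.smul s))
  rw [hasDerivAt_iff_hasFDerivAt]
  refine hasFDerivAt_of_quadratic (C := C * T.normU12 v ^ 2) ?_
  filter_upwards [eventually_abs_mul_le (T.normU12 v) one_pos] with k hk
  have := hC (k • v) (hv.smul k) (by rw [normU12_smul]; exact hk.le)
  rw [energyDeriv_smul, normU12_smul, add_assoc, ← add_smul] at this
  calc _ = _ := by simp
    _ ≤ _ := this
    _ = _ := by rw [Real.norm_eq_abs]; ring

/-- This carries strong stability, a statement about derivatives along lines, over to the quadratic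
form that occurs in the expansion of the first variation. -/
theorem secondVariation_eq (hu : T.IsU12 u) (hv : T.IsU12 v) :
    P.secondVariation u v = P.energyHessian u v := by
  have h1 : deriv (fun s : ℝ => P.energy (u + s • v)) = fun s => P.energyDeriv (u + s • v) v :=
    funext fun s => (P.hasDerivAt_energy hu hv s).deriv
  rw [secondVariation, iteratedDeriv_succ, iteratedDeriv_one, h1]
  refine HasDerivAt.deriv ?_
  rw [hasDerivAt_iff_isLittleO_nhds_zero, Asymptotics.isLittleO_iff]
  intro c hc
  obtain ⟨δ, hδ, h⟩ := P.exists_abs_energyDeriv_sub_le hu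
    (show 0 < c / (T.normU12 v ^ 2 + 1) by positivity)
  filter_upwards [eventually_abs_mul_le (T.normU12 v) hδ] with k hk
  have h2 := h (k • v) (hv.smul k) (by rw [normU12_smul]; exact hk.le)
  rw [energyDeriv_smul, energyDeriv_smul, energyHessian_smul, normU12_smul] at h2
  rw [zero_add, zero_smul, add_zero, Real.norm_eq_abs, Real.norm_eq_abs, smul_eq_mul]
  rcases eq_or_ne k 0 with rfl | hk0
  · simp
  have hkp : 0 < |k| := abs_pos.2 hk0
  have e : k * P.energyDeriv (u + k • v) v - k * P.energyDeriv u v - k ^ 2 * P.energyHessian u v =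
      k * (P.energyDeriv (u + k • v) v - P.energyDeriv u v - k * P.energyHessian u v) := by ring
  rw [e, abs_mul] at h2
  refine le_of_mul_le_mul_left (h2.trans ?_) hkp
  calc c / (T.normU12 v ^ 2 + 1) * (|k| * T.normU12 v) ^ 2
      = |k| * |k| * (c * (T.normU12 v ^ 2 / (T.normU12 v ^ 2 + 1))) := by ring
    _ ≤ |k| * |k| * (c * 1) := by
        gcongr
        exact div_le_one_of_le₀ (by linarith) (by positivity)
    _ = _ := by ring

theorem IsLocalMinimiser.energyDeriv_eq_zero {P : SitePotential L} (h : P.IsLocalMinimiser T u)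
    (hv : T.IsU12 v) : P.energyDeriv u v = 0 := by
  obtain ⟨hu, ε, hε, hmin⟩ := h
  have h1 := P.hasDerivAt_energy hu hv 0
  rw [zero_smul, add_zero] at h1
  refine IsLocalMin.hasDerivAt_eq_zero ?_ h1
  filter_upwards [eventually_abs_mul_le (T.normU12 v) hε] with k hk
  rw [zero_smul, add_zero]
  refine hmin _ (hu.add (hv.smul k)) ?_
  rwa [add_sub_cancel_left, normU12_smul]

/-! ### The residual forces -/

variable (T) in
theorem isU12_bump (ℓ : L.sites) (a : Plane) : T.IsU12 (bump ℓ a) :=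
  isU12_of_support (S := {ℓ}) fun m hm => by
    simp [bump, show m ≠ ℓ by simpa using hm]

variable (T) in
theorem normU12_bump_sq_le (ℓ : L.sites) (a : Plane) :
    T.normU12 (bump ℓ a) ^ 2 ≤ T.normConst * (12 * T.nearBound 0) * ‖a‖ ^ 2 := by
  have := T.normU12_sq_le_sum (u := bump ℓ a) (S := {ℓ}) fun m hm => by
    simp [bump, show m ≠ ℓ by simpa using hm]
  simpa [bump] using this

theorem inner_force (hw : T.IsU12 w) (ℓ : L.sites) (a : Plane) :
    inner ℝ (P.force w ℓ) a = P.energyDeriv w (bump ℓ a) := by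
  obtain ⟨C, hC0, hC⟩ := P.exists_abs_energy_sub_le hw
  let A : Plane →ₗ[ℝ] ℝ :=
    { toFun := fun a => P.energyDeriv w (bump ℓ a)
      map_add' := fun a b => by
        have : bump ℓ (a + b) = bump ℓ a + bump ℓ b := (bumpLinear ℓ).map_add a b
        rw [this, P.energyDeriv_add hw (isU12_bump T ℓ a) (isU12_bump T ℓ b)]
      map_smul' := fun c a => by
        have : bump ℓ (c • a) = c • bump ℓ a := (bumpLinear ℓ).map_smul c a
        rw [this, energyDeriv_smul]
        rfl }
  set B := T.normConst * (12 * T.nearBound 0) with hB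
  have h : HasFDerivAt (fun a => P.energy (w + bump ℓ a)) A.toContinuousLinearMap 0 := by
    refine hasFDerivAt_of_quadratic (C := C * B) ?_
    have hcont : Continuous fun k : Plane => B * ‖k‖ ^ 2 := by fun_prop
    filter_upwards [(hcont.tendsto' 0 0 (by simp)).eventually (gt_mem_nhds one_pos)] with k hk
    have h1 := normU12_bump_sq_le T ℓ k
    have h2 : T.normU12 (bump ℓ k) ≤ 1 := by
      rw [← abs_of_nonneg (T.normU12_nonneg (bump ℓ k)), ← sq_le_one_iff_abs_le_one]
      exact h1.trans hk.le
    have h0 : bump ℓ (0 : Plane) = 0 := (bumpLinear ℓ).map_zero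
    rw [zero_add, h0, add_zero]
    refine (hC _ (isU12_bump T ℓ k) h2).trans ?_
    rw [mul_assoc]
    gcongr
  rw [force, gradient, InnerProductSpace.toDual_symm_apply, h.fderiv]
  rfl

theorem energyDeriv_sum_bump (hw : T.IsU12 w) (v : L.sites → Plane) (Q : Finset L.sites) :
    T.IsU12 (∑ ℓ ∈ Q, bump ℓ (v ℓ)) ∧
      P.energyDeriv w (∑ ℓ ∈ Q, bump ℓ (v ℓ)) = ∑ ℓ ∈ Q, inner ℝ (P.force w ℓ) (v ℓ) := by
  classical
  induction Q using Finset.induction_on with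
  | empty =>
    refine ⟨isU12_const T 0, ?_⟩
    have := P.energyDeriv_smul w 0 0
    rwa [zero_smul, zero_mul] at this
  | insert ℓ Q hℓ ih =>
    rw [Finset.sum_insert hℓ, Finset.sum_insert hℓ]
    refine ⟨(isU12_bump T ℓ _).add ih.1, ?_⟩
    rw [P.energyDeriv_add hw (isU12_bump T ℓ _) ih.1, ih.2, P.inner_force hw]

/-- For displacements with finite support the first variation is represented by the forces. -/
theorem energyDeriv_eq_sum_force {S₀ S : Finset L.sites} (hw : ∀ ℓ ∉ S₀, w ℓ = 0)
    (hS : ∀ ℓ ∉ S, P.force w ℓ = 0) (hv : T.IsU12 v) :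
    P.energyDeriv w v = ∑ ℓ ∈ S, inner ℝ (P.force w ℓ) (v ℓ) := by
  classical
  have hwU : T.IsU12 w := isU12_of_support hw
  obtain ⟨N, hN⟩ := P.finite_D_ne_zero S₀
  -- The set contains every site that the first variation at `w` can see: outside `N` the stencil of
  -- `w` is zero and the derivative of the renormalised potential vanishes there. Hence `v` may be
  -- replaced by its part on `Q`, even if `v` itself has infinite support.
  let Q : Finset L.sites := S ∪ P.finite_refForce.toFinset ∪
    N.biUnion fun m => insert m (Finset.univ.image fun ρ : L.range P.rcut m => ⟨m + ρ, ρ.2.2.2⟩)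
  set v' := ∑ ℓ ∈ Q, bump ℓ (v ℓ) with hv'
  obtain ⟨hv'U, hv'E⟩ := P.energyDeriv_sum_bump hwU v Q
  have hQ : ∀ m ∈ Q, (v - v') m = 0 := by
    intro m hm
    rw [Pi.sub_apply, hv', Finset.sum_apply, Finset.sum_eq_single_of_mem m hm]
    · simp [bump]
    · intro b _ hb
      simp [bump, hb.symm]
  have hzero : P.energyDeriv w (v - v') = 0 := by
    rw [energyDeriv, P.refWork_eq_sum subset_rfl, Finset.sum_eq_zero, add_zero]
    · convert tsum_zero with m
      by_cases hm : m ∈ N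
      · have hsub : insert m (Finset.univ.image fun ρ : L.range P.rcut m =>
            (⟨m + ρ, ρ.2.2.2⟩ : L.sites)) ⊆ Q := fun x hx =>
          Finset.mem_union_right _ (Finset.mem_biUnion.2 ⟨m, hm, hx⟩)
        have : P.D (v - v') m = 0 := by
          funext ρ
          change (v - v') ⟨m + ρ, ρ.2.2.2⟩ - (v - v') m = 0
          rw [hQ m (hsub (Finset.mem_insert_self _ _)), hQ _ (hsub (Finset.mem_insert_of_mem
            (Finset.mem_image_of_mem _ (Finset.mem_univ ρ)))), sub_zero]
        rw [this, map_zero]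
      · rw [hN w hw m hm, fderiv_V2_zero, zero_apply]
    · intro ℓ hℓ
      rw [hQ ℓ (Finset.mem_union_left _ (Finset.mem_union_right _ hℓ)), inner_zero_right]
  have h1 := P.energyDeriv_add hwU (hv.sub hv'U) hv'U
  rw [sub_add_cancel, hzero, zero_add, hv'E] at h1
  rw [h1]
  refine (Finset.sum_subset (fun ℓ hℓ => Finset.mem_union_left _ (Finset.mem_union_left _ hℓ))
    fun ℓ _ hℓ => ?_).symm
  rw [hS ℓ hℓ, inner_zero_left]

/-- The forces are in equilibrium. -/
theorem IsLocalMinimiser.sum_force_eq_zero {P : SitePotential L} (h : P.IsLocalMinimiser T u)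
    {S₀ S : Finset L.sites} (hw : ∀ ℓ ∉ S₀, w ℓ = 0) (hS : ∀ ℓ ∉ S, P.force w ℓ = 0) :
    ∑ ℓ ∈ S, P.force w ℓ = 0 := by
  refine ext_inner_right ℝ fun c => ?_
  have hc := isU12_const T c
  -- Constants have no stencil, so the first variation in their direction is the same at `w` as at
  -- the minimiser, where it is zero.
  rw [inner_zero_left, sum_inner, ← P.energyDeriv_eq_sum_force (v := fun _ => c) hw hS hc,
    energyDeriv_const, ← P.energyDeriv_const u, h.energyDeriv_eq_zero hc]

/-- Near a strongly stable minimiser the error is controlled by the residual. -/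
theorem IsLocalMinimiser.exists_coercive {P : SitePotential L} (h : P.IsLocalMinimiser T u)
    (hs : P.IsStronglyStable T u) : ∃ c > 0, ∃ C, 0 ≤ C ∧ ∃ δ > 0, ∀ e, T.IsU12 e →
      T.normU12 e ≤ δ → c * T.normU12 e ^ 2 ≤ P.energyDeriv (u + e) e ∧
        |P.energy (u + e) - P.energy u| ≤ C * T.normU12 e ^ 2 := by
  obtain ⟨γ, hγ, hstab⟩ := hs
  -- Half of the stability constant is spent on the nonlinearity.
  obtain ⟨δ, hδ, hH⟩ := P.exists_abs_energyDeriv_sub_le h.1 (half_pos hγ)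
  obtain ⟨C, hC0, hC⟩ := P.exists_abs_energy_sub_le h.1
  refine ⟨γ / 2, half_pos hγ, C, hC0, min δ 1, lt_min hδ one_pos, fun e he heδ => ⟨?_, ?_⟩⟩
  · have h1 := (abs_le.1 (hH e he (heδ.trans (min_le_left _ _)))).1
    have h2 := hstab e he
    rw [P.secondVariation_eq h.1 he] at h2
    rw [h.energyDeriv_eq_zero he] at h1
    linarith
  · have h1 := hC e he (heδ.trans (min_le_right _ _))
    rwa [h.energyDeriv_eq_zero he, sub_zero] at h1

end SitePotential

/-! ### Blended solutions and their rates -/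

theorem Discretization.eq_zero_of_mem_space {T : BackgroundMesh L} {d : Discretization T}
    {m : BlendedMethod} {u : Plane → Plane} (hu : u ∈ d.space m) {x : Plane} (hx : x ∉ d.domain) :
    u x = 0 := by
  cases m with
  | bqce => exact hu.2.2 x hx
  | bgfcP1 => exact hu.2.2 x hx
  | bgfcP2 Q => exact hu.2.2.2 x hx

theorem BlendedMethod.rate_le (m : BlendedMethod) : m.rate ≤ -(1 / 2) := by
  cases m <;> norm_num [BlendedMethod.rate]

/-- The slowest rate, `-1/2`, decides for all methods. The comparison of exponents needs a base of
at least one, hence the `max N 1`. -/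
theorem BlendedMethod.exists_forall_mul_rpow_rate_le (K : ℝ) (hK : 0 < K) {δ : ℝ} (hδ : 0 < δ) :
    ∃ N₀ : ℕ, ∀ (m : BlendedMethod) (n : ℕ), N₀ ≤ n → K * (n : ℝ) ^ m.rate ≤ δ := by
  have h1 : Tendsto (fun n : ℕ => K * (n : ℝ) ^ (-(1 / 2) : ℝ)) atTop (𝓝 0) := by
    have := ((tendsto_rpow_neg_atTop (show (0 : ℝ) < 1 / 2 by norm_num)).comp
      tendsto_natCast_atTop_atTop).const_mul K
    simpa using this
  obtain ⟨N, hN⟩ := eventually_atTop.1 (h1.eventually (gt_mem_nhds hδ))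
  refine ⟨max N 1, fun m n hn => ?_⟩
  refine le_trans ?_ (hN n ((le_max_left _ _).trans hn)).le
  have hn1 : (1 : ℝ) ≤ n := by exact_mod_cast (le_max_right _ _).trans hn
  have := Real.rpow_le_rpow_of_exponent_le hn1 m.rate_le
  gcongr

end

/-! ### The energy error estimate -/

theorem theorem3p4 (L : DefectLattice) (P : SitePotential L) (T : BackgroundMesh L)
    (ua : L.sites → Plane) (hmin : P.IsLocalMinimiser T ua) (hstab : P.IsStronglyStable T ua) :
    ∃ CE : ℝ, 0 < CE ∧ ∀ K : ℝ, 0 < K → ∃ N₀ : ℕ,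
      ∀ (d : Discretization T) (m : BlendedMethod) (uh : Plane → Plane) (Ω : CompDomain T),
        d.IsSolution P m uh →
        T.normU12 (ua - Discretization.restrict uh) ≤ K * (d.dof : ℝ) ^ m.rate →
        N₀ ≤ d.dof →
        d.domain ⊆ Ω.carrier →
        (∀ ℓ : L.sites, (ℓ : Plane) ∉ Ω.carrier →
          P.force (Discretization.restrict uh) ℓ = 0) →
        |P.energy ua - d.blendedEnergy P m uh| ≤
          CE * (Ω.eta P (Discretization.restrict uh) ^ 2 +
            Ω.rhoTr P (Discretization.restrict uh) ^ 2) + |d.muE P m uh| := by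
  obtain ⟨c, hc, C, hC0, δ, hδ, hcoer⟩ := hmin.exists_coercive hstab
  obtain ⟨C', hC'0, hres⟩ := CompDomain.residual_le P T
  -- The factor two comes from `(η + ρ)² ≤ 2 (η² + ρ²)`; the summand one only ensures positivity.
  -- The constant is fixed before `K`, which enters only through `N₀`.
  refine ⟨2 * C * (C' / c) ^ 2 + 1, by positivity, fun K hK => ?_⟩
  obtain ⟨N₀, hN₀⟩ := BlendedMethod.exists_forall_mul_rpow_rate_le K hK hδ
  refine ⟨N₀, fun d m uh Ω hsol hcons hdof hdom hforce => ?_⟩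
  set w : L.sites → Plane := Discretization.restrict uh
  have hw : ∀ ℓ ∉ Ω.sites, w ℓ = 0 := fun ℓ hℓ =>
    Discretization.eq_zero_of_mem_space hsol.1 fun h => hℓ (Ω.mem_sites.2 (hdom h))
  have hF : ∀ ℓ ∉ Ω.sites, P.force w ℓ = 0 := fun ℓ hℓ =>
    hforce ℓ fun h => hℓ (Ω.mem_sites.2 h)
  have hwU : T.IsU12 w := BackgroundMesh.isU12_of_support hw
  have heU : T.IsU12 (w - ua) := hwU.sub hmin.1
  have hsymm : T.normU12 (w - ua) = T.normU12 (ua - w) := by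
    have := BackgroundMesh.normU12_smul (T := T) (ua - w) (-1)
    rwa [neg_one_smul, neg_sub, abs_neg, abs_one, one_mul] at this
  obtain ⟨h1, h2⟩ := hcoer (w - ua) heU
    (hsymm.trans_le (hcons.trans (hN₀ m d.dof hdof)))
  rw [add_sub_cancel] at h1 h2
  have h3 := hres Ω w hforce (hmin.sum_force_eq_zero hw hF) (w - ua) heU
  rw [← P.energyDeriv_eq_sum_force hw hF heU] at h3
  have hη := Ω.eta_nonneg P w
  have hρ := Ω.rhoTr_nonneg P w
  set n := T.normU12 (w - ua) with hn
  have hn0 : 0 ≤ n := T.normU12_nonneg _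
  -- Coercivity and the residual bound give `c n² ≤ C' (η + ρ) n`; one factor `n` is cancelled.
  have h4 : n ≤ C' / c * (Ω.eta P w + Ω.rhoTr P w) := by
    rcases hn0.eq_or_lt with h0 | hpos
    · rw [← h0]
      positivity
    · rw [div_mul_eq_mul_div, le_div_iff₀ hc]
      have : c * n * n ≤ C' * (Ω.eta P w + Ω.rhoTr P w) * n := by linarith
      linarith [le_of_mul_le_mul_right this hpos]
  have h5 : |P.energy w - P.energy ua| ≤
      (2 * C * (C' / c) ^ 2 + 1) * (Ω.eta P w ^ 2 + Ω.rhoTr P w ^ 2) := by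
    calc _ ≤ C * n ^ 2 := h2
      _ ≤ C * (C' / c * (Ω.eta P w + Ω.rhoTr P w)) ^ 2 := by gcongr
      _ = C * (C' / c) ^ 2 * (Ω.eta P w + Ω.rhoTr P w) ^ 2 := by ring
      _ ≤ C * (C' / c) ^ 2 * (2 * (Ω.eta P w ^ 2 + Ω.rhoTr P w ^ 2)) := by
          gcongr
          exact add_sq_le
      _ ≤ _ := by nlinarith [sq_nonneg (Ω.eta P w), sq_nonneg (Ω.rhoTr P w)]
  have h6 : P.energy ua - d.blendedEnergy P m uh =
      -(P.energy w - P.energy ua) + d.muE P m uh := by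
    rw [Discretization.muE]
    ring
  rw [h6]
  refine (abs_add_le _ _).trans ?_
  rw [abs_neg]
  gcongr
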